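/- There is a universal constant $C$ such that the following holds. Let $n \ge 2$, $p \ge 1$, and let $N_1,\dots,N_m$ be semi-norms on $\mathbb R^n$; denote by $N$ the semi-norm with $N(x)^p = N_1(x)^p + \cdots + N_m(x)^p$. Suppose that for some numbers $K, S > 1$ the semi-norm $N$ is $K$-equivalent to a semi-norm $\mathscr N$ which is $\min(p,2)$-uniformly smooth with constant $S$; that is, there is $\lambda > 0$ with $\mathscr N(z) \le \lambda N(z) \le K \mathscr N(z)$ for all $z \in \mathbb R^n$, and, with $q = \min(p,2)$, \[ \frac{\mathscr N(x+y)^q + \mathscr N(x-y)^q}{2} \le \mathscr N(x)^q + \mathscr N(Sy)^q \qquad \text{for all } x,y \in \mathbb R^n. \] Then for every $\epsilon \in (0,1)$ there are weights $w_1,\dots,w_m \ge 0$, at most $C s$ of which are nonzero, such that \[ \Bigl| N(x)^p - \sum_{i=1}^m w_i N_i(x)^p \Bigr| \le \epsilon\, N(x)^p \qquad \text{for all } x \in \mathbb R^n, \] where \[ s = \begin{cases} \dfrac{K^p}{\epsilon^2}\, n\, \bigl(S \psi_n \log(n/\epsilon)\bigr)^p (\log n)^2 & \text{if } 1 \le p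 \le 2, \\[2ex] \dfrac{K^p S^p p^2}{\epsilon^2} \Bigl(\dfrac{n+p}{2}\Bigr)^{p/2} \bigl(\psi_n \log(n/\epsilon)\bigr)^2 (\log n)^2 & \text{if } p \ge 2 \end{cases} \] (for $p = 2$ both bounds hold). Here $\psi_n$ is the KLS constant on $\mathbb R^n$: the supremum of $\sqrt{C_P(\mu)}$ over all isotropic (mean zero, identity covariance) log-concave probability measures $\mu$ on $\mathbb R^n$, where $C_P(\mu)$ is the Poincaré constant, i.e. the least $c$ with $\operatorname{Var}_\mu(f) \le c \int \|\nabla f\|_2^2 \, d\mu$ for all $C^1$ functions $f \in L^2(\mu)$. -/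

import Mathlib

open MeasureTheory ProbabilityTheory
open scoped ENNReal NNReal

noncomputable section

/-- The semi-norm `N` with `N(x)^p = N_1(x)^p + ⋯ + N_m(x)^p`. -/
def lpSum {n m : ℕ} (p : ℝ) (hp : 1 ≤ p)
    (N : Fin m → Seminorm ℝ (EuclideanSpace ℝ (Fin n))) :
    Seminorm ℝ (EuclideanSpace ℝ (Fin n)) :=
  Seminorm.of (fun x => (∑ i, N i x ^ p) ^ (1 / p))
    (by
      intro x y
      have h0 : (0 : ℝ) ≤ p := by linarith
      calc (∑ i, N i (x + y) ^ p) ^ (1 / p)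
          ≤ (∑ i, (N i x + N i y) ^ p) ^ (1 / p) := by
            apply Real.rpow_le_rpow
            · exact Finset.sum_nonneg fun i _ => Real.rpow_nonneg (apply_nonneg _ _) _
            · exact Finset.sum_le_sum fun i _ =>
                Real.rpow_le_rpow (apply_nonneg _ _) (map_add_le_add _ _ _) h0
            · positivity
        _ ≤ _ := Real.Lp_add_le_of_nonneg Finset.univ hp
            (fun i _ => apply_nonneg _ _) (fun i _ => apply_nonneg _ _))
    (by
      intro a x
      have h0 : p ≠ 0 := by linarith
      have h : ∀ i, N i (a • x) ^ p = ‖a‖ ^ p * N i x ^ p := fun i => by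
        rw [map_smul_eq_mul, Real.mul_rpow (norm_nonneg _) (apply_nonneg _ _)]
      simp only [h]
      rw [← Finset.mul_sum, Real.mul_rpow (Real.rpow_nonneg (norm_nonneg _) _)
        (Finset.sum_nonneg fun i _ => Real.rpow_nonneg (apply_nonneg _ _) _),
        ← Real.rpow_mul (norm_nonneg _), mul_one_div_cancel h0, Real.rpow_one])

/-- `N` is `p`-uniformly smooth with constant `S`. -/
def IsUniformlySmooth {n : ℕ} (p S : ℝ) (N : Seminorm ℝ (EuclideanSpace ℝ (Fin n))) : Prop :=
  ∀ x y, (N (x + y) ^ p + N (x - y) ^ p) / 2 ≤ N x ^ p + N (S • y) ^ p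

/-- `N₁` and `N₂` are `K`-equivalent. -/
def IsKEquivalent {n : ℕ} (K : ℝ) (N₁ N₂ : Seminorm ℝ (EuclideanSpace ℝ (Fin n))) : Prop :=
  ∃ c : ℝ, 0 < c ∧ ∀ z, N₂ z ≤ c * N₁ z ∧ c * N₁ z ≤ K * N₂ z

/-- The function `∑ i, w i * N i ^ p`, with nonnegative weights of which at most `s` are nonzero,
is an `ε`-approximation of `N ^ p = ∑ i, N i ^ p`. -/
def IsSparseApprox {n m : ℕ} (p : ℝ) (hp : 1 ≤ p)
    (N : Fin m → Seminorm ℝ (EuclideanSpace ℝ (Fin n))) (s : ℝ≥0∞) (ε : ℝ)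
    (w : Fin m → ℝ) : Prop :=
  (∀ i, 0 ≤ w i) ∧
  ((Finset.univ.filter fun i => w i ≠ 0).card : ℝ≥0∞) ≤ s ∧
  ∀ x, |lpSum p hp N x ^ p - ∑ i, w i * N i x ^ p| ≤ ε * lpSum p hp N x ^ p

/-- `μ` has a log-concave density with respect to Lebesgue measure. (An isotropic log-concave
measure is not carried by a proper affine subspace, so it always has a density.) -/
def HasLogConcaveDensity {n : ℕ} (μ : Measure (EuclideanSpace ℝ (Fin n))) : Prop :=
  ∃ f : EuclideanSpace ℝ (Fin n) → ℝ, Measurable f ∧ (∀ x, 0 ≤ f x) ∧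
    (∀ x y, ∀ a b : ℝ, 0 ≤ a → 0 ≤ b → a + b = 1 →
      f x ^ a * f y ^ b ≤ f (a • x + b • y)) ∧
    μ = volume.withDensity fun x => ENNReal.ofReal (f x)

/-- `μ` has mean zero and identity covariance matrix. -/
def IsIsotropic {n : ℕ} (μ : Measure (EuclideanSpace ℝ (Fin n))) : Prop :=
  (∀ θ : EuclideanSpace ℝ (Fin n), ∫ x, inner ℝ x θ ∂μ = 0) ∧
  ∀ θ : EuclideanSpace ℝ (Fin n), ∫ x, inner ℝ x θ ^ 2 ∂μ = ‖θ‖ ^ 2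

/-- The Poincaré constant of `μ`: the least `c` with `Var_μ(f) ≤ c ∫ ‖∇f‖² dμ` for all `C¹`
functions `f` in `L²(μ)`. -/
def poincareConst {n : ℕ} (μ : Measure (EuclideanSpace ℝ (Fin n))) : ℝ≥0∞ :=
  sInf {c | ∀ f : EuclideanSpace ℝ (Fin n) → ℝ, ContDiff ℝ 1 f → MemLp f 2 μ →
    evariance f μ ≤ c * ∫⁻ x, ‖fderiv ℝ f x‖ₑ ^ 2 ∂μ}

/-- The KLS constant `ψ_n`: the supremum of the square roots of the Poincaré constants of all
isotropic log-concave probability measures on `ℝⁿ`. -/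
def klsConst (n : ℕ) : ℝ≥0∞ :=
  ⨆ (μ : Measure (EuclideanSpace ℝ (Fin n))) (_ : IsProbabilityMeasure μ)
    (_ : HasLogConcaveDensity μ) (_ : IsIsotropic μ), poincareConst μ ^ (1 / 2 : ℝ)

end

/-! ### The Prékopa–Leindler inequality -/

/-! Put q = min(p, 2) and rescale so that N' ≤ N ≤ K N' with N' q-uniformly smooth. Enlarge N' to a
smooth norm M which agrees with N' modulo the kernel, and let μ be the probability measure with
density proportional to exp(-M^q). Draw s indices independently with probabilities ρ_i proportional
to ∫ N_i^p dμ, and give each drawn index the weight 1/(s ρ_i). The result is an unbiased estimator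
of N^p; what must be shown is that some sample is accurate uniformly on {M ≤ 1, N ≤ 1}.

Symmetrization (`exists_sample`) replaces the error by Rademacher sums of the functions v_j^p / s,
where v_j is ρ_i^(-1/p) N_i for the j-th drawn index i. These are bounded by chaining
(`exists_radSum_seminorm_bound`) in the seminorm V = max_j v_j. Two facts about μ supply the nets.
First, uniform smoothness acts as a Cameron–Martin inequality: translating a symmetric set by x
costs at most a factor exp(-M(Sx)^q) of its mass (`gibbs_translate_ge`). Packing disjoint translates
of a V-ball then gives a dual Sudakov estimate (`exists_net`). Second, V = O(log s) · Y on a set of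
mass at least 1/2 (`half_le_gibbs_sup_le`), where Y^p bounds ∫ N^p dμ. This follows from a union
bound and Borell's lemma, which rests on Prékopa–Leindler. Below the scale where the entropy reaches
n, the nets are refined by volume. So about log n levels contribute equally and the rest decay
geometrically, which produces the factor log n.

Since Borell's exponential tails already suffice, the KLS constant enters only through ψ_n ≥ 1,
witnessed by the standard Gaussian (`one_le_klsConst`).

The sampling condition contains log(2s) on its right side. It is solved by `exists_sample_size` as
soon as the logarithm of the target size is O(p² log(n/ε)), which holds if K S ≤ 44(n + p). If K S
is larger, the target exceeds what the triangle inequality alone provides: every seminorm is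
1-uniformly smooth with constant 1 (`exists_sparse_crude`). -/

open Set in
theorem volume_add_volume_le_of_isCompact {A B : Set ℝ} (hA : IsCompact A) (hB : IsCompact B)
    (hA0 : A.Nonempty) (hB0 : B.Nonempty) {C : Set ℝ}
    (h : ∀ a ∈ A, ∀ b ∈ B, a + b ∈ C) : volume A + volume B ≤ volume C := by
  obtain ⟨a, ha, hamax⟩ := hA.exists_isGreatest hA0
  obtain ⟨b, hb, hbmin⟩ := hB.exists_isLeast hB0
  -- With a = max A and b = min B, the translates A + b and a + B both lie in C and meet at most in
  -- the point a + b.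
  have h1 : volume (Set.image (fun x => x + b) A) = volume A := by
    simp
  have h2 : volume (Set.image (fun x => a + x) B) = volume B := by
    simp
  rw [← h1, ← h2]
  have hmA : MeasurableSet (Set.image (fun x => x + b) A) :=
    (hA.image (by fun_prop)).measurableSet
  rw [← measure_union₀' hmA.nullMeasurableSet]
  · refine measure_mono ?_
    rintro _ (⟨x, hx, rfl⟩ | ⟨x, hx, rfl⟩)
    · exact h x hx b hb
    · exact h a ha x hx
  · refine measure_mono_null (t := {a + b}) ?_ (by simp)
    rintro _ ⟨⟨x, hx, rfl⟩, ⟨y, hy, hxy⟩⟩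
    have := hamax hx
    have := hbmin hy
    simp only [mem_singleton_iff]
    simp only at hxy
    linarith

/-- The one-dimensional Brunn–Minkowski inequality. -/
theorem volume_add_volume_le {A B : Set ℝ} (hA : MeasurableSet A) (hB : MeasurableSet B)
    (hA0 : A.Nonempty) (hB0 : B.Nonempty) {C : Set ℝ}
    (h : ∀ a ∈ A, ∀ b ∈ B, a + b ∈ C) : volume A + volume B ≤ volume C := by
  have key : ∀ A : Set ℝ, MeasurableSet A → A.Nonempty → ∀ r < volume A,
      ∃ K ⊆ A, IsCompact K ∧ K.Nonempty ∧ r < volume K := by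
    intro A hA _ r hr
    obtain ⟨K, hK, hKc, hrK⟩ := hA.exists_lt_isCompact hr
    refine ⟨K, hK, hKc, ?_, hrK⟩
    by_contra h
    rw [Set.not_nonempty_iff_eq_empty] at h
    simp [h] at hrK
  have key' : ∀ A : Set ℝ, MeasurableSet A → A.Nonempty → ∀ c : ℝ≥0∞,
      (∀ K ⊆ A, IsCompact K → K.Nonempty → volume K ≤ c) → volume A ≤ c := by
    intro A hA hA0 c hc
    refine le_of_forall_lt fun r hr => ?_
    obtain ⟨K, hK, hKc, hK0, hrK⟩ := key A hA hA0 r hr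
    exact hrK.trans_le (hc K hK hKc hK0)
  by_cases hCtop : volume C = ⊤
  · simp [hCtop]
  have h1 : ∀ L ⊆ B, IsCompact L → L.Nonempty → volume A ≤ volume C - volume L := by
    intro L hL hLc hL0
    refine key' A hA hA0 _ fun K hK hKc hK0 => ?_
    refine ENNReal.le_sub_of_add_le_right ?_ ?_
    · exact hLc.measure_lt_top.ne
    · exact volume_add_volume_le_of_isCompact hKc hLc hK0 hL0
        fun a ha b hb => h a (hK ha) b (hL hb)
  obtain ⟨b, hb⟩ := hB0
  have hAC : volume A ≤ volume C := by
    have := h1 {b} (by simpa using hb) isCompact_singleton (by simp)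
    simpa using this
  have hAtop : volume A ≠ ⊤ := (hAC.trans_lt (lt_top_iff_ne_top.mpr hCtop)).ne
  have h2 : volume B ≤ volume C - volume A := by
    refine key' B hB ⟨b, hb⟩ _ fun L hL hLc hL0 => ?_
    refine ENNReal.le_sub_of_add_le_left hAtop ?_
    have hh := h1 L hL hLc hL0
    -- Subtraction is truncated, so `hh` is informative only when L is no larger than C. The other
    -- case is impossible, since C contains a translate of L.
    by_cases hle : volume L ≤ volume C
    · calc volume A + volume L ≤ (volume C - volume L) + volume L := by gcongr
        _ = volume C := tsub_add_cancel_of_le hle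
    · exfalso
      obtain ⟨a, ha⟩ := hA0
      have := volume_add_volume_le_of_isCompact (isCompact_singleton (x := a)) hLc (by simp) hL0
        (C := C) (fun a' ha' b hb => h a'
          (by simp only [Set.mem_singleton_iff] at ha'; simpa [ha'] using ha) b (hL hb))
      simp at this
      exact hle this
  calc volume A + volume B ≤ volume A + (volume C - volume A) := by gcongr
    _ = volume C := add_tsub_cancel_of_le hAC

theorem ENNReal.rpow_mul_rpow_le_add {a b : ℝ} (ha : 0 < a) (hb : 0 < b) (hab : a + b = 1)
    (x y : ℝ≥0∞) :
    x ^ a * y ^ b ≤ ENNReal.ofReal a * x + ENNReal.ofReal b * y := by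
  by_cases hx : x = ⊤
  · have : ENNReal.ofReal a * x = ⊤ := by rw [hx, ENNReal.mul_top]; simpa using ha
    simp [this]
  by_cases hy : y = ⊤
  · have : ENNReal.ofReal b * y = ⊤ := by rw [hy, ENNReal.mul_top]; simpa using hb
    simp [this]
  lift x to ℝ≥0 using hx
  lift y to ℝ≥0 using hy
  have h := NNReal.geom_mean_le_arith_mean2_weighted a.toNNReal b.toNNReal x y
    (by rw [← Real.toNNReal_add ha.le hb.le, hab]; simp)
  rw [Real.coe_toNNReal _ ha.le, Real.coe_toNNReal _ hb.le] at h
  rw [← ENNReal.coe_rpow_of_nonneg _ ha.le, ← ENNReal.coe_rpow_of_nonneg _ hb.le, ENNReal.ofReal,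
    ENNReal.ofReal]
  exact_mod_cast h

/-- Layer-cake formula: each value c is the length of {t > 0 : t < c}, infinite values included, and
Tonelli exchanges the integrals. -/
theorem lintegral_eq_lintegral_volume_lt {α : Type*} [MeasurableSpace α] {μ : Measure α} [SFinite μ]
    {f : α → ℝ≥0∞} (hf : Measurable f) :
    ∫⁻ x, f x ∂μ = ∫⁻ t in Set.Ioi (0 : ℝ), μ {x | ENNReal.ofReal t < f x} := by
  have h1 : ∀ c : ℝ≥0∞, c = ∫⁻ t in Set.Ioi (0 : ℝ),
      Set.indicator {t : ℝ | ENNReal.ofReal t < c} (fun _ => (1 : ℝ≥0∞)) t := by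
    intro c
    have hm : MeasurableSet {t : ℝ | ENNReal.ofReal t < c} :=
      measurableSet_lt ENNReal.measurable_ofReal measurable_const
    rw [lintegral_indicator_const hm, one_mul, Measure.restrict_apply hm]
    by_cases hc : c = ⊤
    · have : {t : ℝ | ENNReal.ofReal t < c} ∩ Set.Ioi 0 = Set.Ioi 0 := by
        ext t; simp [hc]
      rw [this, hc]; simp
    · have : {t : ℝ | ENNReal.ofReal t < c} ∩ Set.Ioi 0 = Set.Ioo 0 c.toReal := by
        ext t
        simp only [Set.mem_inter_iff, Set.mem_ofPred_eq, Set.mem_Ioi, Set.mem_Ioo]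
        constructor
        · rintro ⟨h, h'⟩
          exact ⟨h', (ENNReal.ofReal_lt_iff_lt_toReal h'.le hc).1 h⟩
        · rintro ⟨h, h'⟩
          exact ⟨(ENNReal.ofReal_lt_iff_lt_toReal h.le hc).2 h', h⟩
      rw [this]; simp [ENNReal.ofReal_toReal hc]
  have hS : MeasurableSet {z : α × ℝ | ENNReal.ofReal z.2 < f z.1} :=
    measurableSet_lt (by fun_prop) (by fun_prop)
  calc ∫⁻ x, f x ∂μ = ∫⁻ x, (∫⁻ t in Set.Ioi (0 : ℝ),
      Set.indicator {t : ℝ | ENNReal.ofReal t < f x} (fun _ => (1 : ℝ≥0∞)) t) ∂μ :=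
        lintegral_congr fun x => h1 _
    _ = ∫⁻ t in Set.Ioi (0 : ℝ), ∫⁻ x,
      Set.indicator {t : ℝ | ENNReal.ofReal t < f x} (fun _ => (1 : ℝ≥0∞)) t ∂μ := by
        refine lintegral_lintegral_swap ?_
        refine Measurable.aemeasurable ?_
        exact (measurable_const (a := (1 : ℝ≥0∞))).indicator hS
    _ = _ := by
        refine lintegral_congr fun t => ?_
        have hm : MeasurableSet {x | ENNReal.ofReal t < f x} :=
          measurableSet_lt measurable_const hf
        have : ∀ x, Set.indicator {t : ℝ | ENNReal.ofReal t < f x} (fun _ => (1 : ℝ≥0∞)) t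
            = Set.indicator {x | ENNReal.ofReal t < f x} (fun _ => 1) x := by
          intro x; simp [Set.indicator]
        simp_rw [this]
        rw [lintegral_indicator_const hm, one_mul]

/-- Equal suprema make the superlevel sets of f and g nonempty for the same heights t < 1. At such
heights a{f > t} + b{g > t} lies in {h > t}; Brunn–Minkowski compares the lengths and the layer-cake
formula integrates over t. -/
theorem lintegral_add_le_of_iSup_eq_one {a b : ℝ} (ha : 0 < a) (hb : 0 < b) (hab : a + b = 1)
    {f g h : ℝ → ℝ≥0∞} (hf : Measurable f) (hg : Measurable g) (hh : Measurable h)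
    (hf1 : ⨆ x, f x = 1) (hg1 : ⨆ x, g x = 1)
    (H : ∀ x y, f x ^ a * g y ^ b ≤ h (a * x + b * y)) :
    ENNReal.ofReal a * (∫⁻ x, f x) + ENNReal.ofReal b * (∫⁻ x, g x) ≤ ∫⁻ x, h x := by
  rw [lintegral_eq_lintegral_volume_lt hf, lintegral_eq_lintegral_volume_lt hg,
    lintegral_eq_lintegral_volume_lt hh]
  have mf : ∀ φ : ℝ → ℝ≥0∞, Measurable fun t : ℝ => volume {x | ENNReal.ofReal t < φ x} := by
    intro φ
    have : Antitone fun t : ℝ => volume {x | ENNReal.ofReal t < φ x} := by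
      intro s t hst
      exact measure_mono fun x hx => (ENNReal.ofReal_le_ofReal hst).trans_lt hx
    exact this.measurable
  rw [← lintegral_const_mul _ (mf f), ← lintegral_const_mul _ (mf g),
    ← lintegral_add_left ((mf f).const_mul _)]
  refine setLIntegral_mono' measurableSet_Ioi fun t ht => ?_
  have ht0 : 0 < t := ht
  have hsc : ∀ (c : ℝ) (_ : 0 < c) (A : Set ℝ),
      volume (Set.image (fun x => c * x) A) = ENNReal.ofReal c * volume A := by
    intro c hc A
    have := Measure.addHaar_smul volume c A
    simp only [Module.finrank_self, pow_one, abs_of_pos hc] at this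
    rw [← this]
    rfl
  rcases lt_or_ge t 1 with ht1 | ht1
  · have hne : ∀ φ : ℝ → ℝ≥0∞, ⨆ x, φ x = 1 → {x | ENNReal.ofReal t < φ x}.Nonempty := by
      intro φ hφ
      have : ENNReal.ofReal t < ⨆ x, φ x := by rw [hφ]; simpa using ht1
      exact lt_iSup_iff.1 this
    have hms : ∀ (c : ℝ) (_ : 0 < c) (A : Set ℝ), MeasurableSet A →
        MeasurableSet (Set.image (fun x => c * x) A) := by
      intro c hc A hA
      exact (Homeomorph.mulLeft₀ c hc.ne').toMeasurableEquiv.measurableSet_image.2 hA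
    rw [← hsc a ha, ← hsc b hb]
    refine volume_add_volume_le (hms a ha _ (measurableSet_lt measurable_const hf))
      (hms b hb _ (measurableSet_lt measurable_const hg)) ((hne f hf1).image _)
      ((hne g hg1).image _) ?_
    rintro _ ⟨x, hx, rfl⟩ _ ⟨y, hy, rfl⟩
    refine lt_of_lt_of_le ?_ (H x y)
    simp only [Set.mem_ofPred_eq] at hx hy
    have e : ENNReal.ofReal t = ENNReal.ofReal t ^ a * ENNReal.ofReal t ^ b := by
      rw [← ENNReal.rpow_add_of_nonneg _ _ ha.le hb.le, hab, ENNReal.rpow_one]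
    rw [e]
    exact ENNReal.mul_lt_mul (ENNReal.rpow_lt_rpow hx ha) (ENNReal.rpow_lt_rpow hy hb)
  · have he : ∀ φ : ℝ → ℝ≥0∞, ⨆ x, φ x = 1 → {x | ENNReal.ofReal t < φ x} = ∅ := by
      intro φ hφ
      ext x
      simp only [Set.mem_ofPred_eq, Set.mem_empty_iff_false, iff_false, not_lt]
      calc φ x ≤ ⨆ x, φ x := le_iSup φ x
        _ = 1 := hφ
        _ ≤ _ := by simpa using ht1
    simp [he f hf1, he g hg1]

/-- Dividing f and g by their suprema reduces to the normalized inequality. Weighted AM–GM turns its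
sum into a product, and the scaling factors cancel by homogeneity. -/
theorem prekopaLeindler_real_of_bounded {a b : ℝ} (ha : 0 < a) (hb : 0 < b) (hab : a + b = 1)
    {f g h : ℝ → ℝ≥0∞} (hf : Measurable f) (hg : Measurable g) (hh : Measurable h)
    (hf1 : ⨆ x, f x ≠ ⊤) (hg1 : ⨆ x, g x ≠ ⊤)
    (H : ∀ x y, f x ^ a * g y ^ b ≤ h (a * x + b * y)) :
    (∫⁻ x, f x) ^ a * (∫⁻ x, g x) ^ b ≤ ∫⁻ x, h x := by
  set A := ⨆ x, f x with hA
  set B := ⨆ x, g x with hB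
  by_cases hA0 : A = 0
  · have : ∀ x, f x = 0 := by simpa [hA0] using hA.symm
    simp [this, ha]
  by_cases hB0 : B = 0
  · have : ∀ x, g x = 0 := by simpa [hB0] using hB.symm
    simp [this, hb]
  have key := lintegral_add_le_of_iSup_eq_one ha hb hab (f := fun x => A⁻¹ * f x)
    (g := fun x => B⁻¹ * g x) (h := fun x => (A⁻¹ ^ a * B⁻¹ ^ b) * h x)
    (hf.const_mul _) (hg.const_mul _) (hh.const_mul _)
    (by rw [← ENNReal.mul_iSup, ← hA, ENNReal.inv_mul_cancel hA0 hf1])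
    (by rw [← ENNReal.mul_iSup, ← hB, ENNReal.inv_mul_cancel hB0 hg1])
    (by
      intro x y
      rw [ENNReal.mul_rpow_of_nonneg _ _ ha.le, ENNReal.mul_rpow_of_nonneg _ _ hb.le,
        mul_mul_mul_comm]
      gcongr
      exact H x y)
  have key2 := (ENNReal.rpow_mul_rpow_le_add ha hb hab _ _).trans key
  rw [lintegral_const_mul _ hf, lintegral_const_mul _ hg, lintegral_const_mul _ hh,
    ENNReal.mul_rpow_of_nonneg _ _ ha.le, ENNReal.mul_rpow_of_nonneg _ _ hb.le,
        mul_mul_mul_comm] at key2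
  have hc0 : A⁻¹ ^ a * B⁻¹ ^ b ≠ 0 := by
    refine mul_ne_zero ?_ ?_
    · simp [ENNReal.rpow_eq_zero_iff, hf1, hA0]
    · simp [ENNReal.rpow_eq_zero_iff, hg1, hB0]
  have hctop : A⁻¹ ^ a * B⁻¹ ^ b ≠ ⊤ := by
    refine ENNReal.mul_ne_top ?_ ?_
    · exact ENNReal.rpow_ne_top_of_nonneg ha.le (by simpa using hA0)
    · exact ENNReal.rpow_ne_top_of_nonneg hb.le (by simpa using hB0)
  exact (ENNReal.mul_le_mul_iff_right hc0 hctop).1 key2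

theorem prekopaLeindler_real {a b : ℝ} (ha : 0 < a) (hb : 0 < b) (hab : a + b = 1)
    {f g h : ℝ → ℝ≥0∞} (hf : Measurable f) (hg : Measurable g) (hh : Measurable h)
    (H : ∀ x y, f x ^ a * g y ^ b ≤ h (a * x + b * y)) :
    (∫⁻ x, f x) ^ a * (∫⁻ x, g x) ^ b ≤ ∫⁻ x, h x := by
  have tr : ∀ φ : ℝ → ℝ≥0∞, Measurable φ →
      Filter.Tendsto (fun k : ℕ => ∫⁻ x, min (φ x) k) Filter.atTop (nhds (∫⁻ x, φ x)) := by
    intro φ hφ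
    refine lintegral_tendsto_of_tendsto_of_monotone (fun k => by fun_prop) ?_ ?_
    · filter_upwards with x k l hkl
      exact min_le_min le_rfl (by exact_mod_cast hkl)
    · filter_upwards with x
      have := (tendsto_const_nhds (x := φ x)).min ENNReal.tendsto_nat_nhds_top
      simpa using this
  have hb' : ∀ (φ : ℝ → ℝ≥0∞) (k : ℕ), ⨆ x, min (φ x) (k : ℝ≥0∞) ≠ ⊤ := by
    intro φ k
    refine ((iSup_le fun x => min_le_right _ _).trans_lt (ENNReal.natCast_lt_top k)).ne
  have key : ∀ k l : ℕ, (∫⁻ x, min (f x) k) ^ a * (∫⁻ x, min (g x) l) ^ b ≤ ∫⁻ x, h x := by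
    intro k l
    refine prekopaLeindler_real_of_bounded ha hb hab (by fun_prop) (by fun_prop) hh (hb' f k)
      (hb' g l) fun x y => le_trans ?_ (H x y)
    gcongr <;> exact min_le_left _ _
  -- Vanishing integrals are set aside so that the limit of the product of truncated integrals never
  -- has the form 0 · ∞.
  by_cases hf0 : ∫⁻ x, f x = 0
  · simp [hf0, ha]
  by_cases hg0 : ∫⁻ x, g x = 0
  · simp [hg0, hb]
  have t1 := ((ENNReal.continuous_rpow_const (y := a)).tendsto _).comp (tr f hf)
  have t2 := ((ENNReal.continuous_rpow_const (y := b)).tendsto _).comp (tr g hg)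
  have t3 := ENNReal.Tendsto.mul t1 (Or.inl (by simp [ENNReal.rpow_eq_zero_iff, hf0, ha.not_gt])) t2
    (Or.inl (by simp [ENNReal.rpow_eq_zero_iff, hg0, hb.not_gt]))
  exact le_of_tendsto' t3 fun k => key k k

/-- Induction on the dimension: after Fubini, the inequality for the n-dimensional sections is
exactly the hypothesis of the one-dimensional inequality for the partial integrals. -/
theorem prekopaLeindler_pi {a b : ℝ} (ha : 0 < a) (hb : 0 < b) (hab : a + b = 1) (n : ℕ)
    {f g h : (Fin n → ℝ) → ℝ≥0∞} (hf : Measurable f) (hg : Measurable g) (hh : Measurable h)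
    (H : ∀ x y, f x ^ a * g y ^ b ≤ h (a • x + b • y)) :
    (∫⁻ x, f x) ^ a * (∫⁻ x, g x) ^ b ≤ ∫⁻ x, h x := by
  induction n with
  | zero =>
    have : ∀ φ : (Fin 0 → ℝ) → ℝ≥0∞, ∫⁻ x, φ x = φ 0 := by
      intro φ
      rw [volume_pi, Measure.pi_of_empty _ 0]
      simp
    simp only [this]
    simpa using H 0 0
  | succ n ih =>
    let e := (MeasurableEquiv.piFinSuccAbove (fun _ : Fin (n + 1) => ℝ) 0).symm
    have he : MeasurePreserving e :=
      (volume_preserving_piFinSuccAbove (fun _ : Fin (n + 1) => ℝ) 0).symm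
    have hlin : ∀ (t u : ℝ) (x y : Fin n → ℝ),
        e (a * t + b * u, a • x + b • y) = a • e (t, x) + b • e (u, y) := by
      intro t u x y
      ext i
      refine Fin.cases ?_ (fun i => ?_) i <;> simp [e, MeasurableEquiv.piFinSuccAbove]
    have I : ∀ φ : (Fin (n + 1) → ℝ) → ℝ≥0∞, Measurable φ →
        ∫⁻ x, φ x = ∫⁻ t : ℝ, ∫⁻ y : Fin n → ℝ, φ (e (t, y)) := by
      intro φ hφ
      rw [← he.lintegral_comp hφ]
      exact lintegral_prod _ (hφ.comp e.measurable).aemeasurable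
    have M : ∀ φ : (Fin (n + 1) → ℝ) → ℝ≥0∞, Measurable φ →
        Measurable fun t : ℝ => ∫⁻ y : Fin n → ℝ, φ (e (t, y)) := fun φ hφ =>
      Measurable.lintegral_prod_right' (f := fun z => φ (e z)) (hφ.comp e.measurable)
    rw [I f hf, I g hg, I h hh]
    refine prekopaLeindler_real ha hb hab (M f hf) (M g hg) (M h hh) fun t u => ?_
    have ms : ∀ (φ : (Fin (n + 1) → ℝ) → ℝ≥0∞) (t : ℝ), Measurable φ →
        Measurable fun y : Fin n → ℝ => φ (e (t, y)) := fun φ t hφ =>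
      hφ.comp (e.measurable.comp (by fun_prop))
    refine ih (ms f _ hf) (ms g _ hg) (ms h _ hh) fun x y => ?_
    rw [hlin]
    exact H _ _

/-- The Prékopa–Leindler inequality. -/
theorem prekopaLeindler {a b : ℝ} (ha : 0 < a) (hb : 0 < b) (hab : a + b = 1) {n : ℕ}
    {f g h : EuclideanSpace ℝ (Fin n) → ℝ≥0∞} (hf : Measurable f) (hg : Measurable g)
    (hh : Measurable h) (H : ∀ x y, f x ^ a * g y ^ b ≤ h (a • x + b • y)) :
    (∫⁻ x, f x) ^ a * (∫⁻ x, g x) ^ b ≤ ∫⁻ x, h x := by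
  have hm := (PiLp.volume_preserving_toLp (Fin n)).measurable
  rw [← (PiLp.volume_preserving_toLp (Fin n)).lintegral_comp hf,
    ← (PiLp.volume_preserving_toLp (Fin n)).lintegral_comp hg,
    ← (PiLp.volume_preserving_toLp (Fin n)).lintegral_comp hh]
  exact prekopaLeindler_pi ha hb hab n (hf.comp hm) (hg.comp hm) (hh.comp hm)
    fun x y => by simpa using H _ _

/-! ### The probability measure with density proportional to `exp (-M ^ q)` -/

section Gibbs

open scoped Pointwise

variable {n : ℕ}

theorem Seminorm.continuous_euclidean (M : Seminorm ℝ (EuclideanSpace ℝ (Fin n))) :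
    Continuous M := by
  rw [← continuousOn_univ]
  exact M.convexOn.continuousOn isOpen_univ

theorem Seminorm.measurable_euclidean (M : Seminorm ℝ (EuclideanSpace ℝ (Fin n))) :
    Measurable M := M.continuous_euclidean.measurable

/-- Integration of a function of a norm in polar coordinates. -/
theorem exists_integral_comp_norm {E : Type*} [AddCommGroup E] [Module ℝ E]
    [FiniteDimensional ℝ E] [mE : MeasurableSpace E]
    [tE : TopologicalSpace E] [IsTopologicalAddGroup E] [BorelSpace E] [T2Space E]
    [ContinuousSMul ℝ E] (μ : Measure E) [μ.IsAddHaarMeasure] {g : E → ℝ} (h1 : g 0 = 0)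
    (h2 : ∀ x, g (-x) = g x) (h3 : ∀ x y, g (x + y) ≤ g x + g y) (h4 : ∀ {x}, g x = 0 → x = 0)
    (h5 : ∀ r x, g (r • x) ≤ |r| * (g x)) (hE : 1 ≤ Module.finrank ℝ E) :
    ∃ c : ℝ, 0 < c ∧ ∀ f : ℝ → ℝ,
      (IntegrableOn (fun y : ℝ => y ^ (Module.finrank ℝ E - 1) * f y) (Set.Ioi 0) →
        Integrable (fun x => f (g x)) μ) ∧
      ∫ x, f (g x) ∂μ = c * ∫ y in Set.Ioi (0 : ℝ), y ^ (Module.finrank ℝ E - 1) * f y := by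
  -- F is E with g as its norm. In finite dimension the identity is a homeomorphism, so the image of
  -- μ is a Haar measure on F and the polar formula for norms applies.
  let F : Type _ := E
  let p : AddGroupNorm F := ⟨⟨g, h1, h3, h2⟩, fun x hx ↦ h4 hx⟩
  let : NormedAddCommGroup F := AddGroupNorm.toNormedAddCommGroup p
  let : NormedSpace ℝ F := { norm_smul_le := fun _ _ ↦ h5 _ _ }
  let : TopologicalSpace F := UniformSpace.toTopologicalSpace
  let : MeasurableSpace F := borel F
  have : BorelSpace F := { measurable_eq := rfl }
  let φ := @LinearEquiv.toContinuousLinearEquiv ℝ _ E _ _ tE _ _ F _ _ _ _ _ _ _ _ _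
    (LinearEquiv.refl ℝ E : E ≃ₗ[ℝ] F)
  let ν : Measure F := @Measure.map E F mE _ φ μ
  let ψ := @Homeomorph.toMeasurableEquiv E F tE mE _ _ _ _
      (@ContinuousLinearEquiv.toHomeomorph ℝ ℝ _ _ _ _ _ _ E tE _ F _ _ _ _ φ)
  have hψ : @MeasurePreserving E F mE _ ψ μ ν :=
      @Measurable.measurePreserving E F mE _ ψ (@MeasurableEquiv.measurable E F mE _ ψ) _
  have hdim : Module.finrank ℝ F = Module.finrank ℝ E := rfl
  have : Nontrivial F := Module.nontrivial_of_finrank_pos (R := ℝ) (by omega)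
  refine ⟨Module.finrank ℝ E * ν.real (Metric.ball 0 1), ?_, fun f => ⟨fun hf => ?_, ?_⟩⟩
  · have : 0 < ν.real (Metric.ball 0 1) :=
      ENNReal.toReal_pos (Metric.measure_ball_pos _ _ one_pos).ne' measure_ball_lt_top.ne
    have : (0 : ℝ) < Module.finrank ℝ E := by exact_mod_cast hE
    positivity
  · have h1 : Integrable (fun x : F => f ‖x‖) ν := by
      rw [integrable_fun_norm_addHaar ν, hdim]
      simpa using hf
    exact (hψ.integrable_comp_emb (@MeasurableEquiv.measurableEmbedding E F mE _ ψ)).2 h1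
  · have h1 := integral_fun_norm_addHaar ν f
    rw [hdim] at h1
    rw [← hψ.integral_comp'] at h1
    rw [nsmul_eq_mul, smul_eq_mul, ← mul_assoc] at h1
    exact h1

theorem exists_integral_comp_seminorm (hn : 1 ≤ n) (M : Seminorm ℝ (EuclideanSpace ℝ (Fin n)))
    (hM : ∀ x, M x = 0 → x = 0) :
    ∃ c : ℝ, 0 < c ∧ ∀ f : ℝ → ℝ,
      (IntegrableOn (fun y : ℝ => y ^ (n - 1) * f y) (Set.Ioi 0) →
        Integrable fun x => f (M x)) ∧
      ∫ x, f (M x) = c * ∫ y in Set.Ioi (0 : ℝ), y ^ (n - 1) * f y := by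
  have := exists_integral_comp_norm (volume : Measure (EuclideanSpace ℝ (Fin n))) (g := M)
    (map_zero M) (map_neg_eq_map M) (map_add_le_add M) (fun {x} => hM x)
    (fun r x => (map_smul_eq_mul M r x).le) (by simpa using hn)
  simpa only [finrank_euclideanSpace_fin] using this

theorem integrable_rpow_mul_exp_neg_seminorm (hn : 1 ≤ n)
    {M : Seminorm ℝ (EuclideanSpace ℝ (Fin n))}
    (hM : ∀ x, M x = 0 → x = 0) {q : ℝ} (hq : 0 < q) {r : ℝ} (hr : 0 ≤ r) :
    Integrable fun x => M x ^ r * Real.exp (-(M x) ^ q) := by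
  obtain ⟨c, -, hc⟩ := exists_integral_comp_seminorm hn M hM
  refine (hc fun t => t ^ r * Real.exp (-t ^ q)).1 ?_
  have h1 : (0 : ℝ) ≤ ((n - 1 : ℕ) : ℝ) := by positivity
  refine (integrableOn_rpow_mul_exp_neg_rpow (s := (n - 1 : ℕ) + r) (by linarith) hq).congr_fun
    (fun y hy => ?_) measurableSet_Ioi
  have hy : (0 : ℝ) < y := hy
  simp only [Real.rpow_add hy, Real.rpow_natCast, mul_assoc]

/-- In polar coordinates both integrals are one-dimensional Gamma integrals with the same geometric
constant, which cancels. -/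
theorem integral_rpow_mul_exp_neg_seminorm (hn : 1 ≤ n)
    {M : Seminorm ℝ (EuclideanSpace ℝ (Fin n))}
    (hM : ∀ x, M x = 0 → x = 0) {q : ℝ} (hq : 0 < q) {r : ℝ} (hr : 0 ≤ r) :
    ∫ x, M x ^ r * Real.exp (-(M x) ^ q)
      = Real.Gamma ((n + r) / q) / Real.Gamma (n / q) * ∫ x, Real.exp (-(M x) ^ q) := by
  obtain ⟨c, -, hc⟩ := exists_integral_comp_seminorm hn M hM
  have hn0 : (0 : ℝ) < n := by exact_mod_cast hn
  have h1 : (0 : ℝ) ≤ ((n - 1 : ℕ) : ℝ) := by positivity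
  have h2 : ((n - 1 : ℕ) : ℝ) = n - 1 := by rw [Nat.cast_sub hn, Nat.cast_one]
  have e1 : ∀ r : ℝ, 0 ≤ r → ∫ y in Set.Ioi (0 : ℝ), y ^ (n - 1) * (y ^ r * Real.exp (-y ^ q))
      = (1 / q) * Real.Gamma ((n + r) / q) := by
    intro r hr
    have := integral_rpow_mul_exp_neg_rpow (p := q) (q := (n - 1 : ℕ) + r) hq (by linarith)
    rw [show ((n - 1 : ℕ) : ℝ) + r + 1 = n + r by rw [h2]; ring] at this
    rw [← this]
    refine setIntegral_congr_fun measurableSet_Ioi fun y hy => ?_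
    have hy : (0 : ℝ) < y := hy
    simp only [Real.rpow_add hy, Real.rpow_natCast, mul_assoc]
  have e0 := e1 0 le_rfl
  simp only [Real.rpow_zero, one_mul, add_zero] at e0
  rw [(hc fun t => t ^ r * Real.exp (-t ^ q)).2, (hc fun t => Real.exp (-t ^ q)).2, e1 r hr, e0]
  have : 0 < Real.Gamma (n / q) := Real.Gamma_pos_of_pos (by positivity)
  field_simp

/-- The partition function of the norm `M`. -/
noncomputable def gibbsMass (M : Seminorm ℝ (EuclideanSpace ℝ (Fin n))) (q : ℝ) : ℝ :=
  ∫ x, Real.exp (-(M x) ^ q)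

/-- The probability density proportional to `exp (-M ^ q)`. -/
noncomputable def gibbsDensity (M : Seminorm ℝ (EuclideanSpace ℝ (Fin n))) (q : ℝ)
    (x : EuclideanSpace ℝ (Fin n)) : ℝ :=
  Real.exp (-(M x) ^ q) / gibbsMass M q

/-- The probability measure with density proportional to `exp (-M ^ q)`. -/
noncomputable def gibbs (M : Seminorm ℝ (EuclideanSpace ℝ (Fin n))) (q : ℝ) :
    Measure (EuclideanSpace ℝ (Fin n)) :=
  volume.withDensity fun x => ENNReal.ofReal (gibbsDensity M q x)

variable {M : Seminorm ℝ (EuclideanSpace ℝ (Fin n))} {q : ℝ}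

theorem integrable_exp_neg_seminorm (hn : 1 ≤ n) (hM : ∀ x, M x = 0 → x = 0) (hq : 0 < q) :
    Integrable fun x => Real.exp (-(M x) ^ q) := by
  simpa using integrable_rpow_mul_exp_neg_seminorm hn hM hq (r := 0) le_rfl

theorem gibbsMass_pos (hn : 1 ≤ n) (hM : ∀ x, M x = 0 → x = 0) (hq : 0 < q) :
    0 < gibbsMass M q :=
  integral_exp_pos (integrable_exp_neg_seminorm hn hM hq)

theorem gibbsDensity_nonneg (x : EuclideanSpace ℝ (Fin n)) : 0 ≤ gibbsDensity M q x :=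
  div_nonneg (Real.exp_pos _).le (integral_nonneg fun _ => (Real.exp_pos _).le)

theorem measurable_gibbsDensity : Measurable (gibbsDensity M q) := by
  have := M.measurable_euclidean
  unfold gibbsDensity
  fun_prop

theorem integrable_gibbsDensity (hn : 1 ≤ n) (hM : ∀ x, M x = 0 → x = 0) (hq : 0 < q) :
    Integrable (gibbsDensity M q) :=
  (integrable_exp_neg_seminorm hn hM hq).div_const _

theorem gibbs_real_apply {B : Set (EuclideanSpace ℝ (Fin n))} (hB : MeasurableSet B) :
    (gibbs M q).real B = ∫ x in B, gibbsDensity M q x := by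
  rw [measureReal_def, gibbs, withDensity_apply _ hB, integral_eq_lintegral_of_nonneg_ae]
  · exact Filter.Eventually.of_forall fun x => gibbsDensity_nonneg x
  · exact measurable_gibbsDensity.aestronglyMeasurable

theorem isProbabilityMeasure_gibbs (hn : 1 ≤ n) (hM : ∀ x, M x = 0 → x = 0) (hq : 0 < q) :
    IsProbabilityMeasure (gibbs M q) := by
  constructor
  rw [gibbs, withDensity_apply _ MeasurableSet.univ, Measure.restrict_univ,
    ← ofReal_integral_eq_lintegral_ofReal (integrable_gibbsDensity hn hM hq)
      (Filter.Eventually.of_forall fun x => gibbsDensity_nonneg x)]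
  unfold gibbsDensity
  rw [integral_div, ← gibbsMass, div_self (gibbsMass_pos hn hM hq).ne', ENNReal.ofReal_one]

theorem integral_gibbs (f : EuclideanSpace ℝ (Fin n) → ℝ) :
    ∫ x, f x ∂(gibbs M q) = (∫ x, f x * Real.exp (-(M x) ^ q)) / gibbsMass M q := by
  rw [gibbs, integral_withDensity_eq_integral_toReal_smul
    (by have := measurable_gibbsDensity (M := M) (q := q); fun_prop) (by simp)]
  simp_rw [ENNReal.toReal_ofReal (gibbsDensity_nonneg _), gibbsDensity, smul_eq_mul]
  rw [← integral_div]
  congr 1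
  ext x
  ring

theorem integrable_rpow_gibbs (hn : 1 ≤ n) (hM : ∀ x, M x = 0 → x = 0) (hq : 0 < q) {r : ℝ}
    (hr : 0 ≤ r) : Integrable (fun x => M x ^ r) (gibbs M q) := by
  rw [gibbs, integrable_withDensity_iff_integrable_smul'
    (by have := measurable_gibbsDensity (M := M) (q := q); fun_prop) (by simp)]
  simp_rw [ENNReal.toReal_ofReal (gibbsDensity_nonneg _), gibbsDensity, smul_eq_mul]
  refine ((integrable_rpow_mul_exp_neg_seminorm hn hM hq hr).div_const (gibbsMass M q)).congr ?_
  filter_upwards with x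
  ring

theorem integral_rpow_gibbs (hn : 1 ≤ n) (hM : ∀ x, M x = 0 → x = 0) (hq : 0 < q) {r : ℝ}
    (hr : 0 ≤ r) :
    ∫ x, M x ^ r ∂(gibbs M q) = Real.Gamma ((n + r) / q) / Real.Gamma (n / q) := by
  rw [integral_gibbs, integral_rpow_mul_exp_neg_seminorm hn hM hq hr, ← gibbsMass,
    mul_div_assoc, div_self (gibbsMass_pos hn hM hq).ne', mul_one]

/-- By log-convexity of Γ, the slope of log Γ over [a, a + s] is at most its slope over [a + s, a +
s + 1], which is log(a + s). -/
theorem Real.Gamma_add_div_Gamma_le {a s : ℝ} (ha : 0 < a) (hs : 0 < s) :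
    Real.Gamma (a + s) / Real.Gamma a ≤ (a + s) ^ s := by
  have hG := Real.convexOn_log_Gamma
  have h := hG.slope_mono_adjacent (x := a) (y := a + s) (z := a + s + 1)
    (Set.mem_Ioi.2 ha) (Set.mem_Ioi.2 (by linarith)) (by linarith) (by linarith)
  have h1 : 0 < Real.Gamma a := Real.Gamma_pos_of_pos ha
  have h2 : 0 < Real.Gamma (a + s) := Real.Gamma_pos_of_pos (by linarith)
  simp only [Function.comp] at h
  rw [Real.Gamma_add_one (by linarith), Real.log_mul (by linarith) h2.ne', add_sub_cancel_left,
    add_sub_cancel_left, div_one, add_sub_cancel_right, div_le_iff₀ hs,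
    ← Real.log_div h2.ne' h1.ne'] at h
  rw [← Real.exp_log (div_pos h2 h1), Real.rpow_def_of_pos (by linarith)]
  exact Real.exp_le_exp.2 h

theorem integral_rpow_gibbs_le (hn : 1 ≤ n) (hM : ∀ x, M x = 0 → x = 0) (hq : 0 < q) {r : ℝ}
    (hr : 0 < r) :
    ∫ x, M x ^ r ∂(gibbs M q) ≤ ((n + r) / q) ^ (r / q) := by
  have hn0 : (0 : ℝ) < n := by exact_mod_cast hn
  rw [integral_rpow_gibbs hn hM hq hr.le, add_div]
  exact Real.Gamma_add_div_Gamma_le (by positivity) (by positivity)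

/-- Uniform smoothness bounds from below the mass of a translate of a symmetric set. -/
theorem gibbs_translate_ge (hn : 1 ≤ n) (hM : ∀ x, M x = 0 → x = 0) (hq : 0 < q) {S : ℝ}
    (hS : IsUniformlySmooth q S M) {B : Set (EuclideanSpace ℝ (Fin n))} (hB : MeasurableSet B)
    (hBneg : ∀ z, z ∈ B → -z ∈ B) (x : EuclideanSpace ℝ (Fin n)) :
    Real.exp (-(M (S • x)) ^ q) * (gibbs M q).real B
      ≤ (gibbs M q).real {z | z - x ∈ B} := by
  have hBx : MeasurableSet {z | z - x ∈ B} := by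
    have : Measurable fun z : EuclideanSpace ℝ (Fin n) => z - x := by fun_prop
    exact this hB
  have hρint := integrable_gibbsDensity hn hM hq
  rw [gibbs_real_apply hB, gibbs_real_apply hBx]
  set ρ := gibbsDensity M q with hρ
  have e1 : ∫ z in {z | z - x ∈ B}, ρ z = ∫ z in B, ρ (z + x) := by
    rw [← integral_indicator hBx, ← integral_indicator hB,
      ← integral_add_right_eq_self _ x]
    congr 1
    ext z
    by_cases hz : z ∈ B
    · rw [Set.indicator_of_mem hz, Set.indicator_of_mem (by simpa using hz)]
    · rw [Set.indicator_of_notMem hz, Set.indicator_of_notMem (by simpa using hz)]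
  have e2 : ∫ z in B, ρ (z + x) = ∫ z in B, ρ (z - x) := by
    rw [← integral_indicator hB, ← integral_indicator hB, ← integral_neg_eq_self]
    congr 1
    ext z
    have h1 : -z ∈ B ↔ z ∈ B := ⟨fun h => by simpa using hBneg _ h, hBneg z⟩
    have h2 : ρ (-z + x) = ρ (z - x) := by
      simp only [hρ, gibbsDensity]
      rw [← map_neg_eq_map M (-z + x), neg_add, neg_neg, sub_eq_add_neg]
    by_cases hz : z ∈ B
    · rw [Set.indicator_of_mem hz, Set.indicator_of_mem (h1.2 hz), h2]
    · rw [Set.indicator_of_notMem hz, Set.indicator_of_notMem (by rwa [h1])]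
  have i1 : IntegrableOn (fun z => ρ (z + x)) B := (hρint.comp_add_right x).integrableOn
  have i2 : IntegrableOn (fun z => ρ (z - x)) B := (hρint.comp_sub_right x).integrableOn
  -- The symmetry `e2` allows averaging the density over the shifts ±x. Pointwise, convexity of exp
  -- and then uniform smoothness at z with increment x bound this average below by exp(-M(Sx)^q)
  -- ρ(z).
  have e3 : ∫ z in B, ρ (z + x) = ∫ z in B, (ρ (z + x) + ρ (z - x)) / 2 := by
    rw [integral_div, integral_add i1 i2, ← e2]
    ring
  rw [e1, e3, ← integral_const_mul]
  refine integral_mono (hρint.integrableOn.const_mul _) ((i1.add i2).div_const 2) fun z => ?_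
  simp only [hρ, gibbsDensity]
  rw [← add_div, div_right_comm, ← mul_div_assoc]
  refine div_le_div_of_nonneg_right ?_ (gibbsMass_pos hn hM hq).le
  have hs := hS z x
  have hconv := convexOn_exp.2 (Set.mem_univ (-(M (z + x)) ^ q)) (Set.mem_univ (-(M (z - x)) ^ q))
    (by norm_num : (0 : ℝ) ≤ 1 / 2) (by norm_num : (0 : ℝ) ≤ 1 / 2) (by norm_num)
  simp only [smul_eq_mul] at hconv
  rw [← Real.exp_add]
  have : Real.exp (-(M (S • x)) ^ q + -(M z) ^ q)
      ≤ Real.exp (1 / 2 * -(M (z + x)) ^ q + 1 / 2 * -(M (z - x)) ^ q) :=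
    Real.exp_le_exp.2 (by linarith)
  linarith

/-- The substitution z ↦ η z contributes the Jacobian η^n, and the density can only increase towards
the origin. -/
theorem gibbs_ball_scale_ge (hn : 1 ≤ n) (hM : ∀ x, M x = 0 → x = 0) (hq : 0 < q)
    (V : Seminorm ℝ (EuclideanSpace ℝ (Fin n))) (R : ℝ) {η : ℝ} (hη : 0 < η) (hη1 : η ≤ 1) :
    η ^ n * (gibbs M q).real {z | V z ≤ R} ≤ (gibbs M q).real {z | V z ≤ η * R} := by
  have hm : ∀ R, MeasurableSet {z | V z ≤ R} := fun R =>
    measurableSet_le V.measurable_euclidean measurable_const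
  have hρint := integrable_gibbsDensity hn hM hq
  rw [gibbs_real_apply (hm _), gibbs_real_apply (hm _)]
  have h := Measure.setIntegral_comp_smul_of_pos volume (gibbsDensity M q) {z | V z ≤ R} hη
  have hset : (η • {z | V z ≤ R} : Set (EuclideanSpace ℝ (Fin n))) = {z | V z ≤ η * R} := by
    ext z
    rw [Set.mem_smul_set_iff_inv_smul_mem₀ hη.ne']
    simp only [Set.mem_ofPred_eq, map_smul_eq_mul, norm_inv, Real.norm_eq_abs, abs_of_pos hη]
    rw [inv_mul_le_iff₀ hη]
  rw [hset, finrank_euclideanSpace_fin, smul_eq_mul] at h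
  have h2 : ∫ x in {z | V z ≤ R}, gibbsDensity M q x
      ≤ ∫ x in {z | V z ≤ R}, gibbsDensity M q (η • x) := by
    refine integral_mono hρint.integrableOn (hρint.comp_smul hη.ne').integrableOn fun z => ?_
    simp only [gibbsDensity]
    refine div_le_div_of_nonneg_right ?_ (gibbsMass_pos hn hM hq).le
    refine Real.exp_le_exp.2 (neg_le_neg (Real.rpow_le_rpow (apply_nonneg _ _) ?_ hq.le))
    rw [map_smul_eq_mul, Real.norm_eq_abs, abs_of_pos hη]
    exact mul_le_of_le_one_left (apply_nonneg _ _) hη1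
  rw [h, inv_mul_eq_div, le_div_iff₀ (by positivity)] at h2
  linarith

theorem gibbsDensity_logConcave (hn : 1 ≤ n) (hM : ∀ x, M x = 0 → x = 0) (hq : 1 ≤ q) {a b : ℝ}
    (ha : 0 ≤ a) (hb : 0 ≤ b) (hab : a + b = 1) (x y : EuclideanSpace ℝ (Fin n)) :
    gibbsDensity M q x ^ a * gibbsDensity M q y ^ b ≤ gibbsDensity M q (a • x + b • y) := by
  have hZ := gibbsMass_pos hn hM (q := q) (by linarith)
  unfold gibbsDensity
  rw [Real.div_rpow (Real.exp_pos _).le hZ.le, Real.div_rpow (Real.exp_pos _).le hZ.le,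
    div_mul_div_comm, ← Real.rpow_add hZ, hab, Real.rpow_one, ← Real.exp_mul, ← Real.exp_mul,
    ← Real.exp_add]
  refine div_le_div_of_nonneg_right (Real.exp_le_exp.2 ?_) hZ.le
  have h1 : M (a • x + b • y) ≤ a * M x + b * M y := by
    refine (map_add_le_add M _ _).trans ?_
    rw [map_smul_eq_mul, map_smul_eq_mul, Real.norm_of_nonneg ha, Real.norm_of_nonneg hb]
  have h2 := (convexOn_rpow hq).2 (Set.mem_Ici.2 (apply_nonneg M x))
    (Set.mem_Ici.2 (apply_nonneg M y)) ha hb hab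
  simp only [smul_eq_mul] at h2
  have h3 := Real.rpow_le_rpow (apply_nonneg M _) h1 (by linarith : 0 ≤ q)
  linarith

/-- Borell's lemma. -/
theorem gibbs_tail_le (hn : 1 ≤ n) (hM : ∀ x, M x = 0 → x = 0) (hq : 1 ≤ q)
    (N : Seminorm ℝ (EuclideanSpace ℝ (Fin n))) {c u : ℝ} (hu : 1 < u)
    (hc : 2 / 3 ≤ (gibbs M q).real {z | N z ≤ c}) :
    (gibbs M q).real {z | c * u < N z} ≤ (1 / 2) ^ ((u + 1) / 2) := by
  have hq0 : 0 < q := by linarith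
  have := isProbabilityMeasure_gibbs hn hM hq0
  have hm1 : ∀ c, MeasurableSet {z | N z ≤ c} := fun c =>
    measurableSet_le N.measurable_euclidean measurable_const
  have hm2 : ∀ c, MeasurableSet {z | c < N z} := fun c =>
    measurableSet_lt measurable_const N.measurable_euclidean
  have hu1 : 0 < u + 1 := by linarith
  -- The weights are chosen so that a · cu - b · c = c: combining a point of {N > cu} with a point
  -- of {N ≤ c} then lands in {N > c}.
  set a := 2 / (u + 1) with ha'
  set b := (u - 1) / (u + 1) with hb'
  have ha : 0 < a := by positivity
  have hb : 0 < b := div_pos (by linarith) hu1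
  have hab : a + b = 1 := by rw [ha', hb']; field_simp; ring
  have hb1 : b ≤ 1 := by linarith
  let ρ : EuclideanSpace ℝ (Fin n) → ℝ≥0∞ := fun x => ENNReal.ofReal (gibbsDensity M q x)
  have hρ : Measurable ρ := measurable_gibbsDensity.ennreal_ofReal
  have PL := prekopaLeindler ha hb hab (n := n) (f := Set.indicator {z | c * u < N z} ρ)
    (g := Set.indicator {z | N z ≤ c} ρ) (h := Set.indicator {z | c < N z} ρ)
    (hρ.indicator (hm2 _)) (hρ.indicator (hm1 _)) (hρ.indicator (hm2 _)) (by
      intro x y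
      by_cases hx : c * u < N x
      · by_cases hy : N y ≤ c
        · have hxy : c < N (a • x + b • y) := by
            have h1 : N (a • x) ≤ N (a • x + b • y) + N (b • y) := by
              have := map_sub_le_add N (a • x + b • y) (b • y)
              simpa using this
            rw [map_smul_eq_mul, map_smul_eq_mul, Real.norm_of_nonneg ha.le,
              Real.norm_of_nonneg hb.le] at h1
            have h2 : a * (c * u) < a * N x := by gcongr
            have h3 : b * N y ≤ b * c := by gcongr
            have h4 : a * (c * u) - b * c = c := by rw [ha', hb']; field_simp; ring
            linarith
          rw [Set.indicator_of_mem (by exact hx), Set.indicator_of_mem (by exact hy),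
            Set.indicator_of_mem (by exact hxy)]
          simp only [ρ]
          rw [ENNReal.ofReal_rpow_of_nonneg (gibbsDensity_nonneg _) ha.le,
            ENNReal.ofReal_rpow_of_nonneg (gibbsDensity_nonneg _) hb.le,
            ← ENNReal.ofReal_mul (Real.rpow_nonneg (gibbsDensity_nonneg _) _)]
          exact ENNReal.ofReal_le_ofReal (gibbsDensity_logConcave hn hM hq ha.le hb.le hab x y)
        · rw [Set.indicator_of_notMem (s := {z | N z ≤ c}) (by exact hy)]
          simp [hb]
      · rw [Set.indicator_of_notMem (s := {z | c * u < N z}) (by exact hx)]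
        simp [ha])
  rw [lintegral_indicator (hm2 _), lintegral_indicator (hm1 _), lintegral_indicator (hm2 _),
    ← withDensity_apply _ (hm2 _), ← withDensity_apply _ (hm1 _), ← withDensity_apply _ (hm2 _),
    ← gibbs] at PL
  have PL' := ENNReal.toReal_mono (measure_ne_top _ _) PL
  rw [ENNReal.toReal_mul, ← ENNReal.toReal_rpow, ← ENNReal.toReal_rpow, ← measureReal_def,
    ← measureReal_def, ← measureReal_def] at PL'
  set φ := (gibbs M q).real {z | c * u < N z} with hφ
  have hφ0 : 0 ≤ φ := measureReal_nonneg
  have hcompl : (gibbs M q).real {z | c < N z} ≤ 1 / 3 := by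
    have : {z | c < N z} = {z | N z ≤ c}ᶜ := by ext z; simp
    rw [this, measureReal_compl (hm1 c), probReal_univ]
    linarith
  -- As b ≤ 1, the power b does not decrease 2/3. Prékopa–Leindler then reads φ^a · (2/3) ≤ 1/3.
  have h23 : (2 / 3 : ℝ) ≤ (gibbs M q).real {z | N z ≤ c} ^ b := by
    calc (2 / 3 : ℝ) = (2 / 3) ^ (1 : ℝ) := by simp
      _ ≤ (2 / 3) ^ b := Real.rpow_le_rpow_of_exponent_ge (by norm_num) (by norm_num) hb1
      _ ≤ _ := Real.rpow_le_rpow (by norm_num) hc hb.le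
  have h3 : φ ^ a ≤ 1 / 2 := by
    have h4 : φ ^ a * (2 / 3) ≤ 1 / 3 :=
      (mul_le_mul_of_nonneg_left h23 (Real.rpow_nonneg hφ0 _)).trans (PL'.trans hcompl)
    linarith
  calc φ = (φ ^ a) ^ ((u + 1) / 2) := by
        rw [← Real.rpow_mul hφ0, ha']
        have : 2 / (u + 1) * ((u + 1) / 2) = 1 := by field_simp
        rw [this, Real.rpow_one]
    _ ≤ _ := Real.rpow_le_rpow (Real.rpow_nonneg hφ0 _) h3 (by positivity)

end Gibbs

/-! ### Entropy, sensitivity and tail estimates -/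

section Entropy

variable {n : ℕ} {M : Seminorm ℝ (EuclideanSpace ℝ (Fin n))} {q : ℝ}

/-- Separation makes the translates by l x of the V-ball of radius ηR disjoint. Each has mass at
least exp(-(lS)^q) η^n / 2, by the translation and scaling bounds, and the total mass is 1. The
parameter l trades radius against entropy; η performs the volumetric refinement. -/
theorem card_le_of_separated (hn : 1 ≤ n) (hM : ∀ x, M x = 0 → x = 0) (hq : 0 < q) {S : ℝ}
    (hS0 : 0 < S) (hS : IsUniformlySmooth q S M) (V : Seminorm ℝ (EuclideanSpace ℝ (Fin n)))
    {R : ℝ} (hR : 1 / 2 ≤ (gibbs M q).real {z | V z ≤ R}) {l η : ℝ} (hl : 0 < l) (hη : 0 < η)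
    (hη1 : η ≤ 1) (G : Finset (EuclideanSpace ℝ (Fin n))) (hG : ∀ x ∈ G, M x ≤ 1)
    (hsep : ∀ x ∈ G, ∀ y ∈ G, x ≠ y → 2 * η * R / l < V (x - y)) :
    (G.card : ℝ) ≤ 2 * Real.exp ((l * S) ^ q) / η ^ n := by
  have := isProbabilityMeasure_gibbs hn hM hq
  have hB : MeasurableSet {z | V z ≤ η * R} :=
    measurableSet_le V.measurable_euclidean measurable_const
  have hBx : ∀ x : EuclideanSpace ℝ (Fin n),
      MeasurableSet {z | z - l • x ∈ {z | V z ≤ η * R}} := fun x => by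
    have : Measurable fun z : EuclideanSpace ℝ (Fin n) => z - l • x := by fun_prop
    exact this hB
  have hlow : ∀ x ∈ G, Real.exp (-(l * S) ^ q) * (η ^ n * (1 / 2))
      ≤ (gibbs M q).real {z | z - l • x ∈ {z | V z ≤ η * R}} := by
    intro x hx
    refine le_trans ?_ (gibbs_translate_ge hn hM hq hS hB
      (fun z hz => by simpa using hz) (l • x))
    have h1 := gibbs_ball_scale_ge hn hM hq V R hη hη1
    have h2 : M (S • l • x) ≤ l * S := by
      rw [smul_smul, map_smul_eq_mul, Real.norm_of_nonneg (by positivity), mul_comm S l]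
      exact mul_le_of_le_one_right (by positivity) (hG x hx)
    have h3 := Real.rpow_le_rpow (apply_nonneg M _) h2 hq.le
    refine mul_le_mul (Real.exp_le_exp.2 (by linarith)) (le_trans ?_ h1) (by positivity)
      (Real.exp_pos _).le
    gcongr
  have hdisj : Set.PairwiseDisjoint (↑G)
      fun x : EuclideanSpace ℝ (Fin n) => {z | z - l • x ∈ {z | V z ≤ η * R}} := by
    intro x hx y hy hxy
    refine Set.disjoint_left.2 fun z hzx hzy => ?_
    have hzx : V (z - l • x) ≤ η * R := hzx
    have hzy : V (z - l • y) ≤ η * R := hzy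
    have h1 : V (l • (x - y)) ≤ 2 * η * R := by
      have : l • (x - y) = (z - l • y) - (z - l • x) := by rw [smul_sub]; abel
      rw [this]
      have := map_sub_le_add V (z - l • y) (z - l • x)
      linarith
    rw [map_smul_eq_mul, Real.norm_of_nonneg hl.le] at h1
    have h2 := hsep x hx y hy hxy
    rw [div_lt_iff₀ hl] at h2
    linarith
  have hsum := measureReal_biUnion_finset (μ := gibbs M q) hdisj (fun x _ => hBx x)
  have hle1 : ∑ x ∈ G, (gibbs M q).real {z | z - l • x ∈ {z | V z ≤ η * R}} ≤ 1 := by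
    rw [← hsum]; exact measureReal_le_one
  have h3 : G.card * (Real.exp (-(l * S) ^ q) * (η ^ n * (1 / 2))) ≤ 1 := by
    refine le_trans ?_ hle1
    rw [← nsmul_eq_mul]
    exact Finset.card_nsmul_le_sum _ _ _ hlow
  rw [Real.exp_neg] at h3
  have h4 := Real.exp_pos ((l * S) ^ q)
  have h5 : 0 < η ^ n := by positivity
  rw [le_div_iff₀ h5]
  have h6 : (G.card : ℝ) * ((Real.exp ((l * S) ^ q))⁻¹ * (η ^ n * (1 / 2)))
    = G.card * η ^ n / (2 * Real.exp ((l * S) ^ q)) := by field_simp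
  rw [h6, div_le_one (by positivity)] at h3
  exact h3

/-- Dual Sudakov-type covering estimate. -/
theorem exists_net (hn : 1 ≤ n) (hM : ∀ x, M x = 0 → x = 0) (hq : 0 < q) {S : ℝ}
    (hS0 : 0 < S) (hS : IsUniformlySmooth q S M) (V : Seminorm ℝ (EuclideanSpace ℝ (Fin n)))
    {R : ℝ} (hR0 : 0 ≤ R) (hR : 1 / 2 ≤ (gibbs M q).real {z | V z ≤ R}) {l η : ℝ} (hl : 0 < l)
    (hη : 0 < η) (hη1 : η ≤ 1) (T : Set (EuclideanSpace ℝ (Fin n))) (hT : ∀ x ∈ T, M x ≤ 1) :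
    ∃ F : Finset (EuclideanSpace ℝ (Fin n)), (∀ x ∈ F, x ∈ T) ∧
      (∀ x ∈ T, ∃ y ∈ F, V (x - y) ≤ 2 * η * R / l) ∧
      (F.card : ℝ) ≤ 2 * Real.exp ((l * S) ^ q) / η ^ n := by
  classical
  -- Packing bounds the cardinalities of separated subsets of T, so one of largest cardinality
  -- exists; by maximality it is a net.
  let P : Set ℕ := {k | ∃ G : Finset (EuclideanSpace ℝ (Fin n)), G.card = k ∧ (∀ x ∈ G, x ∈ T) ∧
    ∀ x ∈ G, ∀ y ∈ G, x ≠ y → 2 * η * R / l < V (x - y)}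
  have hP : BddAbove P := by
    refine ⟨⌊2 * Real.exp ((l * S) ^ q) / η ^ n⌋₊, ?_⟩
    rintro k ⟨G, rfl, hGT, hG⟩
    exact Nat.le_floor (card_le_of_separated hn hM hq hS0 hS V hR hl hη hη1 G
      (fun x hx => hT x (hGT x hx)) hG)
  have hP0 : P.Nonempty := ⟨0, ∅, by simp⟩
  obtain ⟨F, hFc, hFT, hF⟩ := Nat.sSup_mem hP0 hP
  refine ⟨F, hFT, fun x hx => ?_, card_le_of_separated hn hM hq hS0 hS V hR hl hη hη1 F
      (fun x hx => hT x (hFT x hx)) hF⟩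
  by_contra! hcon
  have hxF : x ∉ F := by
    intro hxF
    have := hcon x hxF
    rw [sub_self, map_zero] at this
    exact this.not_ge (by positivity)
  have : (insert x F).card ∈ P := by
    refine ⟨insert x F, rfl, ?_, ?_⟩
    · intro y hy
      rcases Finset.mem_insert.1 hy with rfl | hy
      exacts [hx, hFT y hy]
    · intro y hy z hz hyz
      rcases Finset.mem_insert.1 hy with hy' | hy' <;> rcases Finset.mem_insert.1 hz with hz' | hz'
      · exact absurd (hy'.trans hz'.symm) hyz
      · rw [hy']; exact hcon z hz'
      · rw [hz', map_sub_rev V]; exact hcon y hy'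
      · exact hF y hy' z hz' hyz
  have h2 := le_csSup hP this
  rw [Finset.card_insert_of_notMem hxF, ← hFc] at h2
  omega

/-- Markov's inequality with strict inequality in the event, so that it remains valid for m = 0,
where f vanishes almost everywhere. -/
theorem measureReal_gt_mul_integral_le {Ω : Type*} [MeasurableSpace Ω] {μ : Measure Ω}
    [IsProbabilityMeasure μ] {f : Ω → ℝ} (hf0 : ∀ x, 0 ≤ f x) (hf : Integrable f μ) {m k : ℝ}
    (hm : ∫ x, f x ∂μ ≤ m) (hk : 0 < k) : μ.real {x | k * m < f x} ≤ 1 / k := by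
  have hm0 : 0 ≤ m := (integral_nonneg hf0).trans hm
  rcases hm0.eq_or_lt with rfl | hm0
  · have h0 : ∫ x, f x ∂μ = 0 := le_antisymm hm (integral_nonneg hf0)
    have h1 := (integral_eq_zero_iff_of_nonneg hf0 hf).1 h0
    have : μ {x | k * 0 < f x} = 0 := by
      refine measure_mono_null (t := {x | ¬ f x = 0}) ?_ h1
      intro x hx
      have hx : k * 0 < f x := hx
      rw [mul_zero] at hx
      exact hx.ne'
    rw [measureReal_def, this]
    simp only [ENNReal.toReal_zero]
    positivity
  · have h1 := mul_meas_ge_le_integral_of_nonneg (Filter.Eventually.of_forall hf0) hf (k * m)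
    have h2 : μ.real {x | k * m < f x} ≤ μ.real {x | k * m ≤ f x} :=
      measureReal_mono fun x (hx : k * m < f x) => hx.le
    have h3 : k * m * μ.real {x | k * m < f x} ≤ m :=
      (mul_le_mul_of_nonneg_left h2 (by positivity)).trans (h1.trans hm)
    rw [le_div_iff₀ hk]
    have : m * (μ.real {x | k * m < f x} * k) ≤ m * 1 := by linarith
    exact le_of_mul_le_mul_left this hm0

theorem measureReal_le_mul_integral_ge {Ω : Type*} [MeasurableSpace Ω] {μ : Measure Ω}
    [IsProbabilityMeasure μ] {f : Ω → ℝ} (hfm : Measurable f) (hf0 : ∀ x, 0 ≤ f x)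
    (hf : Integrable f μ) {m k : ℝ} (hm : ∫ x, f x ∂μ ≤ m) (hk : 0 < k) :
    1 - 1 / k ≤ μ.real {x | f x ≤ k * m} := by
  have h := measureReal_gt_mul_integral_le hf0 hf hm hk
  have : {x | f x ≤ k * m} = {x | k * m < f x}ᶜ := by ext; simp
  rw [this, measureReal_compl (measurableSet_lt measurable_const hfm), probReal_univ]
  linarith

theorem integral_rpow_le_integral_rpow {Ω : Type*} [MeasurableSpace Ω] {μ : Measure Ω}
    [IsProbabilityMeasure μ] {f : Ω → ℝ} (hf0 : ∀ x, 0 ≤ f x) (hf : Integrable f μ) {p : ℝ}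
    (hp : 1 ≤ p) (hfp : Integrable (fun x => f x ^ p) μ) :
    (∫ x, f x ∂μ) ^ p ≤ ∫ x, f x ^ p ∂μ :=
  (convexOn_rpow hp).map_integral_le
    (Real.continuous_rpow_const (by linarith)).continuousOn isClosed_Ici
    (Filter.Eventually.of_forall hf0) hf hfp

theorem integrable_of_integrable_rpow {Ω : Type*} [MeasurableSpace Ω] {μ : Measure Ω}
    [IsProbabilityMeasure μ] {f : Ω → ℝ} (hfm : Measurable f) (hf0 : ∀ x, 0 ≤ f x) {p : ℝ}
    (hp : 1 ≤ p) (hfp : Integrable (fun x => f x ^ p) μ) : Integrable f μ := by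
  refine (hfp.add (integrable_const 1)).mono' hfm.aestronglyMeasurable ?_
  filter_upwards with x
  rw [Real.norm_of_nonneg (hf0 x)]
  simp only [Pi.add_apply]
  rcases le_total (f x) 1 with h | h
  · have := Real.rpow_nonneg (hf0 x) p
    linarith
  · have := Real.rpow_le_rpow_of_exponent_le h hp
    rw [Real.rpow_one] at this
    linarith

/-- Pointwise values of a seminorm on the unit ball are bounded by its moments. -/
theorem rpow_le_integral_gibbs (hn : 1 ≤ n) (hM : ∀ x, M x = 0 → x = 0) (hq : 0 < q) {S : ℝ}
    (hS0 : 0 < S) (hS : IsUniformlySmooth q S M) (N : Seminorm ℝ (EuclideanSpace ℝ (Fin n)))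
    {p : ℝ} (hp : 1 ≤ p) (hN : Integrable (fun x => N x ^ p) (gibbs M q)) {l : ℝ} (hl : 0 < l)
    {x : EuclideanSpace ℝ (Fin n)} (hx : M x ≤ 1) :
    N x ^ p ≤ 2 * Real.exp (l ^ q) * (4 / l * S) ^ p * ∫ z, N z ^ p ∂(gibbs M q) := by
  have := isProbabilityMeasure_gibbs hn hM hq
  have hp0 : 0 ≤ p := by linarith
  have hNm := N.measurable_euclidean
  have hN0 : ∀ z, 0 ≤ N z := fun z => apply_nonneg N z
  have hN1 := integrable_of_integrable_rpow hNm hN0 hp hN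
  set m := ∫ z, N z ∂(gibbs M q) with hm
  set τ := ∫ z, N z ^ p ∂(gibbs M q) with hτ
  have hm0 : 0 ≤ m := integral_nonneg hN0
  have hmτ : m ^ p ≤ τ := integral_rpow_le_integral_rpow hN0 hN1 hp hN
  have hτ0 : 0 ≤ τ := integral_nonneg fun z => Real.rpow_nonneg (hN0 z) p
  have hexp : 1 ≤ Real.exp (l ^ q) := Real.one_le_exp (by positivity)
  -- If N x is comparable with the mean, Jensen suffices. Otherwise translate {N ≤ 2m}, of mass at
  -- least 1/2, by (l/S) x: the translate has mass at least exp(-l^q)/2 and N is at least half of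
  -- (l/S) N x on it, so Markov bounds N x.
  rcases le_total (l / S * N x) (4 * m) with h | h
  · have h1 : N x ≤ 4 / l * S * m := by
      rw [div_mul_eq_mul_div, div_le_iff₀ hS0] at h
      rw [div_mul_eq_mul_div, div_mul_eq_mul_div, le_div_iff₀ hl]
      linarith
    calc N x ^ p ≤ (4 / l * S * m) ^ p := Real.rpow_le_rpow (hN0 x) h1 hp0
      _ = 1 * ((4 / l * S) ^ p * m ^ p) := by rw [Real.mul_rpow (by positivity) hm0, one_mul]
      _ ≤ (2 * Real.exp (l ^ q)) * ((4 / l * S) ^ p * τ) := by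
        gcongr
        linarith
      _ = _ := by ring
  · have hB : MeasurableSet {z | N z ≤ 2 * m} := measurableSet_le hNm measurable_const
    have h1 := gibbs_translate_ge hn hM hq hS hB (fun z hz => by simpa using hz) ((l / S) • x)
    have h2 : (1 : ℝ) - 1 / 2 ≤ (gibbs M q).real {z | N z ≤ 2 * m} :=
      measureReal_le_mul_integral_ge hNm hN0 hN1 le_rfl two_pos
    have h3 : M (S • (l / S) • x) ≤ l := by
      rw [smul_smul, map_smul_eq_mul, mul_div_cancel₀ _ hS0.ne', Real.norm_of_nonneg hl.le]
      exact mul_le_of_le_one_right hl.le hx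
    have h4 := Real.rpow_le_rpow (apply_nonneg M _) h3 hq.le
    have h5 : Real.exp (-l ^ q) * (1 / 2) ≤
        (gibbs M q).real {z | (l / S * N x / 2) ^ p ≤ N z ^ p} := by
      calc Real.exp (-l ^ q) * (1 / 2) ≤ Real.exp (-(M (S • (l / S) • x)) ^ q) *
            (gibbs M q).real {z | N z ≤ 2 * m} := by
            gcongr
            linarith
        _ ≤ _ := h1
        _ ≤ _ := by
            refine measureReal_mono fun z hz => ?_
            have hz : N (z - (l / S) • x) ≤ 2 * m := hz
            refine Real.rpow_le_rpow (by positivity) ?_ hp0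
            have h6 : N ((l / S) • x) ≤ N z + N (z - (l / S) • x) := by
              have := map_sub_le_add N z (z - (l / S) • x)
              rwa [sub_sub_cancel] at this
            rw [map_smul_eq_mul, Real.norm_of_nonneg (by positivity)] at h6
            linarith
    have h6 := mul_meas_ge_le_integral_of_nonneg
      (Filter.Eventually.of_forall fun z => Real.rpow_nonneg (hN0 z) p) hN ((l / S * N x / 2) ^ p)
    have h7 : (l / S * N x / 2) ^ p * (Real.exp (-l ^ q) * (1 / 2)) ≤ τ :=
      (mul_le_mul_of_nonneg_left h5 (by positivity)).trans h6
    have h8 : N x = (2 / l * S) * (l / S * N x / 2) := by field_simp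
    calc N x ^ p = (2 / l * S) ^ p * (l / S * N x / 2) ^ p := by
          rw [← Real.mul_rpow (by positivity) (by positivity), ← h8]
      _ = 2 * Real.exp (l ^ q) * (2 / l * S) ^ p *
          ((l / S * N x / 2) ^ p * (Real.exp (-l ^ q) * (1 / 2))) := by
          rw [Real.exp_neg]
          field_simp
      _ ≤ 2 * Real.exp (l ^ q) * (4 / l * S) ^ p * τ := by
          gcongr
          norm_num

/-- Markov gives {v_j ≤ 3Y} mass at least 2/3. Borell's lemma with u = 4 log(2s) then makes each
tail at most 1/(2s), and a union bound leaves half of the mass. This is the only source of the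
factor log(2s). -/
theorem half_le_gibbs_sup_le (hn : 1 ≤ n) (hM : ∀ x, M x = 0 → x = 0) (hq : 1 ≤ q) {s : ℕ}
    (hs : 1 ≤ s) (v : Fin s → Seminorm ℝ (EuclideanSpace ℝ (Fin n)))
    (hv : ∀ j, Integrable (v j) (gibbs M q)) {Y : ℝ}
    (hY : ∀ j, ∫ z, v j z ∂(gibbs M q) ≤ Y) :
    1 / 2 ≤ (gibbs M q).real
      {z | (Finset.univ.sup v) z ≤ 12 * Real.log (2 * s) * Y} := by
  have := isProbabilityMeasure_gibbs hn hM (q := q) (by linarith)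
  have hs1 : (1 : ℝ) ≤ s := by exact_mod_cast hs
  have hl2 : (0.69 : ℝ) < Real.log 2 := by linarith [Real.log_two_gt_d9]
  have hlog : Real.log 2 ≤ Real.log (2 * s) :=
    Real.log_le_log (by norm_num) (by linarith)
  have hY0 : 0 ≤ Y := (integral_nonneg fun z => apply_nonneg (v ⟨0, hs⟩) z).trans (hY ⟨0, hs⟩)
  set u := 4 * Real.log (2 * s) with hu
  have htail : ∀ j, (gibbs M q).real {z | 3 * Y * u < v j z} ≤ 1 / (2 * s) := by
    intro j
    have h1 : (2 : ℝ) / 3 ≤ (gibbs M q).real {z | v j z ≤ 3 * Y} := by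
      have := measureReal_le_mul_integral_ge (μ := gibbs M q) (v j).measurable_euclidean
        (fun z => apply_nonneg (v j) z) (hv j) (hY j) (k := 3) (by norm_num)
      norm_num at this ⊢
      exact this
    refine (gibbs_tail_le hn hM hq (v j) (u := u) (by linarith) h1).trans ?_
    rw [Real.rpow_def_of_pos (by norm_num), one_div, Real.log_inv, one_div,
      ← Real.exp_log (by positivity : (0 : ℝ) < (2 * (s : ℝ))⁻¹), Real.log_inv]
    refine Real.exp_le_exp.2 ?_
    nlinarith
  have hset : {z | (Finset.univ.sup v) z ≤ 12 * Real.log (2 * s) * Y}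
      = (⋃ j ∈ Finset.univ, {z | 3 * Y * u < v j z})ᶜ := by
    ext z
    simp only [Set.mem_ofPred_eq, Set.mem_compl_iff, Set.mem_iUnion, not_exists, not_lt]
    rw [show 12 * Real.log (2 * s) * Y = 3 * Y * u by rw [hu]; ring]
    refine ⟨fun h j hj => (Seminorm.le_finset_sup_apply hj).trans h, fun h => ?_⟩
    exact Seminorm.finset_sup_apply_le (mul_nonneg (by positivity) (by linarith)) h
  have hmeas : ∀ j, MeasurableSet {z | 3 * Y * u < v j z} := fun j =>
    measurableSet_lt measurable_const (v j).measurable_euclidean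
  rw [hset, measureReal_compl (Finset.measurableSet_biUnion _ fun j _ => hmeas j), probReal_univ]
  have h2 := measureReal_biUnion_finset_le (μ := gibbs M q) Finset.univ
    (fun j => {z | 3 * Y * u < v j z})
  have h3 : ∑ j, (gibbs M q).real {z | 3 * Y * u < v j z} ≤ ∑ j : Fin s, 1 / (2 * (s : ℝ)) :=
    Finset.sum_le_sum fun j _ => htail j
  have h4 : ∑ j : Fin s, 1 / (2 * (s : ℝ)) = 1 / 2 := by
    simp only [Finset.sum_const, Finset.card_univ, Fintype.card_fin, nsmul_eq_mul]
    field_simp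
  linarith

end Entropy

/-! ### Rademacher averages and chaining -/

section Rademacher

variable {s : ℕ}

/-- The sign encoded by a Boolean. -/
def radSign (b : Bool) : ℝ := if b then 1 else -1

/-- The Rademacher sum with coefficients `a` at the sign pattern `σ`. -/
def radSum (a : Fin s → ℝ) (σ : Fin s → Bool) : ℝ := ∑ j, radSign (σ j) * a j

/-- The average of a function over all sign patterns. -/
noncomputable def radAvg (F : (Fin s → Bool) → ℝ) : ℝ := (∑ σ, F σ) / 2 ^ s

theorem radAvg_mono {F G : (Fin s → Bool) → ℝ} (h : ∀ σ, F σ ≤ G σ) : radAvg F ≤ radAvg G := by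
  unfold radAvg
  gcongr with σ
  exact h σ

theorem radAvg_add (F G : (Fin s → Bool) → ℝ) :
    radAvg (fun σ => F σ + G σ) = radAvg F + radAvg G := by
  simp [radAvg, Finset.sum_add_distrib, add_div]

theorem radAvg_const (c : ℝ) : radAvg (fun _ : Fin s → Bool => c) = c := by
  simp [radAvg]

theorem radAvg_const_mul (c : ℝ) (F : (Fin s → Bool) → ℝ) :
    radAvg (fun σ => c * F σ) = c * radAvg F := by
  simp [radAvg, ← Finset.mul_sum, mul_div_assoc]

theorem radAvg_sum {κ : Type*} (t : Finset κ) (F : κ → (Fin s → Bool) → ℝ) :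
    radAvg (fun σ => ∑ u ∈ t, F u σ) = ∑ u ∈ t, radAvg (F u) := by
  simp only [radAvg]
  rw [Finset.sum_comm, Finset.sum_div]

/-- The average over signs factors into a product of hyperbolic cosines, and cosh t ≤ exp(t²/2). -/
theorem radAvg_exp_le (a : Fin s → ℝ) (b : ℝ) :
    radAvg (fun σ => Real.exp (b * radSum a σ)) ≤ Real.exp (b ^ 2 * (∑ j, a j ^ 2) / 2) := by
  have h1 : ∑ σ : Fin s → Bool, Real.exp (b * radSum a σ)
      = ∏ j, (2 * Real.cosh (b * a j)) := by
    have h2 : ∀ j, 2 * Real.cosh (b * a j) = ∑ c : Bool, Real.exp (b * (radSign c * a j)) := by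
      intro j
      simp [radSign, Real.cosh_eq]
      ring
    simp_rw [h2]
    rw [Finset.prod_univ_sum, Fintype.piFinset_univ]
    refine Finset.sum_congr rfl fun σ _ => ?_
    rw [← Real.exp_sum, radSum, Finset.mul_sum]
  rw [radAvg, h1, Finset.prod_mul_distrib, Finset.prod_const, Finset.card_univ, Fintype.card_fin,
    mul_div_assoc, mul_comm, div_mul_cancel₀ _ (by positivity), Finset.mul_sum, Finset.sum_div,
    Real.exp_sum]
  refine Finset.prod_le_prod (fun j _ => (Real.cosh_pos _).le) fun j _ => ?_
  have := Real.cosh_le_exp_half_sq (b * a j)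
  rwa [mul_pow] at this

/-- The maximal inequality for finitely many Rademacher sums. -/
theorem exists_radSum_bound {κ : Type*} (F : Finset κ) (hF : F.Nonempty) (a : κ → Fin s → ℝ) {δ : ℝ}
    (hδ : 0 ≤ δ) (ha : ∀ u ∈ F, ∑ j, a u j ^ 2 ≤ δ ^ 2) :
    ∃ m : (Fin s → Bool) → ℝ, (∀ σ, ∀ u ∈ F, |radSum (a u) σ| ≤ m σ) ∧
      radAvg m ≤ δ * Real.sqrt (2 * Real.log (2 * F.card)) := by
  rcases hδ.eq_or_lt with rfl | hδ
  · refine ⟨fun _ => 0, fun σ u hu => ?_, by simp [radAvg_const]⟩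
    have h0 := ha u hu
    have h1 : ∀ j, a u j = 0 := by
      intro j
      have h2 := Finset.single_le_sum (f := fun j => a u j ^ 2) (fun j _ => sq_nonneg (a u j))
        (Finset.mem_univ j)
      have h3 : a u j ^ 2 ≤ 0 := h2.trans (by linarith)
      exact pow_eq_zero_iff (two_ne_zero) |>.1 (le_antisymm h3 (sq_nonneg _))
    simp [radSum, h1]
  have hc1 : (1 : ℝ) ≤ F.card := by exact_mod_cast hF.card_pos
  have hlog : 0 < Real.log (2 * F.card) := Real.log_pos (by linarith)
  set L := Real.log (2 * F.card) with hL
  -- This b optimizes the exponential-moment bound: every exponential below has average at most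
  -- exp(b²δ²/2) = exp L.
  set b := Real.sqrt (2 * L) / δ with hb
  have hb0 : 0 < b := by positivity
  have hbδ : b ^ 2 * δ ^ 2 = 2 * L := by
    rw [← mul_pow, hb, div_mul_cancel₀ _ hδ.ne', Real.sq_sqrt (by positivity)]
  let W : (Fin s → Bool) → ℝ := fun σ =>
    ∑ u ∈ F, (Real.exp (b * radSum (a u) σ) + Real.exp (-b * radSum (a u) σ))
  have hexp : ∀ u ∈ F, ∀ c : ℝ, c ^ 2 = b ^ 2 →
      radAvg (fun σ => Real.exp (c * radSum (a u) σ)) ≤ Real.exp L := by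
    intro u hu c hc
    refine (radAvg_exp_le (a u) c).trans (Real.exp_le_exp.2 ?_)
    rw [hc]
    have := mul_le_mul_of_nonneg_left (ha u hu) (sq_nonneg b)
    linarith
  have hW : radAvg W ≤ 2 * F.card * Real.exp L := by
    simp only [W]
    rw [radAvg_sum]
    have : ∀ u ∈ F, radAvg (fun σ => Real.exp (b * radSum (a u) σ) +
        Real.exp (-b * radSum (a u) σ)) ≤ 2 * Real.exp L := by
      intro u hu
      rw [radAvg_add]
      have h1 := hexp u hu b rfl
      have h2 := hexp u hu (-b) (by ring)
      linarith
    refine (Finset.sum_le_card_nsmul _ _ _ this).trans (le_of_eq ?_)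
    rw [nsmul_eq_mul]; ring
  have hexpL : Real.exp L = 2 * F.card := Real.exp_log (by linarith)
  set c := 2 * F.card * Real.exp L with hc
  have hcL : Real.log c = 2 * L := by
    rw [hc, ← hexpL, Real.log_mul (Real.exp_pos _).ne' (Real.exp_pos _).ne', Real.log_exp]
    ring
  have hcpos : 0 < c := by positivity
  -- The maximum is at most log(W)/b. Replacing log by its tangent at c, an upper bound for the
  -- average of W, makes the majorant affine in W, so its average is at most log(c)/b = 2L/b.
  refine ⟨fun σ => b⁻¹ * (2 * L - 1) + b⁻¹ * c⁻¹ * W σ, fun σ u hu => ?_, ?_⟩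
  · have hWpos : Real.exp (b * |radSum (a u) σ|) ≤ W σ := by
      refine le_trans ?_ (Finset.single_le_sum (f := fun u => Real.exp (b * radSum (a u) σ) +
        Real.exp (-b * radSum (a u) σ)) (fun u _ => by positivity) hu)
      rcases abs_cases (radSum (a u) σ) with ⟨h, -⟩ | ⟨h, -⟩ <;> rw [h]
      · have := Real.exp_pos (-b * radSum (a u) σ)
        linarith
      · have := Real.exp_pos (b * radSum (a u) σ)
        rw [mul_neg, neg_mul]
        linarith
    have hWσ : 0 < W σ := (Real.exp_pos _).trans_le hWpos
    have h1 : b * |radSum (a u) σ| ≤ Real.log (W σ) := (Real.le_log_iff_exp_le hWσ).2 hWpos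
    have h2 : Real.log (W σ / c) ≤ W σ / c - 1 := Real.log_le_sub_one_of_pos (by positivity)
    rw [Real.log_div hWσ.ne' hcpos.ne', hcL] at h2
    have h3 : |radSum (a u) σ| ≤ b⁻¹ * (2 * L - 1 + W σ / c) := by
      rw [inv_mul_eq_div, le_div_iff₀ hb0]
      linarith
    refine h3.trans (le_of_eq ?_)
    field_simp
  · rw [radAvg_add, radAvg_const, radAvg_const_mul]
    have h1 : b⁻¹ * c⁻¹ * radAvg W ≤ b⁻¹ := by
      rw [mul_assoc]
      refine mul_le_of_le_one_right (by positivity) ?_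
      rw [inv_mul_le_iff₀ hcpos]
      linarith
    have h2 : b⁻¹ * (2 * L) = δ * Real.sqrt (2 * L) := by
      rw [hb, inv_div, div_mul_eq_mul_div, mul_div_assoc, Real.div_sqrt]
    linarith

/-- Cauchy–Schwarz; this crude bound controls the remainder after the last level of a chain. -/
theorem abs_radSum_le (a : Fin s → ℝ) (σ : Fin s → Bool) {δ : ℝ} (hδ : 0 ≤ δ)
    (ha : ∑ j, a j ^ 2 ≤ δ ^ 2) : |radSum a σ| ≤ Real.sqrt s * δ := by
  have h1 := Finset.sum_mul_sq_le_sq_mul_sq Finset.univ (fun j => radSign (σ j)) a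
  have h2 : ∑ j, radSign (σ j) ^ 2 = s := by
    have : ∀ j, radSign (σ j) ^ 2 = 1 := by
      intro j
      unfold radSign
      split_ifs <;> norm_num
    simp [this]
  rw [h2] at h1
  rw [← Real.sqrt_sq hδ, ← Real.sqrt_mul (by positivity), ← Real.sqrt_sq_eq_abs]
  refine Real.sqrt_le_sqrt (h1.trans ?_)
  gcongr

theorem radSum_sub (a b : Fin s → ℝ) (σ : Fin s → Bool) :
    radSum (fun j => a j - b j) σ = radSum a σ - radSum b σ := by
  simp [radSum, mul_sub, Finset.sum_sub_distrib]

/-- Chaining along a sequence of finite nets. -/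
theorem exists_chaining_bound {E : Type*} (T : Set E) (a : E → Fin s → ℝ) (F : ℕ → Finset E)
    (δ : ℕ → ℝ) (hδ : ∀ k, 0 ≤ δ k) (x₀ : E) (hx₀ : F 0 = {x₀}) (ha₀ : ∀ j, a x₀ j = 0)
    (hF : ∀ k, (F k).Nonempty) (hFT : ∀ k, ∀ x ∈ F k, x ∈ T)
    (hnet : ∀ k, ∀ x ∈ T, ∃ y ∈ F k, ∑ j, (a x j - a y j) ^ 2 ≤ δ k ^ 2) (L : ℕ) :
    ∃ m : (Fin s → Bool) → ℝ, (∀ σ, ∀ x ∈ T, |radSum (a x) σ| ≤ m σ) ∧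
      radAvg m ≤ Real.sqrt s * δ L +
        ∑ k ∈ Finset.range L, δ k * Real.sqrt (2 * Real.log (2 * (F (k + 1)).card)) := by
  have key : ∀ L : ℕ, ∃ m : (Fin s → Bool) → ℝ, (∀ σ, ∀ x ∈ F L, |radSum (a x) σ| ≤ m σ) ∧
      radAvg m ≤
        ∑ k ∈ Finset.range L, δ k * Real.sqrt (2 * Real.log (2 * (F (k + 1)).card)) := by
    intro L
    induction L with
    | zero =>
      refine ⟨fun _ => 0, fun σ x hx => ?_, by simp [radAvg_const]⟩
      rw [hx₀, Finset.mem_singleton] at hx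
      simp [radSum, hx, ha₀]
    | succ L ih =>
      obtain ⟨m, hm, hmavg⟩ := ih
      -- The net F (L + 1) lies in T, so each of its points has a neighbour in F L at distance at
      -- most δ L. The links at this level are indexed by F (L + 1) alone.
      choose! π hπF hπ using hnet L
      obtain ⟨m', hm', hmavg'⟩ := exists_radSum_bound (F (L + 1)) (hF _)
        (fun x j => a x j - a (π x) j) (hδ L) (fun x hx => hπ x (hFT _ x hx))
      refine ⟨fun σ => m σ + m' σ, fun σ x hx => ?_, ?_⟩
      · have h1 := hm' σ x hx
        rw [radSum_sub] at h1
        have h2 := hm σ (π x) (hπF x (hFT _ x hx))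
        calc |radSum (a x) σ| = |radSum (a (π x)) σ + (radSum (a x) σ - radSum (a (π x)) σ)| := by
              congr 1; ring
          _ ≤ _ := (abs_add_le _ _).trans (add_le_add h2 h1)
      · rw [radAvg_add, Finset.sum_range_succ]
        linarith
  obtain ⟨m, hm, hmavg⟩ := key L
  refine ⟨fun σ => Real.sqrt s * δ L + m σ, fun σ x hx => ?_, ?_⟩
  · obtain ⟨y, hy, hxy⟩ := hnet L x hx
    have h1 := abs_radSum_le (fun j => a x j - a y j) σ (hδ L) hxy
    rw [radSum_sub] at h1
    have h2 := hm σ y hy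
    calc |radSum (a x) σ| = |(radSum (a x) σ - radSum (a y) σ) + radSum (a y) σ| := by
          congr 1; ring
      _ ≤ _ := (abs_add_le _ _).trans (add_le_add h1 h2)
  · rw [radAvg_add, radAvg_const]
    linarith

end Rademacher

/-! ### Increments of p-th powers -/

theorem sq_rpow_sub_rpow_le {a b p : ℝ} (hb : 0 ≤ b) (hab : b ≤ a) (hp : 1 ≤ p) :
    (p ≤ 2 → (a ^ (p / 2) - b ^ (p / 2)) ^ 2 ≤ (a - b) ^ p) ∧
    (2 ≤ p → (a ^ (p / 2) - b ^ (p / 2)) ^ 2 ≤ p ^ 2 * ((a - b) ^ 2 * a ^ (p - 2))) := by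
  have ha : 0 ≤ a := hb.trans hab
  have hmono : b ^ (p / 2) ≤ a ^ (p / 2) := Real.rpow_le_rpow hb hab (by linarith)
  refine ⟨fun hp2 => ?_, fun hp2 => ?_⟩
  · have h1 : a ^ (p / 2) ≤ (a - b) ^ (p / 2) + b ^ (p / 2) := by
      have := Real.rpow_add_le_add_rpow (sub_nonneg.2 hab) hb (by linarith : 0 ≤ p / 2)
        (by linarith : p / 2 ≤ 1)
      simpa using this
    have h2 : (a - b) ^ p = ((a - b) ^ (p / 2)) ^ 2 := by
      rw [← Real.rpow_natCast, ← Real.rpow_mul (sub_nonneg.2 hab)]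
      congr 1
      push_cast
      ring
    rw [h2]
    exact pow_le_pow_left₀ (by linarith) (by linarith) 2
  · rcases ha.eq_or_lt with rfl | ha
    · have : b = 0 := le_antisymm hab hb
      subst this
      simp
    -- Bernoulli's inequality at b/a plays the role of the mean value theorem; for p ≤ 2 the
    -- subadditivity of t ↦ t^(p/2) was enough.
    have h1 : 1 + p / 2 * (b / a - 1) ≤ (b / a) ^ (p / 2) := by
      have := one_add_mul_self_le_rpow_one_add (s := b / a - 1)
        (by have : 0 ≤ b / a := by positivity
            linarith) (p := p / 2) (by linarith)
      simpa using this
    rw [Real.div_rpow hb ha.le, le_div_iff₀ (by positivity)] at h1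
    have h2 : a ^ (p / 2) - b ^ (p / 2) ≤ p * ((a - b) * (a ^ (p / 2) / a)) := by
      have h3 : (1 + p / 2 * (b / a - 1)) * a ^ (p / 2)
          = a ^ (p / 2) - p / 2 * ((a - b) * (a ^ (p / 2) / a)) := by field_simp; ring
      have h4 : 0 ≤ p / 2 * ((a - b) * (a ^ (p / 2) / a)) :=
        mul_nonneg (by linarith) (mul_nonneg (by linarith) (by positivity))
      linarith
    have h5 : p ^ 2 * ((a - b) ^ 2 * a ^ (p - 2)) = (p * ((a - b) * (a ^ (p / 2) / a))) ^ 2 := by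
      have : a ^ (p - 2) = (a ^ (p / 2) / a) ^ 2 := by
        rw [div_pow, ← Real.rpow_natCast (a ^ (p / 2)), ← Real.rpow_mul ha.le, Real.rpow_sub ha,
          Real.rpow_two]
        congr 2
        push_cast
        ring
      rw [this]; ring
    rw [h5]
    exact pow_le_pow_left₀ (by linarith) h2 2

/-- Factor a^p - b^p as (x - y)(x + y) with x = a^(p/2), y = b^(p/2). The difference supplies the
distance |a - b|^q; the sum supplies a^p + b^p, which is kept because it can later be summed over
the sample. -/
theorem sq_rpow_sub_le {a b A p q : ℝ} (ha : 0 ≤ a) (hb : 0 ≤ b) (haA : a ≤ A) (hbA : b ≤ A)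
    (hq : 0 < q) (hqp : q ≤ p) (hq2 : q ≤ 2) (hp : 1 ≤ p) :
    (a ^ p - b ^ p) ^ 2 ≤ 2 * p ^ 2 * A ^ (p - q) * |a - b| ^ q * (a ^ p + b ^ p) := by
  wlog hab : b ≤ a generalizing a b
  · have := this hb ha hbA haA (le_of_not_ge hab)
    rw [abs_sub_comm, add_comm (a ^ p)]
    linarith [sq_abs (a ^ p - b ^ p), sq_abs (b ^ p - a ^ p), abs_sub_comm (a ^ p) (b ^ p),
      (by ring : (a ^ p - b ^ p) ^ 2 = (b ^ p - a ^ p) ^ 2)]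
  have hd : 0 ≤ a - b := sub_nonneg.2 hab
  have hdA : a - b ≤ A := by linarith
  rw [abs_of_nonneg hd]
  rcases ha.eq_or_lt with ha0 | ha0
  · subst ha0
    have : b = 0 := le_antisymm hab hb
    subst this
    simp [hq.ne', (by linarith : p ≠ 0)]
  have hA0 : 0 < A := by linarith
  have key : (a ^ (p / 2) - b ^ (p / 2)) ^ 2 ≤ p ^ 2 * (A ^ (p - q) * (a - b) ^ q) := by
    obtain ⟨h1, h2⟩ := sq_rpow_sub_rpow_le hb hab hp
    rcases hd.eq_or_lt with hd0 | hd0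
    · have : a = b := by linarith
      subst this
      simp [hq.ne']
    rcases le_total p 2 with hp2 | hp2
    · refine (h1 hp2).trans ?_
      have h3 : (a - b) ^ p = (a - b) ^ (p - q) * (a - b) ^ q := by
        rw [← Real.rpow_add hd0]; congr 1; ring
      rw [h3]
      have h4 : (a - b) ^ (p - q) ≤ A ^ (p - q) := Real.rpow_le_rpow hd hdA (by linarith)
      have h5 : (a - b) ^ (p - q) * (a - b) ^ q ≤ A ^ (p - q) * (a - b) ^ q := by gcongr
      have h6 : 0 ≤ A ^ (p - q) * (a - b) ^ q := by positivity
      exact h5.trans (le_mul_of_one_le_left h6 (one_le_pow₀ hp))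
    · refine (h2 hp2).trans ?_
      have h3 : (a - b) ^ 2 = (a - b) ^ (2 - q) * (a - b) ^ q := by
        rw [← Real.rpow_add hd0]; norm_num
      have h4 : A ^ (p - q) = A ^ (2 - q) * A ^ (p - 2) := by
        rw [← Real.rpow_add hA0]; congr 1; ring
      rw [h3, h4]
      have h5 : (a - b) ^ (2 - q) ≤ A ^ (2 - q) := Real.rpow_le_rpow hd hdA (by linarith)
      have h6 : a ^ (p - 2) ≤ A ^ (p - 2) := Real.rpow_le_rpow ha haA (by linarith)
      calc p ^ 2 * ((a - b) ^ (2 - q) * (a - b) ^ q * a ^ (p - 2))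
          ≤ p ^ 2 * (A ^ (2 - q) * (a - b) ^ q * A ^ (p - 2)) := by gcongr
        _ = _ := by ring
  have e : ∀ x : ℝ, 0 ≤ x → x ^ p = (x ^ (p / 2)) ^ 2 := by
    intro x hx
    rw [← Real.rpow_natCast, ← Real.rpow_mul hx]
    congr 1
    push_cast
    ring
  rw [e a ha, e b hb]
  set x := a ^ (p / 2)
  set y := b ^ (p / 2)
  calc (x ^ 2 - y ^ 2) ^ 2 = (x - y) ^ 2 * (x + y) ^ 2 := by ring
    _ ≤ (p ^ 2 * (A ^ (p - q) * (a - b) ^ q)) * (2 * (x ^ 2 + y ^ 2)) := by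
        refine mul_le_mul key ?_ (by positivity) (by positivity)
        nlinarith [sq_nonneg (x - y)]
    _ = _ := by ring

/-! ### Chaining for powers of seminorms -/

section ChainingSeminorm

/-- By truncated subtraction the exponent is 0 for k < k₀, giving at most k₀ terms equal to 1; the
remaining geometric tail 3/4 + (3/4)² + … sums to 3. -/
theorem sum_geometric_truncated_le (k₀ L : ℕ) :
    ∑ k ∈ Finset.range L, (3 / 4 : ℝ) ^ (k + 1 - k₀) ≤ k₀ + 3 := by
  have key : ∀ L : ℕ, ∑ k ∈ Finset.range L, (3 / 4 : ℝ) ^ (k + 1 - k₀)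
      = (min L k₀ : ℕ) + 3 * (1 - (3 / 4) ^ (L - k₀)) := by
    intro L
    induction L with
    | zero => simp
    | succ L ih =>
      rw [Finset.sum_range_succ, ih]
      rcases lt_or_ge L k₀ with h | h
      · rw [show L + 1 - k₀ = 0 by omega, show L - k₀ = 0 by omega, min_eq_left h.le,
          min_eq_left (by omega)]
        push_cast
        ring
      · obtain ⟨j, rfl⟩ := Nat.exists_eq_add_of_le h
        rw [show k₀ + j + 1 - k₀ = j + 1 by omega, show k₀ + j - k₀ = j by omega,
          min_eq_right h, min_eq_right (by omega)]
        ring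
  rw [key]
  have h1 : ((min L k₀ : ℕ) : ℝ) ≤ k₀ := by exact_mod_cast min_le_right _ _
  have h2 : (0 : ℝ) ≤ (3 / 4) ^ (L - k₀) := by positivity
  linarith

theorem clog_four_le {n : ℕ} (hn : 2 ≤ n) :
    5 * (Nat.clog 4 n : ℝ) + 16 ≤ 42 * Real.log n := by
  have hl2 : (0.69 : ℝ) < Real.log 2 := by linarith [Real.log_two_gt_d9]
  have hn2 : (2 : ℝ) ≤ n := by exact_mod_cast hn
  have hlogn : Real.log 2 ≤ Real.log n := Real.log_le_log (by norm_num) hn2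
  have hk : 1 ≤ Nat.clog 4 n := Nat.clog_pos (by norm_num) hn
  have h1 : 4 ^ (Nat.clog 4 n - 1) < n := Nat.pow_pred_clog_lt_self (by norm_num) (by omega)
  have h2 : ((4 : ℝ) ^ (Nat.clog 4 n - 1)) ≤ n := by exact_mod_cast h1.le
  have h3 := Real.log_le_log (by positivity) h2
  have h4 : Real.log 4 = 2 * Real.log 2 := by
    rw [show (4 : ℝ) = 2 ^ 2 by norm_num, Real.log_pow]; norm_num
  rw [Real.log_pow, Nat.cast_sub hk, h4] at h3
  push_cast at h3
  nlinarith

/-- The square root of the entropy doubles with each level up to k₀. After k₀ only the volumetric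
term (k - k₀) n log 4 grows, linearly, and n ≤ 4^k₀ makes growth by 3/2 per level sufficient,
strictly less than the halving of the radii can absorb. -/
theorem log_two_mul_card_bound {n k₀ k : ℕ} (hk₀ : n ≤ 4 ^ k₀) {c : ℝ} (hc0 : 1 ≤ c)
    (hc : c ≤ 2 * Real.exp (4 ^ (min k k₀)) * 4 ^ ((k - k₀) * n)) :
    Real.sqrt (2 * Real.log (2 * c)) ≤ 5 / 2 * 2 ^ (min k k₀) * (3 / 2) ^ (k - k₀) := by
  have hl4 : Real.log 4 ≤ 1.4 := by
    rw [show (4 : ℝ) = 2 ^ 2 by norm_num, Real.log_pow]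
    have := Real.log_two_lt_d9
    norm_num
    linarith
  set i := min k k₀ with hi
  set j := k - k₀ with hj
  have h1 : Real.log (2 * c) ≤ Real.log 4 + 4 ^ i + j * n * Real.log 4 := by
    have h2 : 2 * c ≤ 4 * Real.exp (4 ^ i) * 4 ^ (j * n) := by linarith
    have h3 := Real.log_le_log (by linarith) h2
    rw [Real.log_mul (x := 4 * Real.exp (4 ^ i)) (by positivity) (by positivity),
      Real.log_mul (x := 4) (by norm_num) (by positivity), Real.log_exp, Real.log_pow] at h3
    push_cast at h3
    exact h3
  have h4i : (1 : ℝ) ≤ 4 ^ i := one_le_pow₀ (by norm_num)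
  have hjn : (j : ℝ) * n ≤ j * 4 ^ i := by
    rcases Nat.eq_zero_or_pos j with h | h
    · simp [h]
    · have : i = k₀ := by omega
      rw [this]
      gcongr
      exact_mod_cast hk₀
  have hjb : (1 : ℝ) + j ≤ (9 / 4) ^ j := by
    have := one_add_mul_le_pow (a := (5 / 4 : ℝ)) (by norm_num) j
    norm_num at this
    have hj0 : (0 : ℝ) ≤ j := by positivity
    linarith
  have hj0 : (0 : ℝ) ≤ j := by positivity
  refine Real.sqrt_le_iff.2 ⟨by positivity, ?_⟩
  have e : (5 / 2 * 2 ^ i * (3 / 2) ^ j : ℝ) ^ 2 = 25 / 4 * 4 ^ i * (9 / 4) ^ j := by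
    rw [mul_pow, mul_pow, ← pow_mul, ← pow_mul, mul_comm i, mul_comm j, pow_mul, pow_mul]
    norm_num
  rw [e]
  have h5 : (j : ℝ) * n * Real.log 4 ≤ j * 4 ^ i * 1.4 := by
    have : 0 ≤ Real.log 4 := Real.log_nonneg (by norm_num)
    gcongr
  have h6 : (4 : ℝ) ^ i * (1 + j) ≤ 4 ^ i * (9 / 4) ^ j := by gcongr
  nlinarith

variable {n : ℕ} {M : Seminorm ℝ (EuclideanSpace ℝ (Fin n))} {q : ℝ}

/-- The factor v_j(x)^p + v_j(y)^p of the increment bound is summed over j using Q, instead of being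
estimated termwise by A^p. -/
theorem sum_sq_increment_le {s : ℕ} {p : ℝ} (hq : 0 < q) (hq2 : q ≤ 2) (hp : 1 ≤ p) (hqp : q ≤ p)
    (hs : 1 ≤ s) (v : Fin s → Seminorm ℝ (EuclideanSpace ℝ (Fin n)))
    {A Q : ℝ} {x y : EuclideanSpace ℝ (Fin n)} (hx : ∀ j, v j x ≤ A) (hy : ∀ j, v j y ≤ A)
    (hQx : ∑ j, v j x ^ p ≤ s * Q) (hQy : ∑ j, v j y ^ p ≤ s * Q) {r : ℝ}
    (hr : (Finset.univ.sup v) (x - y) ≤ r) :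
    ∑ j, (v j x ^ p / s - v j y ^ p / s) ^ 2 ≤ 4 * p ^ 2 * A ^ (p - q) * Q / s * r ^ q := by
  have hs0 : (0 : ℝ) < s := by exact_mod_cast hs
  have hr0 : 0 ≤ r := (apply_nonneg _ _).trans hr
  have hA0 : 0 ≤ A := (apply_nonneg _ _).trans (hx ⟨0, hs⟩)
  have h1 : ∀ j, (v j x ^ p / s - v j y ^ p / s) ^ 2
      ≤ 2 * p ^ 2 * A ^ (p - q) * r ^ q * (v j x ^ p + v j y ^ p) / s ^ 2 := by
    intro j
    rw [← sub_div, div_pow]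
    gcongr
    have h2 : |v j x - v j y| ≤ r := by
      refine (abs_sub_map_le_sub (v j) x y).trans (le_trans ?_ hr)
      exact Seminorm.le_finset_sup_apply (Finset.mem_univ j)
    refine (sq_rpow_sub_le (apply_nonneg _ _) (apply_nonneg _ _) (hx j) (hy j) hq hqp hq2 hp).trans
      ?_
    have h3 : 0 ≤ v j x ^ p + v j y ^ p :=
      add_nonneg (Real.rpow_nonneg (apply_nonneg _ _) _) (Real.rpow_nonneg (apply_nonneg _ _) _)
    have h4 : |v j x - v j y| ^ q ≤ r ^ q := Real.rpow_le_rpow (abs_nonneg _) h2 hq.le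
    gcongr
  refine (Finset.sum_le_sum fun j _ => h1 j).trans ?_
  rw [← Finset.sum_div, ← Finset.mul_sum, Finset.sum_add_distrib]
  calc 2 * p ^ 2 * A ^ (p - q) * r ^ q * (∑ j, v j x ^ p + ∑ j, v j y ^ p) / s ^ 2
      ≤ 2 * p ^ 2 * A ^ (p - q) * r ^ q * (s * Q + s * Q) / s ^ 2 := by
        gcongr
    _ = _ := by field_simp; ring

/-- The Rademacher process attached to the powers `v j ^ p` of seminorms is bounded on average. -/
theorem exists_radSum_seminorm_bound (hn : 2 ≤ n) (hM : ∀ x, M x = 0 → x = 0) (hq1 : 1 ≤ q)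
    (hq2 : q ≤ 2) {p : ℝ} (hp : 1 ≤ p) (hqp : q ≤ p) {S : ℝ} (hS0 : 0 < S)
    (hS : IsUniformlySmooth q S M) {s : ℕ} (hs : 1 ≤ s)
    (v : Fin s → Seminorm ℝ (EuclideanSpace ℝ (Fin n))) {R A Q : ℝ} (hR0 : 0 ≤ R)
    (hR : 1 / 2 ≤ (gibbs M q).real {z | (Finset.univ.sup v) z ≤ R})
    (T : Set (EuclideanSpace ℝ (Fin n))) (hT : ∀ x ∈ T, M x ≤ 1) (h0 : 0 ∈ T)
    (hA : ∀ x ∈ T, ∀ j, v j x ≤ A) (hAR : A ≤ 2 * R * S)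
    (hQ : ∀ x ∈ T, ∑ j, v j x ^ p ≤ s * Q) :
    ∃ m : (Fin s → Bool) → ℝ,
      (∀ σ, ∀ x ∈ T, |radSum (fun j => v j x ^ p / s) σ| ≤ m σ) ∧
      radAvg m ≤ 42 * Real.log n *
        Real.sqrt (4 * p ^ 2 * A ^ (p - q) * Q / s * (2 * R * S) ^ q) := by
  have hq0 : 0 < q := by linarith
  have hs0 : (0 : ℝ) < s := by exact_mod_cast hs
  have hA0 : 0 ≤ A := (apply_nonneg _ _).trans (hA 0 h0 ⟨0, hs⟩)
  have hQ0 : 0 ≤ Q := by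
    have h1 := hQ 0 h0
    have h2 : 0 ≤ ∑ j, v j 0 ^ p :=
      Finset.sum_nonneg fun j _ => Real.rpow_nonneg (apply_nonneg _ _) _
    exact nonneg_of_mul_nonneg_right (h2.trans h1) hs0
  set V := Finset.univ.sup v with hV
  set k₀ := Nat.clog 4 n with hk₀
  have hnk : n ≤ 4 ^ k₀ := Nat.le_pow_clog (by norm_num) n
  set D := 2 * R * S with hD
  have hD0 : 0 ≤ D := by positivity
  set H := 4 * p ^ 2 * A ^ (p - q) * Q / s with hH
  have hH0 : 0 ≤ H := by positivity
  set Δ := Real.sqrt (H * D ^ q) with hΔ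
  have hΔ2 : Δ ^ 2 = H * D ^ q := Real.sq_sqrt (by positivity)
  -- Up to level k₀ the nets come from translation alone, with η = 1 and (lS)^q = 4^k. From then on
  -- l is frozen and η shrinks. In both ranges the q-th power of the radius is D^q 4^(-k), see
  -- `hrad`, so the chaining distances halve at each level.
  let η : ℕ → ℝ := fun k => ((1 / 4 : ℝ) ^ (k - k₀)) ^ (1 / q)
  let l : ℕ → ℝ := fun k => ((4 : ℝ) ^ (min k k₀)) ^ (1 / q) / S
  have hη0 : ∀ k, 0 < η k := fun k => by positivity
  have hη1 : ∀ k, η k ≤ 1 := fun k =>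
    Real.rpow_le_one (by positivity) (pow_le_one₀ (by norm_num) (by norm_num)) (by positivity)
  have hl0 : ∀ k, 0 < l k := fun k => by positivity
  have hlS : ∀ k, (l k * S) ^ q = 4 ^ (min k k₀) := fun k => by
    simp only [l]
    rw [div_mul_cancel₀ _ hS0.ne', ← Real.rpow_mul (by positivity), one_div,
      inv_mul_cancel₀ hq0.ne', Real.rpow_one]
  have hηq : ∀ k, η k ^ q = (1 / 4) ^ (k - k₀) := fun k => by
    simp only [η]
    rw [← Real.rpow_mul (by positivity), one_div q,
      inv_mul_cancel₀ hq0.ne', Real.rpow_one]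
  have hrad : ∀ k, (2 * η k * R / l k) ^ q = D ^ q * (1 / 4) ^ k := by
    intro k
    have e : 2 * η k * R / l k = D * η k / (l k * S) := by
      have := (hl0 k).ne'
      rw [hD]; field_simp
    rw [e, Real.div_rpow (mul_nonneg hD0 (hη0 k).le) (mul_pos (hl0 k) hS0).le,
      Real.mul_rpow hD0 (hη0 k).le, hηq, hlS]
    have : (1 / 4 : ℝ) ^ k = (1 / 4) ^ (k - k₀) * (1 / 4) ^ (min k k₀) := by
      rw [← pow_add]; congr 1; omega
    rw [this, one_div_pow _ (min k k₀)]
    ring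
  have hηn : ∀ k, (1 / 4 : ℝ) ^ ((k - k₀) * n) ≤ η k ^ n := by
    intro k
    rw [pow_mul]
    refine pow_le_pow_left₀ (by positivity) ?_ n
    calc ((1 / 4 : ℝ) ^ (k - k₀)) = ((1 / 4 : ℝ) ^ (k - k₀)) ^ (1 : ℝ) := (Real.rpow_one _).symm
      _ ≤ _ := Real.rpow_le_rpow_of_exponent_ge (by positivity)
          (pow_le_one₀ (by norm_num) (by norm_num)) (by rw [div_le_one hq0]; exact hq1)
  choose G hGT hGnet hGcard using fun k => exists_net (by omega) hM hq0 hS0 hS V hR0 hR (hl0 k)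
    (hη0 k) (hη1 k) T hT
  -- The chain starts at the single point 0, where the process vanishes. It is a net of radius D
  -- because V ≤ A ≤ D on T.
  let F : ℕ → Finset (EuclideanSpace ℝ (Fin n)) := fun k => if k = 0 then {0} else G k
  have hF0 : F 0 = {0} := by simp [F]
  have hFk : ∀ k, k ≠ 0 → F k = G k := fun k hk => by simp [F, hk]
  have hFT : ∀ k, ∀ x ∈ F k, x ∈ T := by
    intro k x hx
    rcases eq_or_ne k 0 with rfl | hk
    · rw [hF0, Finset.mem_singleton] at hx
      rwa [hx]
    · rw [hFk k hk] at hx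
      exact hGT k x hx
  have hnet : ∀ k, ∀ x ∈ T, ∃ y ∈ F k, ∑ j, (v j x ^ p / s - v j y ^ p / s) ^ 2
      ≤ (Δ * (1 / 2) ^ k) ^ 2 := by
    intro k x hx
    have e : (Δ * (1 / 2) ^ k) ^ 2 = H * (D ^ q * (1 / 4) ^ k) := by
      rw [mul_pow, hΔ2, ← pow_mul, mul_comm k, pow_mul]
      norm_num
      ring
    rw [e]
    rcases eq_or_ne k 0 with rfl | hk
    · refine ⟨0, by simp [hF0], ?_⟩
      rw [pow_zero, mul_one]
      refine sum_sq_increment_le hq0 hq2 hp hqp hs v (hA x hx) (hA 0 h0) (hQ x hx) (hQ 0 h0) ?_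
      rw [sub_zero]
      exact Seminorm.finset_sup_apply_le hD0 fun j _ => (hA x hx j).trans hAR
    · obtain ⟨y, hy, hxy⟩ := hGnet k x hx
      refine ⟨y, by rwa [hFk k hk], ?_⟩
      rw [← hrad k]
      exact sum_sq_increment_le hq0 hq2 hp hqp hs v (hA x hx) (hA y (hGT k y hy)) (hQ x hx)
        (hQ y (hGT k y hy)) hxy
  have hFne : ∀ k, (F k).Nonempty := fun k => by
    obtain ⟨y, hy, -⟩ := hnet k 0 h0
    exact ⟨y, hy⟩
  have hΔ0 : 0 ≤ Δ := Real.sqrt_nonneg _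
  -- After s levels the remainder is √s · 2^(-s) Δ ≤ Δ.
  obtain ⟨m, hm, hmavg⟩ := exists_chaining_bound T (fun x j => v j x ^ p / s) F
    (fun k => Δ * (1 / 2) ^ k) (fun k => by positivity) 0 hF0
    (fun j => by rw [map_zero, Real.zero_rpow (by linarith), zero_div]) hFne hFT hnet s
  refine ⟨m, hm, hmavg.trans ?_⟩
  have hterm : ∀ k ∈ Finset.range s,
      Δ * (1 / 2) ^ k * Real.sqrt (2 * Real.log (2 * (F (k + 1)).card))
        ≤ 5 * Δ * (3 / 4) ^ (k + 1 - k₀) := by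
    intro k _
    have hc1 : (1 : ℝ) ≤ (F (k + 1)).card := by exact_mod_cast (hFne (k + 1)).card_pos
    have hc2 : ((F (k + 1)).card : ℝ)
        ≤ 2 * Real.exp (4 ^ (min (k + 1) k₀)) * 4 ^ ((k + 1 - k₀) * n) := by
      rw [hFk _ (by omega)]
      refine (hGcard (k + 1)).trans ?_
      rw [hlS, div_eq_mul_inv]
      gcongr
      rw [inv_le_comm₀ (pow_pos (hη0 _) n) (by positivity), ← inv_pow]
      simpa using hηn (k + 1)
    have h1 := log_two_mul_card_bound hnk hc1 hc2
    have h2 : Δ * (1 / 2) ^ k * (5 / 2 * 2 ^ (min (k + 1) k₀) * (3 / 2) ^ (k + 1 - k₀))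
        = 5 * Δ * (3 / 4) ^ (k + 1 - k₀) := by
      have e1 : (1 / 2 : ℝ) ^ k = 2 * ((1 / 2) ^ (min (k + 1) k₀) * (1 / 2) ^ (k + 1 - k₀)) := by
        rw [← pow_add, show min (k + 1) k₀ + (k + 1 - k₀) = k + 1 by omega, pow_succ]
        ring
      have e2 : (1 / 2 : ℝ) ^ (min (k + 1) k₀) * 2 ^ (min (k + 1) k₀) = 1 := by
        rw [← mul_pow]; norm_num
      have e3 : (1 / 2 : ℝ) ^ (k + 1 - k₀) * (3 / 2) ^ (k + 1 - k₀) = (3 / 4) ^ (k + 1 - k₀) := by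
        rw [← mul_pow]; norm_num
      rw [e1, ← e3]
      calc _ = 5 * Δ * ((1 / 2) ^ (k + 1 - k₀) * (3 / 2) ^ (k + 1 - k₀)) *
            ((1 / 2 : ℝ) ^ (min (k + 1) k₀) * 2 ^ (min (k + 1) k₀)) := by ring
        _ = _ := by rw [e2, mul_one]
    rw [← h2]
    gcongr
  have hsum : ∑ k ∈ Finset.range s,
      Δ * (1 / 2) ^ k * Real.sqrt (2 * Real.log (2 * (F (k + 1)).card)) ≤ 5 * Δ * (k₀ + 3) := by
    refine (Finset.sum_le_sum hterm).trans ?_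
    rw [← Finset.mul_sum]
    gcongr
    exact sum_geometric_truncated_le k₀ s
  have hrem : Real.sqrt s * (Δ * (1 / 2) ^ s) ≤ Δ := by
    have h1 : Real.sqrt s ≤ 2 ^ s := by
      refine Real.sqrt_le_iff.2 ⟨by positivity, ?_⟩
      have h2 : (s : ℝ) ≤ 2 ^ s := by exact_mod_cast Nat.lt_two_pow_self.le
      have h3 : (1 : ℝ) ≤ 2 ^ s := one_le_pow₀ (by norm_num)
      nlinarith
    have h4 : (2 : ℝ) ^ s * (1 / 2) ^ s = 1 := by rw [← mul_pow]; norm_num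
    calc Real.sqrt s * (Δ * (1 / 2) ^ s) ≤ 2 ^ s * (Δ * (1 / 2) ^ s) := by gcongr
      _ = Δ * (2 ^ s * (1 / 2) ^ s) := by ring
      _ = Δ := by rw [h4, mul_one]
  have hfin := clog_four_le hn
  rw [← hk₀] at hfin
  calc _ ≤ Δ + 5 * Δ * (k₀ + 3) := add_le_add hrem hsum
    _ = (5 * (k₀ : ℝ) + 16) * Δ := by ring
    _ ≤ 42 * Real.log n * Δ := by gcongr

end ChainingSeminorm

/-! ### Independent sampling and symmetrization -/

section Sampling

variable {s m : ℕ} {ρ : Fin m → ℝ}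

/-- The probability of drawing the sample `I` in independent draws from `ρ`. -/
def sampleWeight (ρ : Fin m → ℝ) (I : Fin s → Fin m) : ℝ := ∏ j, ρ (I j)

theorem sampleWeight_nonneg (hρ0 : ∀ i, 0 ≤ ρ i) (I : Fin s → Fin m) : 0 ≤ sampleWeight ρ I :=
  Finset.prod_nonneg fun _ _ => hρ0 _

theorem sum_sampleWeight (hρ1 : ∑ i, ρ i = 1) : ∑ I : Fin s → Fin m, sampleWeight ρ I = 1 := by
  have h := Finset.prod_univ_sum (fun _ : Fin s => (Finset.univ : Finset (Fin m)))
    (fun _ i => ρ i)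
  rw [Fintype.piFinset_univ] at h
  simp only [sampleWeight]
  rw [← h, hρ1, Finset.prod_const_one]

theorem sum_sampleWeight_mul_apply (hρ1 : ∑ i, ρ i = 1) (h : Fin m → ℝ) (k : Fin s) :
    ∑ I : Fin s → Fin m, sampleWeight ρ I * h (I k) = ∑ i, ρ i * h i := by
  have e := Finset.prod_univ_sum (fun _ : Fin s => (Finset.univ : Finset (Fin m)))
    (fun j i => if j = k then ρ i * h i else ρ i)
  rw [Fintype.piFinset_univ] at e
  have e1 : ∏ j : Fin s, ∑ i, (if j = k then ρ i * h i else ρ i) = ∑ i, ρ i * h i := by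
    rw [Finset.prod_eq_single k]
    · simp
    · intro j _ hj
      simp [hj, hρ1]
    · simp
  rw [← e1, e]
  refine Finset.sum_congr rfl fun I _ => ?_
  have : ∀ j, (if j = k then ρ (I j) * h (I j) else ρ (I j))
      = ρ (I j) * (if j = k then h (I j) else 1) := by
    intro j; split_ifs <;> simp
  simp_rw [this]
  rw [Finset.prod_mul_distrib, Finset.prod_ite_eq' Finset.univ k, sampleWeight]
  simp

/-- The exchange of the draws `I j` and `I' j` at those `j` where the sign is negative. -/
def swapDraws (σ : Fin s → Bool) :
    ((Fin s → Fin m) × (Fin s → Fin m)) ≃ ((Fin s → Fin m) × (Fin s → Fin m)) where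
  toFun z := (fun j => if σ j then z.1 j else z.2 j, fun j => if σ j then z.2 j else z.1 j)
  invFun z := (fun j => if σ j then z.1 j else z.2 j, fun j => if σ j then z.2 j else z.1 j)
  left_inv z := by ext j <;> by_cases h : σ j <;> simp [h]
  right_inv z := by ext j <;> by_cases h : σ j <;> simp [h]

theorem sampleWeight_swapDraws (σ : Fin s → Bool) (z : (Fin s → Fin m) × (Fin s → Fin m)) :
    sampleWeight ρ (swapDraws σ z).1 * sampleWeight ρ (swapDraws σ z).2
      = sampleWeight ρ z.1 * sampleWeight ρ z.2 := by
  simp only [sampleWeight, swapDraws, Equiv.coe_fn_mk]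
  rw [← Finset.prod_mul_distrib, ← Finset.prod_mul_distrib]
  refine Finset.prod_congr rfl fun j _ => ?_
  split_ifs
  · rfl
  · ring

/-- Symmetrization: if the Rademacher processes attached to all samples are small then some sample
average is uniformly close to the mean. -/
theorem exists_sample (hρ0 : ∀ i, 0 ≤ ρ i) (hρ1 : ∑ i, ρ i = 1) (hs : 1 ≤ s) {X : Type*}
    (T : Set X) (x₀ : X) (hx₀ : x₀ ∈ T) (g : Fin m → X → ℝ) {B : ℝ}
    (hB : ∀ i, ∀ x ∈ T, |g i x| ≤ B) {θ ε : ℝ} (hε0 : 0 < ε) (hε1 : ε < 1) (hθ : 2 * θ ≤ ε / 2)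
    (H : ∀ (I : Fin s → Fin m) (D : ℝ), 0 ≤ D →
      (∀ x ∈ T, |(∑ j, g (I j) x / s) - ∑ i, ρ i * g i x| ≤ D) →
      ∃ b : (Fin s → Bool) → ℝ, (∀ σ, ∀ x ∈ T, |radSum (fun j => g (I j) x / s) σ| ≤ b σ) ∧
        radAvg b ≤ θ * (1 + D)) :
    ∃ I : Fin s → Fin m, ∀ x ∈ T, |(∑ j, g (I j) x / s) - ∑ i, ρ i * g i x| ≤ ε := by
  classical
  have hs0 : (0 : ℝ) < s := by exact_mod_cast hs
  let Q : (Fin s → Fin m) → X → ℝ := fun I x => ∑ j, g (I j) x / s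
  have : Nonempty T := ⟨⟨x₀, hx₀⟩⟩
  -- The uniform distance between the averages of two independent samples.
  let d : (Fin s → Fin m) × (Fin s → Fin m) → ℝ := fun z => ⨆ x : T, |Q z.1 x - Q z.2 x|
  have hQB : ∀ I, ∀ x ∈ T, |Q I x| ≤ B := by
    intro I x hx
    refine (Finset.abs_sum_le_sum_abs _ _).trans ?_
    have : ∀ j, |g (I j) x / s| ≤ B / s := fun j => by
      rw [abs_div, abs_of_pos hs0]
      gcongr
      exact hB _ x hx
    refine (Finset.sum_le_sum fun j _ => this j).trans (le_of_eq ?_)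
    simp only [Finset.sum_const, Finset.card_univ, Fintype.card_fin, nsmul_eq_mul]
    field_simp
  have hbdd : ∀ z : (Fin s → Fin m) × (Fin s → Fin m),
      BddAbove (Set.range fun x : T => |Q z.1 x - Q z.2 x|) := by
    intro z
    refine ⟨B + B, ?_⟩
    rintro _ ⟨x, rfl⟩
    refine (abs_sub _ _).trans (add_le_add (hQB _ _ x.2) (hQB _ _ x.2))
  have hd : ∀ z, ∀ x ∈ T, |Q z.1 x - Q z.2 x| ≤ d z := fun z x hx =>
    le_ciSup (hbdd z) ⟨x, hx⟩
  have hd0 : ∀ z, 0 ≤ d z := fun z => (abs_nonneg _).trans (hd z x₀ hx₀)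
  let W : (Fin s → Fin m) → ℝ := sampleWeight ρ
  have hW0 : ∀ I, 0 ≤ W I := sampleWeight_nonneg hρ0
  have hW1 : ∑ I, W I = 1 := sum_sampleWeight hρ1
  let D : (Fin s → Fin m) → ℝ := fun I => ∑ I', W I' * d (I, I')
  have hD0 : ∀ I, 0 ≤ D I := fun I =>
    Finset.sum_nonneg fun I' _ => mul_nonneg (hW0 I') (hd0 _)
  have hmean : ∀ x, ∑ I, W I * Q I x = ∑ i, ρ i * g i x := by
    intro x
    simp only [Q, Finset.mul_sum]
    rw [Finset.sum_comm]
    have : ∀ j : Fin s, ∑ I : Fin s → Fin m, W I * (g (I j) x / s)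
        = (∑ i, ρ i * g i x) / s := by
      intro j
      rw [← sum_sampleWeight_mul_apply hρ1 (fun i => g i x) j, Finset.sum_div]
      exact Finset.sum_congr rfl fun I _ => by simp only [W]; ring
    simp_rw [this]
    simp only [Finset.sum_const, Finset.card_univ, Fintype.card_fin, nsmul_eq_mul]
    field_simp
  -- Jensen: the mean is the average of `Q I'` over an independent sample I'.
  have hD : ∀ I, ∀ x ∈ T, |Q I x - ∑ i, ρ i * g i x| ≤ D I := by
    intro I x hx
    have e : Q I x - ∑ i, ρ i * g i x = ∑ I', W I' * (Q I x - Q I' x) := by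
      simp_rw [mul_sub]
      rw [Finset.sum_sub_distrib, hmean, ← Finset.sum_mul, hW1, one_mul]
    rw [e]
    refine (Finset.abs_sum_le_sum_abs _ _).trans (Finset.sum_le_sum fun I' _ => ?_)
    rw [abs_mul, abs_of_nonneg (hW0 I')]
    exact mul_le_mul_of_nonneg_left (hd (I, I') x hx) (hW0 I')
  choose b hb hbavg using fun I => H I (D I) (hD0 I) (hD I)
  have hswap : ∀ (σ : Fin s → Bool) z, d (swapDraws σ z) ≤ b z.1 σ + b z.2 σ := by
    intro σ z
    refine ciSup_le fun x => ?_
    have e : Q (swapDraws σ z).1 x - Q (swapDraws σ z).2 x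
        = radSum (fun j => g (z.1 j) x / s) σ - radSum (fun j => g (z.2 j) x / s) σ := by
      simp only [Q, radSum, swapDraws, Equiv.coe_fn_mk]
      rw [← Finset.sum_sub_distrib, ← Finset.sum_sub_distrib]
      refine Finset.sum_congr rfl fun j _ => ?_
      by_cases h : σ j
      · simp [h, radSign]
      · simp [h, radSign]; ring
    rw [e]
    exact (abs_sub _ _).trans (add_le_add (hb _ σ x x.2) (hb _ σ x x.2))
  set ED := ∑ I, W I * D I with hED
  have hED0 : 0 ≤ ED := Finset.sum_nonneg fun I _ => mul_nonneg (hW0 I) (hD0 I)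
  have hEDz : ED = ∑ z : (Fin s → Fin m) × (Fin s → Fin m), W z.1 * W z.2 * d z := by
    rw [Fintype.sum_prod_type]
    refine Finset.sum_congr rfl fun I _ => ?_
    simp only [D, Finset.mul_sum, mul_assoc]
  -- Exchanging draws preserves the law of the pair of samples and turns their difference into a
  -- difference of two Rademacher sums.
  have hσ : ∀ σ : Fin s → Bool, ED ≤ 2 * ∑ I, W I * b I σ := by
    intro σ
    calc ED = ∑ z, W (swapDraws σ z).1 * W (swapDraws σ z).2 * d (swapDraws σ z) := by
          rw [hEDz]
          exact (Equiv.sum_comp (swapDraws σ) (fun z => W z.1 * W z.2 * d z)).symm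
      _ ≤ ∑ z : (Fin s → Fin m) × (Fin s → Fin m), W z.1 * W z.2 * (b z.1 σ + b z.2 σ) := by
          refine Finset.sum_le_sum fun z _ => ?_
          simp only [W]
          rw [sampleWeight_swapDraws]
          exact mul_le_mul_of_nonneg_left (hswap σ z) (mul_nonneg (hW0 _) (hW0 _))
      _ = 2 * ∑ I, W I * b I σ := by
          rw [Fintype.sum_prod_type]
          have e1 : ∀ I I', W I * W I' * (b I σ + b I' σ)
              = W I * b I σ * W I' + W I * (W I' * b I' σ) := fun I I' => by ring
          simp_rw [e1, Finset.sum_add_distrib, ← Finset.mul_sum, ← Finset.sum_mul, hW1]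
          ring
  have hav : ED ≤ 2 * ∑ I, W I * radAvg (b I) := by
    have h1 := radAvg_mono hσ
    rw [radAvg_const, radAvg_const_mul, radAvg_sum] at h1
    simpa only [radAvg_const_mul] using h1
  have hfin : ED ≤ 2 * θ * (1 + ED) := by
    refine hav.trans ?_
    have h1 : ∑ I, W I * radAvg (b I) ≤ ∑ I, W I * (θ * (1 + D I)) :=
      Finset.sum_le_sum fun I _ => mul_le_mul_of_nonneg_left (hbavg I) (hW0 I)
    have h2 : ∑ I, W I * (θ * (1 + D I)) = θ * (1 + ED) := by
      have e1 : ∀ I, W I * (θ * (1 + D I)) = θ * (W I + W I * D I) := fun I => by ring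
      simp_rw [e1]
      rw [← Finset.mul_sum, Finset.sum_add_distrib, hW1]
    linarith
  -- The self-bounding inequality gives ED ≤ (ε/2)(1 + ED), hence ED ≤ ε/(2 - ε) ≤ ε.
  have hEDε : ED ≤ ε := by nlinarith
  by_contra! hcon
  have hDε : ∀ I, ε < D I := by
    intro I
    obtain ⟨x, hx, hlt⟩ := hcon I
    exact hlt.trans_le (hD I x hx)
  have : ε < ED := by
    have e : ε = ∑ I, W I * ε := by rw [← Finset.sum_mul, hW1, one_mul]
    have hex : ∃ I ∈ Finset.univ, 0 < W I := by
      by_contra! hno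
      have : ∑ I, W I ≤ 0 := Finset.sum_nonpos hno
      linarith
    obtain ⟨I₀, -, hI₀⟩ := hex
    rw [e, hED]
    exact Finset.sum_lt_sum (fun I _ => mul_le_mul_of_nonneg_left (hDε I).le (hW0 I))
      ⟨I₀, Finset.mem_univ _, mul_lt_mul_of_pos_left (hDε I₀) hI₀⟩
  linarith

end Sampling

/-! ### Sparsification by sampling proportionally to the moments -/

section Sparsify

variable {n m : ℕ} {M : Seminorm ℝ (EuclideanSpace ℝ (Fin n))} {p q : ℝ}

theorem lpSum_rpow (hp : 1 ≤ p) (N : Fin m → Seminorm ℝ (EuclideanSpace ℝ (Fin n)))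
    (x : EuclideanSpace ℝ (Fin n)) : lpSum p hp N x ^ p = ∑ i, N i x ^ p := by
  have h : lpSum p hp N x = (∑ i, N i x ^ p) ^ (1 / p) := rfl
  rw [h, ← Real.rpow_mul (Finset.sum_nonneg fun i _ => Real.rpow_nonneg (apply_nonneg _ _) _),
    one_div, inv_mul_cancel₀ (by linarith), Real.rpow_one]

theorem rpow_apply_le_lpSum_rpow (hp : 1 ≤ p) (N : Fin m → Seminorm ℝ (EuclideanSpace ℝ (Fin n)))
    (i : Fin m) (x : EuclideanSpace ℝ (Fin n)) : N i x ^ p ≤ lpSum p hp N x ^ p := by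
  rw [lpSum_rpow]
  exact Finset.single_le_sum (f := fun i => N i x ^ p)
    (fun i _ => Real.rpow_nonneg (apply_nonneg _ _) _) (Finset.mem_univ i)

/-- Sampling the seminorms with probabilities proportional to their `p`-th moments produces a
sparse approximation, as soon as the number of samples is large enough. -/
theorem exists_sparse_weights (hn : 2 ≤ n) (hp : 1 ≤ p) (hq1 : 1 ≤ q) (hq2 : q ≤ 2) (hqp : q ≤ p)
    (N : Fin m → Seminorm ℝ (EuclideanSpace ℝ (Fin n)))
    (hM : ∀ x, M x = 0 → x = 0) {S : ℝ} (hS0 : 0 < S) (hS : IsUniformlySmooth q S M)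
    {K : ℝ} (hNM : ∀ x, lpSum p hp N x ≤ K * M x) {Y : ℝ} (hY0 : 0 < Y)
    (hY : ∫ z, lpSum p hp N z ^ p ∂(gibbs M q) ≤ Y ^ p) {l : ℝ} (hl : 0 < l) {s : ℕ}
    (hs : 1 ≤ s) {ε : ℝ} (hε0 : 0 < ε) (hε1 : ε < 1) {A R : ℝ}
    (hAdef : A = (2 * Real.exp (l ^ q)) ^ (1 / p) * (4 / l * S) * Y)
    (hRdef : R = 12 * Real.log (2 * s) * Y) (hAR : A ≤ 2 * R * S)
    (hs_large : 84 * Real.log n * Real.sqrt (4 * p ^ 2 * A ^ (p - q) / s * (2 * R * S) ^ q)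
      ≤ ε / 2) :
    ∃ w : Fin m → ℝ, (∀ i, 0 ≤ w i) ∧ (Finset.univ.filter fun i => w i ≠ 0).card ≤ s ∧
      ∀ x, M x ≤ lpSum p hp N x →
        |lpSum p hp N x ^ p - ∑ i, w i * N i x ^ p| ≤ ε * lpSum p hp N x ^ p := by
  classical
  have hq0 : 0 < q := by linarith
  have hp0 : 0 < p := by linarith
  have hn1 : 1 ≤ n := by omega
  have hs0 : (0 : ℝ) < s := by exact_mod_cast hs
  have hprob := isProbabilityMeasure_gibbs hn1 hM hq0
  have hNp0 : ∀ i x, 0 ≤ N i x ^ p := fun i x => Real.rpow_nonneg (apply_nonneg _ _) _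
  have hIntN : Integrable (fun z => lpSum p hp N z ^ p) (gibbs M q) := by
    refine ((integrable_rpow_gibbs hn1 hM hq0 hp0.le).const_mul (|K| ^ p)).mono'
      ((lpSum p hp N).measurable_euclidean.pow_const p).aestronglyMeasurable ?_
    filter_upwards with z
    rw [Real.norm_of_nonneg (Real.rpow_nonneg (apply_nonneg _ _) _),
      ← Real.mul_rpow (abs_nonneg _) (apply_nonneg _ _)]
    refine Real.rpow_le_rpow (apply_nonneg _ _) ((hNM z).trans ?_) hp0.le
    exact mul_le_mul_of_nonneg_right (le_abs_self K) (apply_nonneg _ _)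
  have hInt : ∀ i, Integrable (fun z => N i z ^ p) (gibbs M q) := by
    intro i
    refine hIntN.mono' ((N i).measurable_euclidean.pow_const p).aestronglyMeasurable ?_
    filter_upwards with z
    rw [Real.norm_of_nonneg (hNp0 i z)]
    exact rpow_apply_le_lpSum_rpow hp N i z
  set τ : Fin m → ℝ := fun i => ∫ z, N i z ^ p ∂(gibbs M q) with hτ
  have hτ0 : ∀ i, 0 ≤ τ i := fun i => integral_nonneg fun z => hNp0 i z
  have hτsum : ∑ i, τ i ≤ Y ^ p := by
    rw [hτ, ← integral_finsetSum _ fun i _ => hInt i]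
    simpa only [lpSum_rpow] using hY
  -- An index of zero moment is never drawn; this is harmless because its seminorm vanishes
  -- identically, by the pointwise moment bound and homogeneity.
  have hzero : ∀ i, τ i = 0 → ∀ x, N i x = 0 := by
    intro i hi x
    have h1 : ∀ y, M y ≤ 1 → N i y = 0 := by
      intro y hy
      have := rpow_le_integral_gibbs hn1 hM hq0 hS0 hS (N i) hp (hInt i) hl hy
      have hi' : ∫ z, N i z ^ p ∂(gibbs M q) = 0 := hi
      rw [hi', mul_zero] at this
      exact ((Real.rpow_eq_zero (apply_nonneg _ _) hp0.ne').1 (le_antisymm this (hNp0 i y)))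
    have h2 : 0 ≤ M x := apply_nonneg M x
    have h3 := h1 ((1 + M x)⁻¹ • x) (by
      rw [map_smul_eq_mul, Real.norm_of_nonneg (by positivity), inv_mul_le_iff₀ (by positivity)]
      linarith)
    rw [map_smul_eq_mul, Real.norm_of_nonneg (by positivity)] at h3
    exact (mul_eq_zero.1 h3).resolve_left (by positivity)
  set τt := ∑ i, τ i with hτt
  have hτt0 : 0 ≤ τt := Finset.sum_nonneg fun i _ => hτ0 i
  rcases hτt0.eq_or_lt with hτtz | hτtpos
  · have h1 : ∀ i, τ i = 0 := fun i =>
      (Finset.sum_eq_zero_iff_of_nonneg fun i _ => hτ0 i).1 hτtz.symm i (Finset.mem_univ i)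
    refine ⟨fun _ => 0, fun _ => le_rfl, by simp, fun x _ => ?_⟩
    have h2 : lpSum p hp N x ^ p = 0 := by
      rw [lpSum_rpow]
      refine Finset.sum_eq_zero fun i _ => ?_
      rw [hzero i (h1 i) x, Real.zero_rpow hp0.ne']
    simp [h2]
  set ρ : Fin m → ℝ := fun i => τ i / τt with hρ
  have hρ0 : ∀ i, 0 ≤ ρ i := fun i => div_nonneg (hτ0 i) hτt0
  have hρ1 : ∑ i, ρ i = 1 := by
    rw [hρ, ← Finset.sum_div, ← hτt, div_self hτtpos.ne']
  -- The normalization equalizes the p-th moments: each equals τt ≤ Y^p. If ρ i = 0, the conventions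
  -- for powers of 0 make v i = 0.
  let v : Fin m → Seminorm ℝ (EuclideanSpace ℝ (Fin n)) := fun i =>
    (ρ i ^ (-(1 / p))).toNNReal • N i
  have hv : ∀ i x, v i x = ρ i ^ (-(1 / p)) * N i x := fun i x => by
    simp only [v, smul_apply, NNReal.smul_def, smul_eq_mul,
      Real.coe_toNNReal _ (Real.rpow_nonneg (hρ0 i) _)]
  have hvp : ∀ i x, v i x ^ p = (ρ i)⁻¹ * N i x ^ p := by
    intro i x
    rw [hv, Real.mul_rpow (Real.rpow_nonneg (hρ0 i) _) (apply_nonneg _ _),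
      ← Real.rpow_mul (hρ0 i), show -(1 / p) * p = -1 by field_simp, Real.rpow_neg_one]
  have hvInt : ∀ i, Integrable (fun z => v i z ^ p) (gibbs M q) := fun i => by
    simp_rw [hvp]
    exact (hInt i).const_mul _
  have hvmom : ∀ i, ∫ z, v i z ^ p ∂(gibbs M q) ≤ Y ^ p := by
    intro i
    simp_rw [hvp]
    rw [integral_const_mul]
    change (ρ i)⁻¹ * τ i ≤ Y ^ p
    rcases (hτ0 i).eq_or_lt with h | h
    · rw [← h, mul_zero]
      positivity
    · have : (ρ i)⁻¹ * τ i = τt := by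
        simp only [hρ]
        field_simp
      rw [this]
      exact hτsum
  have hv1 : ∀ i, Integrable (v i) (gibbs M q) := fun i =>
    integrable_of_integrable_rpow (v i).measurable_euclidean (fun z => apply_nonneg (v i) z) hp
      (hvInt i)
  have hvmean : ∀ i, ∫ z, v i z ∂(gibbs M q) ≤ Y := by
    intro i
    have h1 := (integral_rpow_le_integral_rpow (fun z => apply_nonneg (v i) z) (hv1 i) hp
      (hvInt i)).trans (hvmom i)
    exact (Real.rpow_le_rpow_iff (integral_nonneg fun z => apply_nonneg (v i) z) hY0.le hp0).1 h1
  have hvA : ∀ i x, M x ≤ 1 → v i x ≤ A := by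
    intro i x hx
    have h1 := rpow_le_integral_gibbs hn1 hM hq0 hS0 hS (v i) hp (hvInt i) hl hx
    have h2 : v i x ^ p ≤ A ^ p := by
      refine h1.trans ?_
      rw [hAdef, Real.mul_rpow (by positivity) hY0.le,
        Real.mul_rpow (x := (2 * Real.exp (l ^ q)) ^ (1 / p)) (by positivity) (by positivity),
        ← Real.rpow_mul (by positivity), one_div, inv_mul_cancel₀ hp0.ne',
        Real.rpow_one]
      exact mul_le_mul_of_nonneg_left (hvmom i) (by positivity)
    exact (Real.rpow_le_rpow_iff (apply_nonneg _ _) (by rw [hAdef]; positivity) hp0).1 h2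
  have hA0 : 0 ≤ A := by rw [hAdef]; positivity
  have hlog : 0 ≤ Real.log (2 * s) := by
    refine Real.log_nonneg ?_
    have : (1 : ℝ) ≤ s := by exact_mod_cast hs
    linarith
  have hR0 : 0 ≤ R := by rw [hRdef]; positivity
  have hmeanN : ∀ x, ∑ i, ρ i * v i x ^ p = lpSum p hp N x ^ p := by
    intro x
    rw [lpSum_rpow]
    refine Finset.sum_congr rfl fun i _ => ?_
    rw [hvp]
    rcases (hτ0 i).eq_or_lt with h | h
    · rw [hzero i h.symm x, Real.zero_rpow hp0.ne']
      simp
    · have : ρ i ≠ 0 := (div_pos h hτtpos).ne'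
      field_simp
  -- M ≤ 1 is needed for the entropy and for v ≤ A. N ≤ 1 makes the mean at most 1, so that
  -- deviation D from it gives Q = 1 + D.
  set T : Set (EuclideanSpace ℝ (Fin n)) := {x | M x ≤ 1 ∧ lpSum p hp N x ≤ 1} with hT
  have h0T : (0 : EuclideanSpace ℝ (Fin n)) ∈ T := by
    simp [hT]
  set c := Real.sqrt (4 * p ^ 2 * A ^ (p - q) / s * (2 * R * S) ^ q) with hc
  obtain ⟨I, hI⟩ := exists_sample hρ0 hρ1 hs T 0 h0T (fun i x => v i x ^ p) (B := A ^ p)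
    (fun i x hx => by
      rw [abs_of_nonneg (Real.rpow_nonneg (apply_nonneg _ _) _)]
      exact Real.rpow_le_rpow (apply_nonneg _ _) (hvA i x hx.1) hp0.le)
    (θ := 42 * Real.log n * c) hε0 hε1 (by linarith) (by
      intro I D hD0 hD
      have hQ : ∀ x ∈ T, ∑ j, v (I j) x ^ p ≤ s * (1 + D) := by
        intro x hx
        have h1 := (abs_le.1 (hD x hx)).2
        rw [hmeanN, ← Finset.sum_div] at h1
        have h2 : lpSum p hp N x ^ p ≤ 1 := Real.rpow_le_one (apply_nonneg _ _) hx.2 hp0.le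
        have h3 : (∑ j, v (I j) x ^ p) / s ≤ 1 + D := by linarith
        rwa [div_le_iff₀ hs0, mul_comm] at h3
      have hhalf := half_le_gibbs_sup_le hn1 hM hq1 hs (fun j => v (I j)) (fun j => hv1 (I j))
        (fun j => hvmean (I j))
      rw [← hRdef] at hhalf
      obtain ⟨b, hb, hbavg⟩ := exists_radSum_seminorm_bound hn hM hq1 hq2 hp hqp hS0 hS hs
        (fun j => v (I j)) hR0 hhalf T (fun x hx => hx.1) h0T
        (fun x hx j => hvA (I j) x hx.1) hAR hQ
      refine ⟨b, hb, hbavg.trans ?_⟩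
      -- The chaining bound carries √(1 + D) ≤ 1 + D, the linear dependence required by
      -- `exists_sample`.
      have e : 4 * p ^ 2 * A ^ (p - q) * (1 + D) / s * (2 * R * S) ^ q
          = (4 * p ^ 2 * A ^ (p - q) / s * (2 * R * S) ^ q) * (1 + D) := by ring
      have hcn : 0 ≤ 4 * p ^ 2 * A ^ (p - q) / s * (2 * R * S) ^ q := by positivity
      have hlogn : 0 ≤ Real.log n := Real.log_natCast_nonneg n
      rw [e, Real.sqrt_mul hcn, ← hc, mul_assoc _ c]
      gcongr
      refine Real.sqrt_le_iff.2 ⟨by linarith, ?_⟩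
      nlinarith)
  -- The weight of i is the number of times it was drawn, divided by s ρ i.
  refine ⟨fun i => ((Finset.univ.filter fun j => I j = i).card : ℝ) / s * (ρ i)⁻¹,
    fun i => mul_nonneg (by positivity) (inv_nonneg.2 (hρ0 i)), ?_, ?_⟩
  · calc (Finset.univ.filter fun i => ((Finset.univ.filter fun j => I j = i).card : ℝ) / s *
          (ρ i)⁻¹ ≠ 0).card ≤ (Finset.univ.image I).card := by
          refine Finset.card_le_card fun i hi => ?_
          simp only [Finset.mem_filter, Finset.mem_univ, true_and] at hi
          by_contra hno
          apply hi
          have : (Finset.univ.filter fun j => I j = i) = ∅ := by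
            ext j
            simp only [Finset.mem_filter, Finset.mem_univ, true_and, Finset.notMem_empty,
              iff_false]
            rintro rfl
            exact hno (Finset.mem_image_of_mem I (Finset.mem_univ j))
          rw [this]
          simp
      _ ≤ (Finset.univ : Finset (Fin s)).card := Finset.card_image_le
      _ = s := by simp
  · have hw : ∀ x, ∑ i, ((Finset.univ.filter fun j => I j = i).card : ℝ) / s * (ρ i)⁻¹ *
        N i x ^ p = ∑ j, v (I j) x ^ p / s := by
      intro x
      rw [← Finset.sum_fiberwise Finset.univ I]
      refine Finset.sum_congr rfl fun i _ => ?_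
      have : ∀ j ∈ Finset.univ.filter (fun j => I j = i), v (I j) x ^ p / s
          = (ρ i)⁻¹ * N i x ^ p / s := by
        intro j hj
        rw [(Finset.mem_filter.1 hj).2, hvp]
      rw [Finset.sum_congr rfl this, Finset.sum_const, nsmul_eq_mul]
      ring
    intro x hx
    rw [hw]
    have hnn : 0 ≤ lpSum p hp N x := apply_nonneg _ _
    rcases hnn.eq_or_lt with h | h
    · have hi : ∀ i, N i x ^ p = 0 := fun i => by
        refine le_antisymm ?_ (hNp0 i x)
        refine (rpow_apply_le_lpSum_rpow hp N i x).trans ?_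
        rw [← h, Real.zero_rpow hp0.ne']
      rw [← hw]
      simp [hi, ← h, Real.zero_rpow hp0.ne']
    · set t := lpSum p hp N x with ht
      -- Normalizing by N x places x in T precisely because M x ≤ N x.
      have hyT : t⁻¹ • x ∈ T := by
        refine ⟨?_, ?_⟩ <;>
          rw [map_smul_eq_mul, Real.norm_of_nonneg (by positivity), inv_mul_le_iff₀ h, mul_one]
        · exact hx
      have h1 := hI _ hyT
      rw [hmeanN, map_smul_eq_mul, Real.norm_of_nonneg (by positivity), ← ht,
        inv_mul_cancel₀ h.ne', Real.one_rpow] at h1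
      have h2 : ∀ j, v (I j) (t⁻¹ • x) ^ p = (t ^ p)⁻¹ * v (I j) x ^ p := fun j => by
        rw [map_smul_eq_mul, Real.norm_of_nonneg (by positivity),
          Real.mul_rpow (by positivity) (apply_nonneg _ _), Real.inv_rpow h.le]
      simp_rw [h2, mul_div_assoc] at h1
      rw [← Finset.mul_sum] at h1
      have htp : 0 < t ^ p := Real.rpow_pos_of_pos h p
      have h3 : t ^ p - ∑ j, v (I j) x ^ p / s
          = -(t ^ p * ((t ^ p)⁻¹ * (∑ j, v (I j) x ^ p / s) - 1)) := by
        field_simp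
        ring
      rw [h3, abs_neg, abs_mul, abs_of_pos htp, mul_comm]
      exact mul_le_mul_of_nonneg_right h1 htp.le

end Sparsify

/-! ### Extending a uniformly smooth seminorm to a norm -/

section Extension

variable {n m : ℕ} {p q : ℝ}

/-- Concavity of t ↦ t^(q/2) is applied to the parallelogram law, then its subadditivity splits the
sum of squares. -/
theorem norm_rpow_smooth {E : Type*} [NormedAddCommGroup E] [InnerProductSpace ℝ E]
    (hq0 : 0 < q) (hq2 : q ≤ 2) (a b : E) :
    (‖a + b‖ ^ q + ‖a - b‖ ^ q) / 2 ≤ ‖a‖ ^ q + ‖b‖ ^ q := by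
  have e : ∀ x : E, ‖x‖ ^ q = (‖x‖ ^ 2) ^ (q / 2) := fun x => by
    rw [← Real.rpow_natCast, ← Real.rpow_mul (norm_nonneg _)]
    congr 1
    push_cast
    ring
  have h1 := (Real.concaveOn_rpow (by linarith : 0 ≤ q / 2) (by linarith : q / 2 ≤ 1)).2
    (Set.mem_Ici.2 (sq_nonneg ‖a + b‖)) (Set.mem_Ici.2 (sq_nonneg ‖a - b‖))
    (by norm_num : (0 : ℝ) ≤ 1 / 2) (by norm_num : (0 : ℝ) ≤ 1 / 2) (by norm_num)
  simp only [smul_eq_mul] at h1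
  have h2 : 1 / 2 * ‖a + b‖ ^ 2 + 1 / 2 * ‖a - b‖ ^ 2 = ‖a‖ ^ 2 + ‖b‖ ^ 2 := by
    have := parallelogram_law_with_norm ℝ a b
    linarith
  rw [h2] at h1
  have h3 := Real.rpow_add_le_add_rpow (sq_nonneg ‖a‖) (sq_nonneg ‖b‖)
    (by linarith : 0 ≤ q / 2) (by linarith : q / 2 ≤ 1)
  rw [e, e, e, e]
  linarith

/-- A uniformly smooth seminorm agrees, modulo its kernel, with a uniformly smooth norm. -/
theorem exists_norm_extension (hq1 : 1 ≤ q) (hq2 : q ≤ 2) {S : ℝ} (hS1 : 1 ≤ S)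
    (N : Seminorm ℝ (EuclideanSpace ℝ (Fin n))) (hN : IsUniformlySmooth q S N) :
    ∃ M : Seminorm ℝ (EuclideanSpace ℝ (Fin n)), (∀ x, M x = 0 → x = 0) ∧
      IsUniformlySmooth q S M ∧ (∀ x, N x ≤ M x) ∧
      ∀ x, ∃ w, N w = 0 ∧ M (x - w) = N (x - w) := by
  have hq0 : 0 < q := by linarith
  let W : Submodule ℝ (EuclideanSpace ℝ (Fin n)) :=
    { carrier := {x | N x = 0}
      add_mem' := fun {x y} hx hy => by
        have hx : N x = 0 := hx
        have hy : N y = 0 := hy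
        have := map_add_le_add N x y
        exact le_antisymm (by linarith) (apply_nonneg _ _)
      zero_mem' := map_zero N
      smul_mem' := fun c x hx => by
        have hx : N x = 0 := hx
        change N (c • x) = 0
        rw [map_smul_eq_mul, hx, mul_zero] }
  have hW : ∀ x, x ∈ W ↔ N x = 0 := fun x => Iff.rfl
  -- P is the orthogonal projection onto the kernel W of N. The norm is M^q = N^q + ‖P ·‖^q; the
  -- Hilbertian term is q-smooth with constant 1 ≤ S, so the sum is smooth with constant S.
  let P : EuclideanSpace ℝ (Fin n) →L[ℝ] EuclideanSpace ℝ (Fin n) := W.starProjection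
  have hPW : ∀ x, P x ∈ W := fun x => Submodule.starProjection_apply_mem W x
  have hPid : ∀ x ∈ W, P x = x := fun x hx => Submodule.starProjection_eq_self_iff.2 hx
  let e : Seminorm ℝ (EuclideanSpace ℝ (Fin n)) :=
    (normSeminorm ℝ (EuclideanSpace ℝ (Fin n))).comp P.toLinearMap
  have he : ∀ x, e x = ‖P x‖ := fun x => rfl
  let M := lpSum q hq1 ![N, e]
  have hMq : ∀ x, M x ^ q = N x ^ q + e x ^ q := fun x => by
    simp only [M]
    rw [lpSum_rpow]
    simp [Fin.sum_univ_two]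
  have hNM : ∀ x, N x ≤ M x := fun x => by
    refine (Real.rpow_le_rpow_iff (apply_nonneg _ _) (apply_nonneg _ _) hq0).1 ?_
    rw [hMq]
    have : 0 ≤ e x ^ q := Real.rpow_nonneg (apply_nonneg _ _) _
    linarith
  have heM : ∀ x, e x ≤ M x := fun x => by
    refine (Real.rpow_le_rpow_iff (apply_nonneg _ _) (apply_nonneg _ _) hq0).1 ?_
    rw [hMq]
    have : 0 ≤ N x ^ q := Real.rpow_nonneg (apply_nonneg _ _) _
    linarith
  refine ⟨M, fun x hx => ?_, fun x y => ?_, hNM, fun x => ?_⟩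
  · have h1 : N x = 0 := le_antisymm (hx ▸ hNM x) (apply_nonneg _ _)
    have h2 : e x ≤ 0 := hx ▸ heM x
    rw [he, hPid x ((hW x).2 h1)] at h2
    exact norm_le_zero_iff.1 h2
  · rw [hMq, hMq, hMq, hMq]
    have h1 := hN x y
    have h2 := norm_rpow_smooth hq0 hq2 (P x) (P y)
    rw [← map_add, ← map_sub, ← he, ← he, ← he, ← he] at h2
    have h3 : e y ^ q ≤ e (S • y) ^ q := by
      refine Real.rpow_le_rpow (apply_nonneg _ _) ?_ hq0.le
      rw [map_smul_eq_mul, Real.norm_of_nonneg (by linarith)]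
      exact le_mul_of_one_le_left (apply_nonneg _ _) hS1
    linarith
  · refine ⟨P x, (hW _).1 (hPW x), ?_⟩
    have h1 : e (x - P x) = 0 := by
      rw [he, map_sub, hPid (P x) (hPW x), sub_self, norm_zero]
    have h2 := hMq (x - P x)
    rw [h1, Real.zero_rpow hq0.ne', add_zero] at h2
    exact (Real.rpow_left_inj (apply_nonneg _ _) (apply_nonneg _ _) hq0.ne').1 h2

theorem IsUniformlySmooth.smul {S : ℝ} {N : Seminorm ℝ (EuclideanSpace ℝ (Fin n))}
    (hN : IsUniformlySmooth q S N) (c : ℝ≥0) : IsUniformlySmooth q S (c • N) := by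
  intro x y
  have e : ∀ z, (c • N) z ^ q = (c : ℝ) ^ q * N z ^ q := fun z => by
    rw [smul_apply, NNReal.smul_def, smul_eq_mul,
      Real.mul_rpow c.coe_nonneg (apply_nonneg _ _)]
  rw [e, e, e, e]
  have := mul_le_mul_of_nonneg_left (hN x y) (Real.rpow_nonneg c.coe_nonneg q)
  linarith

theorem isUniformlySmooth_one (N : Seminorm ℝ (EuclideanSpace ℝ (Fin n))) :
    IsUniformlySmooth 1 1 N := by
  intro x y
  simp only [Real.rpow_one, one_smul]
  have h1 := map_add_le_add N x y
  have h2 := map_sub_le_add N x y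
  linarith

/-- Passes from seminorms to norms and makes the sampling condition explicit. With Y = K ((n +
p)/q)^(1/q), dividing A and 2RS by SY leaves α and 24 log(2s), and the powers of SY recombine to S^p
Y^p. -/
theorem exists_sparse_of_equivalent (hn : 2 ≤ n) (hp : 1 ≤ p) (hq1 : 1 ≤ q) (hq2 : q ≤ 2)
    (hqp : q ≤ p) (N : Fin m → Seminorm ℝ (EuclideanSpace ℝ (Fin n)))
    (N' : Seminorm ℝ (EuclideanSpace ℝ (Fin n))) {S : ℝ} (hS1 : 1 ≤ S)
    (hS : IsUniformlySmooth q S N') {K : ℝ} (hK : 1 ≤ K) (hN' : ∀ x, N' x ≤ lpSum p hp N x)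
    (hNK : ∀ x, lpSum p hp N x ≤ K * N' x) {l : ℝ} (hl : 0 < l) {s : ℕ} (hs : 1 ≤ s) {ε : ℝ}
    (hε0 : 0 < ε) (hε1 : ε < 1) {α : ℝ}
    (hα : α = (2 * Real.exp (l ^ q)) ^ (1 / p) * (4 / l)) (hαs : α ≤ 24 * Real.log (2 * s))
    (hs_large : 112896 * p ^ 2 * Real.log n ^ 2 * (S ^ p * (K ^ p * ((n + p) / q) ^ (p / q))) *
      α ^ (p - q) * (24 * Real.log (2 * s)) ^ q ≤ ε ^ 2 * s) :
    ∃ w : Fin m → ℝ, (∀ i, 0 ≤ w i) ∧ (Finset.univ.filter fun i => w i ≠ 0).card ≤ s ∧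
      ∀ x, |lpSum p hp N x ^ p - ∑ i, w i * N i x ^ p| ≤ ε * lpSum p hp N x ^ p := by
  have hq0 : 0 < q := by linarith
  have hp0 : 0 < p := by linarith
  have hS0 : 0 < S := by linarith
  have hK0 : 0 < K := by linarith
  have hs0 : (0 : ℝ) < s := by exact_mod_cast hs
  have hn0 : (0 : ℝ) < n := by exact_mod_cast (by omega : 0 < n)
  obtain ⟨M, hM, hMS, hNM, hker⟩ := exists_norm_extension hq1 hq2 hS1 N' hS
  set Y := K * ((n + p) / q) ^ (1 / q) with hYdef
  have hY0 : 0 < Y := by positivity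
  have hYp : Y ^ p = K ^ p * ((n + p) / q) ^ (p / q) := by
    rw [hYdef, Real.mul_rpow hK0.le (by positivity), ← Real.rpow_mul (by positivity)]
    congr 2
    ring
  have hNKM : ∀ x, lpSum p hp N x ≤ K * M x := fun x =>
    (hNK x).trans (mul_le_mul_of_nonneg_left (hNM x) hK0.le)
  have hn1 : 1 ≤ n := by omega
  have hprob := isProbabilityMeasure_gibbs hn1 hM hq0
  have hY : ∫ z, lpSum p hp N z ^ p ∂(gibbs M q) ≤ Y ^ p := by
    have hI := integrable_rpow_gibbs hn1 hM hq0 hp0.le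
    calc ∫ z, lpSum p hp N z ^ p ∂(gibbs M q) ≤ ∫ z, K ^ p * M z ^ p ∂(gibbs M q) := by
          refine integral_mono_of_nonneg (Filter.Eventually.of_forall fun z =>
            Real.rpow_nonneg (apply_nonneg _ _) _) (hI.const_mul _)
            (Filter.Eventually.of_forall fun z => ?_)
          simp only
          rw [← Real.mul_rpow hK0.le (apply_nonneg _ _)]
          exact Real.rpow_le_rpow (apply_nonneg _ _) (hNKM z) hp0.le
      _ ≤ Y ^ p := by
          rw [integral_const_mul, hYp]
          gcongr
          exact integral_rpow_gibbs_le hn1 hM hq0 hp0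
  have hα0 : 0 < α := by rw [hα]; positivity
  have hlog : 0 < Real.log (2 * s) := by
    refine Real.log_pos ?_
    have : (1 : ℝ) ≤ s := by exact_mod_cast hs
    linarith
  obtain ⟨w, hw0, hws, hw⟩ := exists_sparse_weights hn hp hq1 hq2 hqp N hM hS0 hMS hNKM hY0 hY hl
    hs hε0 hε1 rfl rfl (by
      rw [show (2 * Real.exp (l ^ q)) ^ (1 / p) * (4 / l * S) * Y = α * (S * Y) by rw [hα]; ring,
        show 2 * (12 * Real.log (2 * s) * Y) * S = 24 * Real.log (2 * s) * (S * Y) by ring]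
      gcongr) (by
      rw [show (2 * Real.exp (l ^ q)) ^ (1 / p) * (4 / l * S) * Y = α * (S * Y) by rw [hα]; ring,
        show 2 * (12 * Real.log (2 * s) * Y) * S = 24 * Real.log (2 * s) * (S * Y) by ring,
        Real.mul_rpow hα0.le (by positivity),
        Real.mul_rpow (x := 24 * Real.log (2 * s)) (by positivity) (by positivity)]
      have e1 : (S * Y) ^ (p - q) * (S * Y) ^ q = S ^ p * Y ^ p := by
        rw [← Real.rpow_add (by positivity), sub_add_cancel, Real.mul_rpow hS0.le hY0.le]
      set B := 112896 * p ^ 2 * Real.log n ^ 2 * (S ^ p * Y ^ p) * α ^ (p - q) *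
        (24 * Real.log (2 * s)) ^ q with hB
      rw [← hYp] at hs_large
      have hlogn : 0 ≤ Real.log n := Real.log_natCast_nonneg n
      -- Squaring the requirement produces the constant 112896 = 4 · 4 · 84².
      have e2 : (84 * Real.log n * Real.sqrt (4 * p ^ 2 * (α ^ (p - q) * (S * Y) ^ (p - q)) / s *
          ((24 * Real.log (2 * s)) ^ q * (S * Y) ^ q))) ^ 2 = B / (4 * s) := by
        rw [mul_pow, Real.sq_sqrt (by positivity), hB, ← e1]
        ring
      refine le_of_sq_le_sq ?_ (by positivity)
      rw [e2, div_le_iff₀ (by positivity)]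
      calc B ≤ ε ^ 2 * s := hs_large
        _ = _ := by ring)
  refine ⟨w, hw0, hws, fun x => ?_⟩
  -- Subtracting y, which lies in the kernel of N' and hence of every N_i, changes none of the
  -- quantities compared and achieves M ≤ N.
  obtain ⟨y, hy0, hy⟩ := hker x
  have hLy : lpSum p hp N y = 0 := by
    refine le_antisymm ((hNK y).trans ?_) (apply_nonneg _ _)
    rw [hy0, mul_zero]
  have hNy : ∀ i, N i y = 0 := by
    intro i
    have h1 := rpow_apply_le_lpSum_rpow hp N i y
    rw [hLy, Real.zero_rpow hp0.ne'] at h1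
    exact (Real.rpow_eq_zero (apply_nonneg _ _) hp0.ne').1
      (le_antisymm h1 (Real.rpow_nonneg (apply_nonneg _ _) _))
  have hsub : ∀ V : Seminorm ℝ (EuclideanSpace ℝ (Fin n)), V y = 0 → V (x - y) = V x := by
    intro V hV
    refine le_antisymm ?_ ?_
    · have := map_sub_le_add V x y
      linarith
    · have := map_add_le_add V (x - y) y
      rw [sub_add_cancel] at this
      linarith
  have h1 := hw (x - y) (by rw [hy]; exact hN' _)
  simpa only [hsub _ hLy, hsub _ (hNy _)] using h1

end Extension

/-! ### The KLS constant is at least one -/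

section KLS

variable {n : ℕ}

/-- The norm whose Gibbs measure with exponent `2` is the standard Gaussian. -/
noncomputable def gaussNorm (n : ℕ) : Seminorm ℝ (EuclideanSpace ℝ (Fin n)) :=
  (Real.sqrt (1 / 2)).toNNReal • normSeminorm ℝ (EuclideanSpace ℝ (Fin n))

theorem gaussNorm_sq (x : EuclideanSpace ℝ (Fin n)) :
    gaussNorm n x ^ (2 : ℝ) = 1 / 2 * ‖x‖ ^ 2 := by
  rw [gaussNorm, smul_apply, NNReal.smul_def, smul_eq_mul,
    Real.coe_toNNReal _ (Real.sqrt_nonneg _), Real.rpow_two, mul_pow,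
    Real.sq_sqrt (by norm_num)]
  rfl

theorem gaussNorm_definite (x : EuclideanSpace ℝ (Fin n)) (hx : gaussNorm n x = 0) : x = 0 := by
  have h := gaussNorm_sq x
  rw [hx, Real.zero_rpow two_ne_zero] at h
  have : ‖x‖ ^ 2 = 0 := by linarith
  simpa using this

/-- Here M² = ‖x‖²/2. The Gaussian Fourier integral at frequency 0 identifies the mass, and at
frequency t the characteristic function. -/
theorem gibbs_gaussNorm (hn : 1 ≤ n) :
    gibbs (gaussNorm n) 2 = stdGaussian (EuclideanSpace ℝ (Fin n)) := by
  have := isProbabilityMeasure_gibbs hn (M := gaussNorm n) gaussNorm_definite two_pos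
  refine Measure.ext_of_charFun (E := EuclideanSpace ℝ (Fin n)) ?_
  ext t
  rw [charFun_stdGaussian, charFun_apply, gibbs, integral_withDensity_eq_integral_toReal_smul
    (by have := measurable_gibbsDensity (M := gaussNorm n) (q := 2); fun_prop) (by simp)]
  have hZ := gibbsMass_pos hn (M := gaussNorm n) gaussNorm_definite two_pos
  set Z := gibbsMass (gaussNorm n) 2 with hZdef
  have key := fun w : EuclideanSpace ℝ (Fin n) =>
    GaussianFourier.integral_cexp_neg_mul_sq_norm_add (V := EuclideanSpace ℝ (Fin n))
      (b := 1 / 2) (by norm_num) Complex.I w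
  have hZc : (Z : ℂ) = (Real.pi / (1 / 2 : ℂ)) ^
      (Module.finrank ℝ (EuclideanSpace ℝ (Fin n)) / 2 : ℂ) := by
    have h0 := key 0
    simp only [inner_zero_left, Complex.ofReal_zero, mul_zero, add_zero, norm_zero, ne_eq,
      OfNat.ofNat_ne_zero, not_false_eq_true, zero_pow, zero_div, Complex.exp_zero, mul_one] at h0
    rw [← h0, hZdef, gibbsMass, ← integral_complex_ofReal]
    refine integral_congr_ae (Filter.Eventually.of_forall fun x => ?_)
    simp only [gaussNorm_sq]
    push_cast
    ring_nf
  have e : ∀ x : EuclideanSpace ℝ (Fin n),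
      (ENNReal.ofReal (gibbsDensity (gaussNorm n) 2 x)).toReal •
        Complex.exp ((inner ℝ x t : ℝ) * Complex.I)
      = (Z : ℂ)⁻¹ * Complex.exp (-(1 / 2) * ‖x‖ ^ 2 + Complex.I * (inner ℝ t x : ℝ)) := by
    intro x
    rw [ENNReal.toReal_ofReal (gibbsDensity_nonneg _), gibbsDensity, gaussNorm_sq, ← hZdef,
      Complex.exp_add, real_inner_comm t x, Complex.real_smul]
    push_cast
    rw [mul_comm Complex.I, div_eq_mul_inv, neg_mul]
    ring
  simp_rw [e]
  rw [integral_const_mul, key t, ← hZc, ← mul_assoc,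
    inv_mul_cancel₀ (by exact_mod_cast hZ.ne'), one_mul, Complex.I_sq]
  congr 1
  ring

/-- Under the standard Gaussian a coordinate function has variance 1 and gradient of norm 1, so no
Poincaré constant is below 1. This lets powers of ψ_n be inserted into the bounds at no cost. -/
theorem one_le_klsConst (hn : 1 ≤ n) : 1 ≤ klsConst n := by
  set μ := gibbs (gaussNorm n) 2 with hμ
  have hprob : IsProbabilityMeasure μ :=
    isProbabilityMeasure_gibbs hn gaussNorm_definite two_pos
  have hstd : μ = stdGaussian (EuclideanSpace ℝ (Fin n)) := gibbs_gaussNorm hn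
  have hlc : HasLogConcaveDensity μ :=
    ⟨gibbsDensity (gaussNorm n) 2, measurable_gibbsDensity, gibbsDensity_nonneg,
      fun x y a b ha hb hab => gibbsDensity_logConcave hn gaussNorm_definite (by norm_num) ha hb
        hab x y, rfl⟩
  have hmem : ∀ L : StrongDual ℝ (EuclideanSpace ℝ (Fin n)), MemLp L 2 μ := fun L => by
    rw [hstd]
    exact IsGaussian.memLp_dual _ L 2 (by simp)
  have hmean : ∀ L : StrongDual ℝ (EuclideanSpace ℝ (Fin n)), ∫ x, L x ∂μ = 0 := fun L => by
    rw [hstd]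
    exact integral_strongDual_stdGaussian L
  have hvar : ∀ L : StrongDual ℝ (EuclideanSpace ℝ (Fin n)), variance L μ = ‖L‖ ^ 2 := fun L => by
    rw [hstd]
    exact variance_dual_stdGaussian L
  have hiso : IsIsotropic μ := by
    have e : ∀ θ x : EuclideanSpace ℝ (Fin n), inner ℝ x θ = innerSL ℝ θ x := fun θ x => by
      rw [innerSL_apply_apply, real_inner_comm]
    refine ⟨fun θ => ?_, fun θ => ?_⟩
    · simp_rw [e]
      exact hmean _
    · simp_rw [e]
      have h := hvar (innerSL ℝ θ)
      rw [variance_of_integral_eq_zero (hmem _).aemeasurable (hmean _)] at h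
      rw [h, innerSL_apply_norm]
  have hP : 1 ≤ poincareConst μ := by
    refine le_sInf fun c hc => ?_
    let i : Fin n := ⟨0, hn⟩
    let L : StrongDual ℝ (EuclideanSpace ℝ (Fin n)) := innerSL ℝ (EuclideanSpace.single i 1)
    have hL : ‖L‖ = 1 := by simp [L]
    have h := hc L L.contDiff (hmem L)
    rw [← ofReal_variance (hmem L), hvar L, hL] at h
    have hL' : ‖L‖ₑ = 1 := by rw [← ofReal_norm, hL, ENNReal.ofReal_one]
    simpa [hL'] using h
  calc (1 : ℝ≥0∞) = 1 ^ (1 / 2 : ℝ) := by simp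
    _ ≤ poincareConst μ ^ (1 / 2 : ℝ) := ENNReal.rpow_le_rpow hP (by norm_num)
    _ ≤ klsConst n := by
        unfold klsConst
        exact le_iSup_of_le μ (le_iSup_of_le hprob (le_iSup_of_le hlc (le_iSup_of_le hiso le_rfl)))

end KLS

/-! ### The number of samples -/

section SampleSize

/-- Resolves the circularity between s and log(2s). Here X is the target size and P L will be p²
log(n/ε). Taking s of order κ² X increases log(2s) by only 2 log κ, which κ absorbs once it is large
in terms of c₀ and c₁. -/
theorem exists_sample_size (c₀ c₁ : ℝ) :
    ∃ κ C : ℝ, 1 ≤ κ ∧ 0 < C ∧ ∀ X P L : ℝ, 1 / 10 ≤ X → 1 ≤ P → 1 / 2 ≤ L →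
      Real.log X ≤ c₀ * (P * L) →
      ∃ s : ℕ, 2 ≤ s ∧ (s : ℝ) ≤ C * X ∧ c₁ * κ ^ 2 * X ≤ s ∧ Real.log (2 * s) ≤ κ * (P * L) := by
  -- The value 20 ensures s ≥ 2 when X ≥ 1/10.
  set d := max c₁ 20 with hd
  have hd20 : 20 ≤ d := le_max_right _ _
  set a := 2 * Real.log (4 * d) + c₀ with ha
  set t := 9 + |a| with ht
  have ha0 : 0 ≤ |a| := abs_nonneg a
  have haa : a ≤ |a| := le_abs_self a
  have hκ1 : 1 ≤ t ^ 2 := by nlinarith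
  have hκ : a + 4 * Real.log (t ^ 2) ≤ t ^ 2 := by
    rw [Real.log_pow]
    have := Real.log_le_sub_one_of_pos (by linarith : 0 < t)
    push_cast
    nlinarith
  refine ⟨t ^ 2, 2 * (d * (t ^ 2) ^ 2), hκ1, by positivity, fun X P L hX hP hL hlogX => ?_⟩
  set κ := t ^ 2 with hκdef
  have hX0 : 0 < X := by linarith
  have hκ2 : 1 ≤ κ ^ 2 := one_le_pow₀ hκ1
  have hPL : 1 / 2 ≤ P * L := by nlinarith
  have hbig : 2 ≤ d * κ ^ 2 * X := by
    calc (2 : ℝ) = 20 * 1 * (1 / 10) := by norm_num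
      _ ≤ d * κ ^ 2 * X := by gcongr
  refine ⟨⌈d * κ ^ 2 * X⌉₊, ?_, ?_, ?_, ?_⟩
  · exact_mod_cast hbig.trans (Nat.le_ceil _)
  · have := (Nat.ceil_lt_add_one (by linarith : 0 ≤ d * κ ^ 2 * X)).le
    linarith
  · refine le_trans ?_ (Nat.le_ceil _)
    gcongr
    exact le_max_left _ _
  · have h1 : (⌈d * κ ^ 2 * X⌉₊ : ℝ) ≤ 2 * (d * κ ^ 2 * X) := by
      have := (Nat.ceil_lt_add_one (by linarith : 0 ≤ d * κ ^ 2 * X)).le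
      linarith
    have hpos : (0 : ℝ) < ⌈d * κ ^ 2 * X⌉₊ := by
      have := Nat.le_ceil (d * κ ^ 2 * X)
      linarith
    have h2 : Real.log (2 * ⌈d * κ ^ 2 * X⌉₊) ≤ Real.log (4 * d * (κ ^ 2 * X)) :=
      Real.log_le_log (by positivity) (by linarith)
    rw [Real.log_mul (x := 4 * d) (by positivity) (by positivity),
      Real.log_mul (x := κ ^ 2) (by positivity) (by positivity), Real.log_pow] at h2
    push_cast at h2
    have hlκ : 0 ≤ Real.log κ := Real.log_nonneg hκ1
    have hld : 0 ≤ Real.log (4 * d) := Real.log_nonneg (by linarith)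
    have h3 : Real.log (4 * d) + 2 * Real.log κ
        ≤ (2 * Real.log (4 * d) + 4 * Real.log κ) * (P * L) := by nlinarith
    have h4 : (a + 4 * Real.log κ) * (P * L) ≤ κ * (P * L) := by gcongr
    rw [ha] at h4
    linarith

theorem pow_four_le_two_rpow {p : ℝ} (hp : 0 ≤ p) : p ^ 4 ≤ 384 * 2 ^ p := by
  have hl2 : (1 / 2 : ℝ) ≤ Real.log 2 := by linarith [Real.log_two_gt_d9]
  have h1 := Real.pow_div_factorial_le_exp (Real.log 2 * p) (by positivity) 4
  rw [← Real.rpow_def_of_pos two_pos] at h1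
  have h2 : (1 / 2 * p) ^ 4 ≤ (Real.log 2 * p) ^ 4 := by gcongr
  have h3 : ((Nat.factorial 4 : ℕ) : ℝ) = 24 := by norm_num [Nat.factorial]
  rw [h3, div_le_iff₀ (by norm_num)] at h1
  have h4 : (1 / 2 * p) ^ 4 = p ^ 4 / 16 := by ring
  linarith

/-- For p ≥ 1936 = 44² the base is at most 1/2 and exponential decay beats p⁴; smaller p form a
bounded range. This absorbs the factor p⁴ arising from log(2s)² when p ≥ 2. -/
theorem exists_pow_four_mul_rpow_le :
    ∃ B : ℝ, 0 < B ∧ ∀ p : ℝ, 2 ≤ p → p ^ 4 * (22 / Real.sqrt p) ^ (p - 2) ≤ B := by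
  refine ⟨max 1536 (1936 ^ 4 * 22 ^ (1936 : ℝ)), by positivity, fun p hp => ?_⟩
  have hp0 : 0 < p := by linarith
  have hsq : 0 < Real.sqrt p := Real.sqrt_pos.2 hp0
  rcases le_total p 1936 with h | h
  · refine le_trans ?_ (le_max_right _ _)
    have h1 : (1 : ℝ) ≤ Real.sqrt p := Real.one_le_sqrt.2 (by linarith)
    have h2 : 22 / Real.sqrt p ≤ 22 := div_le_self (by norm_num) h1
    gcongr
    calc (22 / Real.sqrt p) ^ (p - 2) ≤ 22 ^ (p - 2) :=
          Real.rpow_le_rpow (by positivity) h2 (by linarith)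
      _ ≤ 22 ^ (1936 : ℝ) := Real.rpow_le_rpow_of_exponent_le (by norm_num) (by linarith)
  · refine le_trans ?_ (le_max_left _ _)
    have h1 : (44 : ℝ) ≤ Real.sqrt p := Real.le_sqrt_of_sq_le (by linarith)
    have h2 : 22 / Real.sqrt p ≤ 1 / 2 := by
      rw [div_le_iff₀ hsq]
      linarith
    have h3 : (22 / Real.sqrt p) ^ (p - 2) ≤ (1 / 2) ^ (p - 2) :=
      Real.rpow_le_rpow (by positivity) h2 (by linarith)
    have h4 : (1 / 2 : ℝ) ^ (p - 2) = 4 * (2 ^ p)⁻¹ := by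
      rw [one_div, Real.inv_rpow (by norm_num), Real.rpow_sub (by norm_num), inv_div,
        div_eq_mul_inv]
      norm_num
    have h5 := pow_four_le_two_rpow hp0.le
    have h6 : (0 : ℝ) < 2 ^ p := by positivity
    calc p ^ 4 * (22 / Real.sqrt p) ^ (p - 2) ≤ (384 * 2 ^ p) * (4 * (2 ^ p)⁻¹) := by
          rw [← h4]
          gcongr
      _ = 1536 := by field_simp; norm_num

/-- The bound is 2e < 11/2. Multiplied by 4/l it gives α ≤ 22/l. -/
theorem two_mul_exp_rpow_le {p t : ℝ} (hp : 1 ≤ p) (ht : t ≤ p) :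
    (2 * Real.exp t) ^ (1 / p) ≤ 11 / 2 := by
  have hp0 : 0 < p := by linarith
  have h1 : (2 * Real.exp t) ^ (1 / p) ≤ (2 * Real.exp p) ^ (1 / p) := by
    gcongr
  have h2 : (2 * Real.exp p) ^ (1 / p) = 2 ^ (1 / p) * Real.exp 1 := by
    rw [Real.mul_rpow (by norm_num) (Real.exp_pos _).le, ← Real.exp_mul, mul_one_div_cancel hp0.ne']
  have h3 : (2 : ℝ) ^ (1 / p) ≤ 2 := by
    calc (2 : ℝ) ^ (1 / p) ≤ 2 ^ (1 : ℝ) :=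
          Real.rpow_le_rpow_of_exponent_le (by norm_num) (by rw [div_le_one hp0]; exact hp)
      _ = 2 := Real.rpow_one 2
  have h4 := Real.exp_one_lt_d9
  have h5 := Real.exp_pos 1
  rw [h2] at h1
  nlinarith

theorem log_two_mul_ge {s : ℕ} (hs : 2 ≤ s) : 1.38 ≤ Real.log (2 * s) := by
  have h2 : (2 : ℝ) ≤ s := by exact_mod_cast hs
  have h1 : Real.log 4 ≤ Real.log (2 * s) := Real.log_le_log (by norm_num) (by linarith)
  have h4 : Real.log 4 = 2 * Real.log 2 := by
    rw [show (4 : ℝ) = 2 ^ 2 by norm_num, Real.log_pow]; norm_num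
  have := Real.log_two_gt_d9
  linarith

theorem log_natCast_add_le {n : ℕ} (hn : 1 ≤ n) {p : ℝ} (hp : 0 ≤ p) :
    Real.log (n + p) ≤ Real.log n + p := by
  have hn0 : (1 : ℝ) ≤ n := by exact_mod_cast hn
  have h1 : (n : ℝ) + p ≤ n * Real.exp p := by
    have := Real.add_one_le_exp p
    nlinarith
  calc Real.log (n + p) ≤ Real.log (n * Real.exp p) := Real.log_le_log (by linarith) h1
    _ = _ := by rw [Real.log_mul (by linarith) (Real.exp_pos _).ne', Real.log_exp]

theorem log_forty_four_le : Real.log 44 ≤ 4 := by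
  rw [Real.log_le_iff_le_exp (by norm_num)]
  have h := Real.exp_one_gt_d9
  calc (44 : ℝ) ≤ 2.7 ^ 4 := by norm_num
    _ ≤ Real.exp 1 ^ 4 := by gcongr; linarith
    _ = Real.exp 4 := by rw [← Real.exp_nat_mul]; norm_num

/-- Elementary relations between `log n`, `log ε` and `log (n / ε)`. -/
theorem log_div_bounds {n : ℕ} (hn : 2 ≤ n) {ε : ℝ} (hε0 : 0 < ε) (hε1 : ε < 1) :
    0.69 ≤ Real.log n ∧ Real.log n ≤ Real.log (n / ε) ∧ -Real.log ε ≤ Real.log (n / ε) ∧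
    0.69 ≤ Real.log (n / ε) ∧ Real.log (Real.log n) ≤ Real.log (n / ε) ∧
    Real.log (Real.log (n / ε)) ≤ Real.log (n / ε) := by
  have hn2 : (2 : ℝ) ≤ n := by exact_mod_cast hn
  have h1 : 0.69 ≤ Real.log n := by
    have := Real.log_le_log (by norm_num) hn2
    have := Real.log_two_gt_d9
    linarith
  have h2 : Real.log (n / ε) = Real.log n - Real.log ε := Real.log_div (by linarith) hε0.ne'
  have h3 : Real.log ε < 0 := Real.log_neg hε0 hε1
  have h4 := Real.log_le_sub_one_of_pos (by linarith : 0 < Real.log n)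
  have h5 := Real.log_le_sub_one_of_pos (by linarith : 0 < Real.log (n / ε))
  refine ⟨h1, ?_, ?_, ?_, ?_, ?_⟩ <;> linarith

end SampleSize

/-! ### Bounds for the target sizes and their logarithms -/

section SampleBounds

theorem IsKEquivalent.exists_normalized {n : ℕ} {K q S : ℝ}
    {N N' : Seminorm ℝ (EuclideanSpace ℝ (Fin n))} (h : IsKEquivalent K N N')
    (hS : IsUniformlySmooth q S N') :
    ∃ M : Seminorm ℝ (EuclideanSpace ℝ (Fin n)), IsUniformlySmooth q S M ∧
      (∀ x, M x ≤ N x) ∧ ∀ x, N x ≤ K * M x := by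
  obtain ⟨c, hc, h⟩ := h
  have e : ∀ x, (c⁻¹.toNNReal • N') x = c⁻¹ * N' x := fun x => by
    rw [smul_apply, NNReal.smul_def, smul_eq_mul, Real.coe_toNNReal _ (by positivity)]
  refine ⟨c⁻¹.toNNReal • N', hS.smul _, fun x => ?_, fun x => ?_⟩
  · rw [e, inv_mul_le_iff₀ hc]
    exact (h x).1
  · rw [e, mul_left_comm, le_inv_mul_iff₀ hc]
    exact (h x).2

/-- The number of seminorms kept when `p ≤ 2`. -/
noncomputable def sizeLow (n : ℕ) (p K S ε : ℝ) : ℝ :=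
  K ^ p / ε ^ 2 * n * (S * Real.log (n / ε)) ^ p * Real.log n ^ 2

/-- The number of seminorms kept when `2 ≤ p`. -/
noncomputable def sizeHigh (n : ℕ) (p K S ε : ℝ) : ℝ :=
  K ^ p * S ^ p * p ^ 2 / ε ^ 2 * ((n + p) / 2) ^ (p / 2) * Real.log (n / ε) ^ 2 * Real.log n ^ 2

/-- The number of seminorms kept without any smoothness. -/
noncomputable def sizeCrude (n : ℕ) (p ε : ℝ) : ℝ :=
  44 ^ p * (n + p) ^ p * Real.log (n / ε) * Real.log n ^ 2 / ε ^ 2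

theorem rpow_ge_of_le_two {L p : ℝ} (hL : 0.69 ≤ L) (hp : 0 ≤ p) (hp2 : p ≤ 2) :
    0.47 ≤ L ^ p := by
  rcases le_total L 1 with h | h
  · calc (0.47 : ℝ) ≤ 0.69 ^ 2 := by norm_num
      _ ≤ L ^ 2 := by gcongr
      _ = L ^ (2 : ℝ) := (Real.rpow_two L).symm
      _ ≤ L ^ p := Real.rpow_le_rpow_of_exponent_ge (by linarith) h hp2
  · have := Real.one_le_rpow h hp
    linarith

theorem sizeLow_ge {n : ℕ} (hn : 2 ≤ n) {p K S ε : ℝ} (hp : 1 ≤ p) (hp2 : p ≤ 2) (hK : 1 < K)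
    (hS : 1 < S) (hε0 : 0 < ε) (hε1 : ε < 1) : 1 / 10 ≤ sizeLow n p K S ε := by
  obtain ⟨h1, h2, h3, h4, -, -⟩ := log_div_bounds hn hε0 hε1
  have hn2 : (2 : ℝ) ≤ n := by exact_mod_cast hn
  have hKp : 1 ≤ K ^ p := Real.one_le_rpow hK.le (by linarith)
  have hSL : 0.47 ≤ (S * Real.log (n / ε)) ^ p :=
    rpow_ge_of_le_two (by nlinarith) (by linarith) hp2
  have hε2 : ε ^ 2 ≤ 1 := pow_le_one₀ hε0.le hε1.le
  have hKe : 1 ≤ K ^ p / ε ^ 2 := by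
    rw [le_div_iff₀ (by positivity)]
    linarith
  calc (1 / 10 : ℝ) ≤ 1 * 2 * 0.47 * 0.69 ^ 2 := by norm_num
    _ ≤ _ := by
      unfold sizeLow
      gcongr

theorem sizeHigh_ge {n : ℕ} (hn : 2 ≤ n) {p K S ε : ℝ} (hp : 2 ≤ p) (hK : 1 < K)
    (hS : 1 < S) (hε0 : 0 < ε) (hε1 : ε < 1) : 1 / 10 ≤ sizeHigh n p K S ε := by
  obtain ⟨h1, h2, h3, h4, -, -⟩ := log_div_bounds hn hε0 hε1
  have hn2 : (2 : ℝ) ≤ n := by exact_mod_cast hn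
  have hKp : 1 ≤ K ^ p := Real.one_le_rpow hK.le (by linarith)
  have hSp : 1 ≤ S ^ p := Real.one_le_rpow hS.le (by linarith)
  have hε2 : ε ^ 2 ≤ 1 := pow_le_one₀ hε0.le hε1.le
  have hKe : 1 ≤ K ^ p * S ^ p * p ^ 2 / ε ^ 2 := by
    rw [le_div_iff₀ (by positivity)]
    have : 1 ≤ K ^ p * S ^ p := one_le_mul_of_one_le_of_one_le hKp hSp
    nlinarith
  have hG : 1 ≤ (((n : ℝ) + p) / 2) ^ (p / 2) := Real.one_le_rpow (by linarith) (by linarith)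
  calc (1 / 10 : ℝ) ≤ 1 * 1 * 0.69 ^ 2 * 0.69 ^ 2 := by norm_num
    _ ≤ _ := by
      unfold sizeHigh
      gcongr

theorem sizeCrude_ge {n : ℕ} (hn : 2 ≤ n) {p ε : ℝ} (hp : 1 ≤ p)
    (hε0 : 0 < ε) (hε1 : ε < 1) : 1 / 10 ≤ sizeCrude n p ε := by
  obtain ⟨h1, h2, h3, h4, -, -⟩ := log_div_bounds hn hε0 hε1
  have hn2 : (2 : ℝ) ≤ n := by exact_mod_cast hn
  have h44 : (1 : ℝ) ≤ 44 ^ p := Real.one_le_rpow (by norm_num) (by linarith)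
  have hnp : 1 ≤ ((n : ℝ) + p) ^ p := Real.one_le_rpow (by linarith) (by linarith)
  have hε2 : ε ^ 2 ≤ 1 := pow_le_one₀ hε0.le hε1.le
  unfold sizeCrude
  rw [le_div_iff₀ (by positivity)]
  calc (1 / 10 : ℝ) * ε ^ 2 ≤ 1 * 1 * 0.69 * 0.69 ^ 2 := by linarith
    _ ≤ _ := by gcongr

/-- Only when K S is at most polynomial in n + p is log s controlled by n, p and ε alone; this is
why large K S is treated separately. -/
theorem log_mul_le_of_le {n : ℕ} (hn : 2 ≤ n) {p K S ε : ℝ} (hp : 1 ≤ p) (hK : 1 < K)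
    (hS : 1 < S) (hε0 : 0 < ε) (hε1 : ε < 1) (hKS : K * S ≤ 44 * (n + p)) :
    Real.log K + Real.log S ≤ 9 * (p * Real.log (n / ε)) := by
  obtain ⟨h1, h2, h3, h4, -, -⟩ := log_div_bounds hn hε0 hε1
  have hn2 : (2 : ℝ) ≤ n := by exact_mod_cast hn
  rw [← Real.log_mul (by linarith) (by linarith)]
  have h5 := Real.log_le_log (by nlinarith) hKS
  rw [Real.log_mul (x := 44) (by norm_num) (by linarith)] at h5
  have h6 := log_forty_four_le
  have h7 := log_natCast_add_le (by omega : 1 ≤ n) (by linarith : 0 ≤ p)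
  have h8 : Real.log (n / ε) ≤ p * Real.log (n / ε) := le_mul_of_one_le_left (by linarith) hp
  have h9 : p * 0.69 ≤ p * Real.log (n / ε) := by gcongr
  linarith

theorem log_sizeLow_le {n : ℕ} (hn : 2 ≤ n) {p K S ε : ℝ} (hp : 1 ≤ p) (hK : 1 < K)
    (hS : 1 < S) (hε0 : 0 < ε) (hε1 : ε < 1) (hKS : K * S ≤ 44 * (n + p)) :
    Real.log (sizeLow n p K S ε) ≤ 40 * (p ^ 2 * Real.log (n / ε)) := by
  obtain ⟨h1, h2, h3, h4, h5, h6⟩ := log_div_bounds hn hε0 hε1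
  have hn2 : (2 : ℝ) ≤ n := by exact_mod_cast hn
  have h7 := log_mul_le_of_le hn hp hK hS hε0 hε1 hKS
  set L := Real.log (n / ε)
  have hL0 : 0 < L := by linarith
  have hSL : 0 < S * L := by positivity
  have e : Real.log (sizeLow n p K S ε) = p * Real.log K - 2 * Real.log ε + Real.log n +
      p * (Real.log S + Real.log L) + 2 * Real.log (Real.log n) := by
    unfold sizeLow
    rw [Real.log_mul (by positivity) (by positivity), Real.log_mul (by positivity) (by positivity),
      Real.log_mul (by positivity) (by positivity), Real.log_div (by positivity) (by positivity),
      Real.log_rpow (by linarith), Real.log_rpow hSL, Real.log_mul (by linarith) (by linarith),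
      Real.log_pow, Real.log_pow]
    push_cast
    ring
  rw [e]
  have h8 : p * (Real.log K + Real.log S) ≤ p * (9 * (p * L)) := by gcongr
  have h9 : p * Real.log L ≤ p * L := by gcongr
  have h10 : p * L ≤ p ^ 2 * L := mul_le_mul_of_nonneg_right (by nlinarith) hL0.le
  have h11 : L ≤ p ^ 2 * L := le_mul_of_one_le_left hL0.le (by nlinarith)
  nlinarith

theorem log_sizeHigh_le {n : ℕ} (hn : 2 ≤ n) {p K S ε : ℝ} (hp : 2 ≤ p) (hK : 1 < K)
    (hS : 1 < S) (hε0 : 0 < ε) (hε1 : ε < 1) (hKS : K * S ≤ 44 * (n + p)) :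
    Real.log (sizeHigh n p K S ε) ≤ 40 * (p ^ 2 * Real.log (n / ε)) := by
  obtain ⟨h1, h2, h3, h4, h5, h6⟩ := log_div_bounds hn hε0 hε1
  have hn2 : (2 : ℝ) ≤ n := by exact_mod_cast hn
  have h7 := log_mul_le_of_le hn (by linarith) hK hS hε0 hε1 hKS
  set L := Real.log (n / ε)
  have hL0 : 0 < L := by linarith
  have e : Real.log (sizeHigh n p K S ε) = p * Real.log K + p * Real.log S + 2 * Real.log p
      - 2 * Real.log ε + p / 2 * Real.log ((n + p) / 2) + 2 * Real.log L
      + 2 * Real.log (Real.log n) := by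
    unfold sizeHigh
    rw [Real.log_mul (by positivity) (by positivity), Real.log_mul (by positivity) (by positivity),
      Real.log_mul (by positivity) (by positivity), Real.log_div (by positivity) (by positivity),
      Real.log_mul (by positivity) (by positivity), Real.log_mul (by positivity) (by positivity),
      Real.log_rpow (by linarith), Real.log_rpow (by linarith), Real.log_rpow (by linarith),
      Real.log_pow, Real.log_pow, Real.log_pow, Real.log_pow]
    push_cast
    ring
  rw [e]
  have h8 : p * (Real.log K + Real.log S) ≤ p * (9 * (p * L)) := by gcongr
  have h9 : Real.log p ≤ p := (Real.log_le_sub_one_of_pos (by linarith)).trans (by linarith)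
  have h10 : Real.log ((n + p) / 2) ≤ Real.log n + p :=
    (Real.log_le_log (by linarith) (by linarith)).trans
      (log_natCast_add_le (by omega : 1 ≤ n) (by linarith : 0 ≤ p))
  have h12 : p / 2 * Real.log ((n + p) / 2) ≤ p / 2 * (L + p) := by
    gcongr
    linarith
  have h13 : p * L ≤ p ^ 2 * L := mul_le_mul_of_nonneg_right (by nlinarith) hL0.le
  have h14 : L ≤ p ^ 2 * L := le_mul_of_one_le_left hL0.le (by nlinarith)
  have h15 : p ≤ 2 * (p * L) := by nlinarith
  have h16 : p ^ 2 ≤ 2 * (p ^ 2 * L) := by nlinarith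
  nlinarith

theorem log_sizeCrude_le {n : ℕ} (hn : 2 ≤ n) {p ε : ℝ} (hp : 1 ≤ p) (hε0 : 0 < ε)
    (hε1 : ε < 1) : Real.log (sizeCrude n p ε) ≤ 40 * (p ^ 2 * Real.log (n / ε)) := by
  obtain ⟨h1, h2, h3, h4, h5, h6⟩ := log_div_bounds hn hε0 hε1
  have hn2 : (2 : ℝ) ≤ n := by exact_mod_cast hn
  set L := Real.log (n / ε)
  have hL0 : 0 < L := by linarith
  have e : Real.log (sizeCrude n p ε) = p * Real.log 44 + p * Real.log (n + p) + Real.log L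
      + 2 * Real.log (Real.log n) - 2 * Real.log ε := by
    unfold sizeCrude
    rw [Real.log_div (by positivity) (by positivity), Real.log_mul (by positivity) (by positivity),
      Real.log_mul (by positivity) (by positivity), Real.log_mul (by positivity) (by positivity),
      Real.log_rpow (by linarith), Real.log_rpow (by linarith), Real.log_pow, Real.log_pow]
    push_cast
    ring
  rw [e]
  have h8 : p * Real.log 44 ≤ p * 4 := by
    gcongr
    exact log_forty_four_le
  have h9 : p * Real.log (n + p) ≤ p * (L + p) := by
    gcongr
    have := log_natCast_add_le (by omega : 1 ≤ n) (by linarith : 0 ≤ p)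
    linarith
  have h13 : p * L ≤ p ^ 2 * L := mul_le_mul_of_nonneg_right (by nlinarith) hL0.le
  have h14 : L ≤ p ^ 2 * L := le_mul_of_one_le_left hL0.le (by nlinarith)
  have h15 : p ≤ 2 * (p * L) := by nlinarith
  have h16 : p ^ 2 ≤ 2 * (p ^ 2 * L) := by nlinarith
  nlinarith

end SampleBounds

/-! ### Sparsification in each range of the parameters -/

section Regimes

theorem exists_sparse_low : ∃ C : ℝ, 0 < C ∧ ∀ {n m : ℕ} (_ : 2 ≤ n) {p : ℝ} (hp : 1 ≤ p)
    (_ : p ≤ 2) (N : Fin m → Seminorm ℝ (EuclideanSpace ℝ (Fin n)))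
    (N' : Seminorm ℝ (EuclideanSpace ℝ (Fin n))) {K S : ℝ} (_ : 1 < K) (_ : 1 < S)
    (_ : IsUniformlySmooth p S N') (_ : ∀ x, N' x ≤ lpSum p hp N x)
    (_ : ∀ x, lpSum p hp N x ≤ K * N' x) (_ : K * S ≤ 44 * (n + p)) {ε : ℝ} (_ : 0 < ε)
    (_ : ε < 1), ∃ w : Fin m → ℝ, (∀ i, 0 ≤ w i) ∧
      ((Finset.univ.filter fun i => w i ≠ 0).card : ℝ) ≤ C * sizeLow n p K S ε ∧
      ∀ x, |lpSum p hp N x ^ p - ∑ i, w i * N i x ^ p| ≤ ε * lpSum p hp N x ^ p := by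
  -- Here q = p, so the power of α disappears and l = 1 suffices. The factor 8 comes from p² ≤ 4 and
  -- (n + p)/p ≤ 2n, and 9216 = 96² from 24 log(2s) ≤ 96 κ log(n/ε).
  obtain ⟨κ, C, hκ, hC, H⟩ := exists_sample_size 40 (112896 * 8 * 9216)
  refine ⟨C, hC, fun {n m} hn {p} hp hp2 N N' {K S} hK hS hsm h1 h2 hKS {ε} hε0 hε1 => ?_⟩
  obtain ⟨hl1, hl2, -, hl4, -, -⟩ := log_div_bounds hn hε0 hε1
  obtain ⟨s, hs2, hsC, hsκ, hslog⟩ := H (sizeLow n p K S ε) (p ^ 2) (Real.log (n / ε))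
    (sizeLow_ge hn hp hp2 hK hS hε0 hε1) (one_le_pow₀ hp) (by linarith)
    (log_sizeLow_le hn hp hK hS hε0 hε1 hKS)
  have hn2 : (2 : ℝ) ≤ n := by exact_mod_cast hn
  have hp0 : 0 < p := by linarith
  have hs138 := log_two_mul_ge hs2
  have hexp := two_mul_exp_rpow_le hp ((Real.one_rpow p).le.trans hp)
  obtain ⟨w, hw0, hws, hw⟩ := exists_sparse_of_equivalent hn hp hp hp2 le_rfl N N' hS.le hsm hK.le
    h1 h2 one_pos (by omega : 1 ≤ s) hε0 hε1 rfl (by linarith) (by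
      set L := Real.log (n / ε)
      have hL0 : 0 < L := by linarith
      have hp4 : p ^ 2 ≤ 4 := by nlinarith
      have hnp : (n + p) / p ≤ 2 * n := by
        rw [div_le_iff₀ hp0]
        nlinarith
      have hlog : 24 * Real.log (2 * s) ≤ 96 * κ * L := by
        have : κ * (p ^ 2 * L) ≤ κ * (4 * L) := by gcongr
        linarith
      have hpow : (24 * Real.log (2 * s)) ^ p ≤ (96 * κ) ^ 2 * L ^ p := by
        calc (24 * Real.log (2 * s)) ^ p ≤ (96 * κ * L) ^ p := by gcongr
          _ = (96 * κ) ^ p * L ^ p := Real.mul_rpow (by positivity) hL0.le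
          _ ≤ (96 * κ) ^ (2 : ℝ) * L ^ p := by
            gcongr
            linarith
          _ = _ := by rw [Real.rpow_two]
      rw [sub_self, Real.rpow_zero, mul_one, div_self hp0.ne', Real.rpow_one]
      calc 112896 * p ^ 2 * Real.log n ^ 2 * (S ^ p * (K ^ p * ((n + p) / p))) *
            (24 * Real.log (2 * s)) ^ p
          ≤ 112896 * 4 * Real.log n ^ 2 * (S ^ p * (K ^ p * (2 * n))) *
            ((96 * κ) ^ 2 * L ^ p) := by gcongr
        _ = ε ^ 2 * (112896 * 8 * 9216 * κ ^ 2 * sizeLow n p K S ε) := by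
          unfold sizeLow
          rw [Real.mul_rpow (by linarith) hL0.le]
          field_simp
          ring
        _ ≤ ε ^ 2 * s := by gcongr)
  exact ⟨w, hw0, le_trans (by exact_mod_cast hws) hsC, hw⟩

theorem exists_sparse_high : ∃ C : ℝ, 0 < C ∧ ∀ {n m : ℕ} (_ : 2 ≤ n) {p : ℝ} (hp : 1 ≤ p)
    (_ : 2 ≤ p) (N : Fin m → Seminorm ℝ (EuclideanSpace ℝ (Fin n)))
    (N' : Seminorm ℝ (EuclideanSpace ℝ (Fin n))) {K S : ℝ} (_ : 1 < K) (_ : 1 < S)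
    (_ : IsUniformlySmooth 2 S N') (_ : ∀ x, N' x ≤ lpSum p hp N x)
    (_ : ∀ x, lpSum p hp N x ≤ K * N' x) (_ : K * S ≤ 44 * (n + p)) {ε : ℝ} (_ : 0 < ε)
    (_ : ε < 1), ∃ w : Fin m → ℝ, (∀ i, 0 ≤ w i) ∧
      ((Finset.univ.filter fun i => w i ≠ 0).card : ℝ) ≤ C * sizeHigh n p K S ε ∧
      ∀ x, |lpSum p hp N x ^ p - ∑ i, w i * N i x ^ p| ≤ ε * lpSum p hp N x ^ p := by
  obtain ⟨B, hB0, hB⟩ := exists_pow_four_mul_rpow_le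
  obtain ⟨κ, C, hκ, hC, H⟩ := exists_sample_size 40 (112896 * 576 * B)
  refine ⟨C, hC, fun {n m} hn {p} hp hp2 N N' {K S} hK hS hsm h1 h2 hKS {ε} hε0 hε1 => ?_⟩
  obtain ⟨hl1, hl2, -, hl4, -, -⟩ := log_div_bounds hn hε0 hε1
  obtain ⟨s, hs2, hsC, hsκ, hslog⟩ := H (sizeHigh n p K S ε) (p ^ 2) (Real.log (n / ε))
    (sizeHigh_ge hn hp2 hK hS hε0 hε1) (one_le_pow₀ hp) (by linarith)
    (log_sizeHigh_le hn hp2 hK hS hε0 hε1 hKS)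
  have hn2 : (2 : ℝ) ≤ n := by exact_mod_cast hn
  have hp0 : 0 < p := by linarith
  have hs138 := log_two_mul_ge hs2
  have hsq : 1 ≤ Real.sqrt p := Real.one_le_sqrt.2 hp
  have hsq2 : Real.sqrt p ^ (2 : ℝ) ≤ p := by rw [Real.rpow_two, Real.sq_sqrt hp0.le]
  have hα : (2 * Real.exp (Real.sqrt p ^ (2 : ℝ))) ^ (1 / p) * (4 / Real.sqrt p)
      ≤ 22 / Real.sqrt p := by
    calc _ ≤ 11 / 2 * (4 / Real.sqrt p) := by
          gcongr
          exact two_mul_exp_rpow_le hp hsq2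
      _ = _ := by ring
  have hα22 : 22 / Real.sqrt p ≤ 22 := div_le_self (by norm_num) hsq
  -- The choice l = √p keeps exp(l²)^(1/p) = e bounded while 4/l shrinks, so α ≤ 22/√p and α^(p-2)
  -- cancels the p⁴ coming from log(2s)².
  obtain ⟨w, hw0, hws, hw⟩ := exists_sparse_of_equivalent hn hp one_le_two le_rfl hp2 N N' hS.le hsm
    hK.le h1 h2 (by linarith : 0 < Real.sqrt p) (by omega : 1 ≤ s) hε0 hε1 rfl (by linarith) (by
      set L := Real.log (n / ε)
      have hL0 : 0 < L := by linarith
      set α := (2 * Real.exp (Real.sqrt p ^ (2 : ℝ))) ^ (1 / p) * (4 / Real.sqrt p)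
      have hα0 : 0 ≤ α := by positivity
      have hαp : p ^ 4 * α ^ (p - 2) ≤ B := by
        refine le_trans ?_ (hB p hp2)
        gcongr
      rw [Real.rpow_two]
      calc 112896 * p ^ 2 * Real.log n ^ 2 * (S ^ p * (K ^ p * ((n + p) / 2) ^ (p / 2))) *
            α ^ (p - 2) * (24 * Real.log (2 * s)) ^ 2
          ≤ 112896 * p ^ 2 * Real.log n ^ 2 * (S ^ p * (K ^ p * ((n + p) / 2) ^ (p / 2))) *
            α ^ (p - 2) * (24 * (κ * (p ^ 2 * L))) ^ 2 := by gcongr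
        _ = 112896 * 576 * p ^ 2 * Real.log n ^ 2 *
            (S ^ p * (K ^ p * ((n + p) / 2) ^ (p / 2))) * κ ^ 2 * L ^ 2 *
            (p ^ 4 * α ^ (p - 2)) := by ring
        _ ≤ 112896 * 576 * p ^ 2 * Real.log n ^ 2 *
            (S ^ p * (K ^ p * ((n + p) / 2) ^ (p / 2))) * κ ^ 2 * L ^ 2 * B := by gcongr
        _ = ε ^ 2 * (112896 * 576 * B * κ ^ 2 * sizeHigh n p K S ε) := by
          unfold sizeHigh
          field_simp
          rfl
        _ ≤ ε ^ 2 * s := by gcongr)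
  exact ⟨w, hw0, le_trans (by exact_mod_cast hws) hsC, hw⟩

theorem exists_sparse_crude : ∃ C : ℝ, 0 < C ∧ ∀ {n m : ℕ} (_ : 2 ≤ n) {p : ℝ} (hp : 1 ≤ p)
    (N : Fin m → Seminorm ℝ (EuclideanSpace ℝ (Fin n))) {ε : ℝ} (_ : 0 < ε) (_ : ε < 1),
    ∃ w : Fin m → ℝ, (∀ i, 0 ≤ w i) ∧
      ((Finset.univ.filter fun i => w i ≠ 0).card : ℝ) ≤ C * sizeCrude n p ε ∧
      ∀ x, |lpSum p hp N x ^ p - ∑ i, w i * N i x ^ p| ≤ ε * lpSum p hp N x ^ p := by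
  obtain ⟨κ, C, hκ, hC, H⟩ := exists_sample_size 40 (112896 * 24 * 384)
  refine ⟨C, hC, fun {n m} hn {p} hp N {ε} hε0 hε1 => ?_⟩
  obtain ⟨hl1, hl2, -, hl4, -, -⟩ := log_div_bounds hn hε0 hε1
  obtain ⟨s, hs2, hsC, hsκ, hslog⟩ := H (sizeCrude n p ε) (p ^ 2) (Real.log (n / ε))
    (sizeCrude_ge hn hp hε0 hε1) (one_le_pow₀ hp) (by linarith) (log_sizeCrude_le hn hp hε0 hε1)
  have hn2 : (2 : ℝ) ≤ n := by exact_mod_cast hn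
  have hp0 : 0 < p := by linarith
  have hs138 := log_two_mul_ge hs2
  have hexp := two_mul_exp_rpow_le hp ((Real.one_rpow (1 : ℝ)).le.trans hp)
  -- N itself serves as the smooth seminorm, with q = K = S = l = 1. In 44^p = 2^p · 22^p, the
  -- factor 22^p bounds the power of α and 2^p absorbs p⁴.
  obtain ⟨w, hw0, hws, hw⟩ := exists_sparse_of_equivalent hn hp le_rfl one_le_two hp N
    (lpSum p hp N) le_rfl (isUniformlySmooth_one _) le_rfl (fun x => le_rfl)
    (fun x => (one_mul _).ge) one_pos (by omega : 1 ≤ s) hε0 hε1 rfl (by linarith) (by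
      set L := Real.log (n / ε)
      have hL0 : 0 < L := by linarith
      set α := (2 * Real.exp ((1 : ℝ) ^ (1 : ℝ))) ^ (1 / p) * (4 / 1) with hαdef
      have hα0 : 0 ≤ α := by positivity
      have hα : α ≤ 22 := by linarith
      have hαp : α ^ (p - 1) ≤ 22 ^ p :=
        calc α ^ (p - 1) ≤ 22 ^ (p - 1) := Real.rpow_le_rpow hα0 hα (by linarith)
          _ ≤ 22 ^ p := Real.rpow_le_rpow_of_exponent_le (by norm_num) (by linarith)
      have h44 : (44 : ℝ) ^ p = 2 ^ p * 22 ^ p := by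
        rw [← Real.mul_rpow (by norm_num) (by norm_num)]
        norm_num
      have hκ2 : κ ≤ κ ^ 2 := by nlinarith
      rw [Real.one_rpow, one_mul, one_mul, div_one, div_one, Real.rpow_one]
      calc 112896 * p ^ 2 * Real.log n ^ 2 * (n + p) ^ p * α ^ (p - 1) * (24 * Real.log (2 * s))
          ≤ 112896 * p ^ 2 * Real.log n ^ 2 * (n + p) ^ p * 22 ^ p *
            (24 * (κ ^ 2 * (p ^ 2 * L))) := by
              have : κ * (p ^ 2 * L) ≤ κ ^ 2 * (p ^ 2 * L) := by gcongr
              gcongr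
              linarith
        _ = 112896 * 24 * Real.log n ^ 2 * (n + p) ^ p * 22 ^ p * κ ^ 2 * L * p ^ 4 := by ring
        _ ≤ 112896 * 24 * Real.log n ^ 2 * (n + p) ^ p * 22 ^ p * κ ^ 2 * L * (384 * 2 ^ p) := by
          gcongr
          exact pow_four_le_two_rpow hp0.le
        _ = ε ^ 2 * (112896 * 24 * 384 * κ ^ 2 * sizeCrude n p ε) := by
          unfold sizeCrude
          rw [h44]
          field_simp
          rfl
        _ ≤ ε ^ 2 * s := by gcongr)
  exact ⟨w, hw0, le_trans (by exact_mod_cast hws) hsC, hw⟩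

/-- The assumption turns 44^p (n + p)^p into at most (K S)^p. The single logarithm L = log(n/ε) is
at most 2n L^p because L ≥ 0.69 and p ≤ 2. -/
theorem sizeCrude_le_sizeLow {n : ℕ} (hn : 2 ≤ n) {p K S ε : ℝ} (hp : 1 ≤ p) (hp2 : p ≤ 2)
    (hK : 1 < K) (hS : 1 < S) (hε0 : 0 < ε) (hε1 : ε < 1) (hKS : 44 * (n + p) ≤ K * S) :
    sizeCrude n p ε ≤ 2 * sizeLow n p K S ε := by
  obtain ⟨h1, h2, h3, h4, -, -⟩ := log_div_bounds hn hε0 hε1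
  have hn2 : (2 : ℝ) ≤ n := by exact_mod_cast hn
  set L := Real.log (n / ε)
  have hL0 : 0 < L := by linarith
  have h5 : (44 : ℝ) ^ p * (n + p) ^ p ≤ K ^ p * S ^ p := by
    rw [← Real.mul_rpow (by norm_num) (by linarith), ← Real.mul_rpow (by linarith) (by linarith)]
    exact Real.rpow_le_rpow (by positivity) hKS (by linarith)
  have h6 : L ≤ n * (2 * L ^ p) := by
    have : L ^ p = L ^ (p - 1) * L := by
      rw [Real.rpow_sub_one hL0.ne', div_mul_cancel₀ _ hL0.ne']
    have h7 := rpow_ge_of_le_two h4 (by linarith : 0 ≤ p - 1) (by linarith)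
    rw [this]
    have h8 : 1 ≤ n * (2 * L ^ (p - 1)) := by nlinarith
    nlinarith
  unfold sizeCrude sizeLow
  rw [Real.mul_rpow (by linarith) hL0.le]
  calc 44 ^ p * (n + p) ^ p * L * Real.log n ^ 2 / ε ^ 2
      ≤ K ^ p * S ^ p * (n * (2 * L ^ p)) * Real.log n ^ 2 / ε ^ 2 := by gcongr
    _ = _ := by ring

theorem sizeCrude_le_sizeHigh {n : ℕ} (hn : 2 ≤ n) {p K S ε : ℝ} (hp2 : 2 ≤ p)
    (hK : 1 < K) (hS : 1 < S) (hε0 : 0 < ε) (hε1 : ε < 1) (hKS : 44 * (n + p) ≤ K * S) :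
    sizeCrude n p ε ≤ 2 * sizeHigh n p K S ε := by
  obtain ⟨h1, h2, h3, h4, -, -⟩ := log_div_bounds hn hε0 hε1
  have hn2 : (2 : ℝ) ≤ n := by exact_mod_cast hn
  set L := Real.log (n / ε)
  have hL0 : 0 < L := by linarith
  have h5 : (44 : ℝ) ^ p * (n + p) ^ p ≤ K ^ p * S ^ p := by
    rw [← Real.mul_rpow (by norm_num) (by linarith), ← Real.mul_rpow (by linarith) (by linarith)]
    exact Real.rpow_le_rpow (by positivity) hKS (by linarith)
  have h6 : L ≤ 2 * L ^ 2 := by nlinarith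
  have hG : 1 ≤ p ^ 2 * (((n : ℝ) + p) / 2) ^ (p / 2) :=
    one_le_mul_of_one_le_of_one_le (one_le_pow₀ (by linarith))
      (Real.one_le_rpow (by linarith) (by linarith))
  unfold sizeCrude sizeHigh
  calc 44 ^ p * (n + p) ^ p * L * Real.log n ^ 2 / ε ^ 2
      = 44 ^ p * (n + p) ^ p * 1 * L * Real.log n ^ 2 / ε ^ 2 := by ring
    _ ≤ K ^ p * S ^ p * (p ^ 2 * ((n + p) / 2) ^ (p / 2)) * (2 * L ^ 2) *
        Real.log n ^ 2 / ε ^ 2 := by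
      gcongr
    _ = _ := by ring

theorem ofReal_sizeLow_le {n : ℕ} (hn : 2 ≤ n) {p K S ε : ℝ} (hp : 1 ≤ p)
    (hK : 1 < K) (hS : 1 < S) (hε0 : 0 < ε) (hε1 : ε < 1) :
    ENNReal.ofReal (sizeLow n p K S ε) ≤ ENNReal.ofReal (K ^ p / ε ^ 2 * n) *
      (ENNReal.ofReal S * klsConst n * ENNReal.ofReal (Real.log (n / ε))) ^ p *
      ENNReal.ofReal (Real.log n) ^ 2 := by
  obtain ⟨h1, h2, h3, h4, -, -⟩ := log_div_bounds hn hε0 hε1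
  have hkls := one_le_klsConst (by omega : 1 ≤ n)
  have hS0 : 0 < S := by linarith
  have hL0 : 0 < Real.log (n / ε) := by linarith
  unfold sizeLow
  rw [ENNReal.ofReal_mul (by positivity), ENNReal.ofReal_mul (by positivity),
    ENNReal.ofReal_pow (by linarith), ← ENNReal.ofReal_rpow_of_nonneg (by positivity) (by linarith),
    ENNReal.ofReal_mul hS0.le]
  gcongr
  exact le_mul_of_one_le_right zero_le hkls

theorem ofReal_sizeHigh_le {n : ℕ} (hn : 2 ≤ n) {p K S ε : ℝ} (hp : 1 ≤ p)
    (hK : 1 < K) (hS : 1 < S) (hε0 : 0 < ε) (hε1 : ε < 1) :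
    ENNReal.ofReal (sizeHigh n p K S ε) ≤
      ENNReal.ofReal (K ^ p * S ^ p * p ^ 2 / ε ^ 2 * ((n + p) / 2) ^ (p / 2)) *
      (klsConst n * ENNReal.ofReal (Real.log (n / ε))) ^ 2 * ENNReal.ofReal (Real.log n) ^ 2 := by
  obtain ⟨h1, h2, h3, h4, -, -⟩ := log_div_bounds hn hε0 hε1
  have hkls := one_le_klsConst (by omega : 1 ≤ n)
  have hL0 : 0 < Real.log (n / ε) := by linarith
  unfold sizeHigh
  rw [ENNReal.ofReal_mul (by positivity), ENNReal.ofReal_mul (by positivity),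
    ENNReal.ofReal_pow (p := Real.log n) (by linarith), ENNReal.ofReal_pow hL0.le]
  gcongr
  exact le_mul_of_one_le_left zero_le hkls

end Regimes

/-! ### Assembling the theorem -/

theorem isSparseApprox_of_card_le {n m : ℕ} {p : ℝ} {hp : 1 ≤ p}
    {N : Fin m → Seminorm ℝ (EuclideanSpace ℝ (Fin n))} {ε c X : ℝ} {C : ℝ≥0} {T : ℝ≥0∞}
    (hX : 0 ≤ X) (hcC : c ≤ C) (hT : ENNReal.ofReal X ≤ T)
    (h : ∃ w : Fin m → ℝ, (∀ i, 0 ≤ w i) ∧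
      ((Finset.univ.filter fun i => w i ≠ 0).card : ℝ) ≤ c * X ∧
      ∀ x, |lpSum p hp N x ^ p - ∑ i, w i * N i x ^ p| ≤ ε * lpSum p hp N x ^ p) :
    ∃ w : Fin m → ℝ, IsSparseApprox p hp N (C * T) ε w := by
  obtain ⟨w, hw0, hws, hw⟩ := h
  refine ⟨w, hw0, ?_, hw⟩
  calc ((Finset.univ.filter fun i => w i ≠ 0).card : ℝ≥0∞)
      = ENNReal.ofReal ((Finset.univ.filter fun i => w i ≠ 0).card : ℝ) :=
        (ENNReal.ofReal_natCast _).symm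
    _ ≤ ENNReal.ofReal (C * X) :=
        ENNReal.ofReal_le_ofReal (hws.trans (mul_le_mul_of_nonneg_right hcC hX))
    _ = C * ENNReal.ofReal X := by rw [ENNReal.ofReal_mul C.coe_nonneg, ENNReal.ofReal_coe_nnreal]
    _ ≤ C * T := by gcongr

theorem theorem2 :
    ∃ C : ℝ≥0, ∀ (n m : ℕ) (_ : 2 ≤ n) (p : ℝ) (hp : 1 ≤ p)
      (N : Fin m → Seminorm ℝ (EuclideanSpace ℝ (Fin n)))
      (K S : ℝ) (_ : 1 < K) (_ : 1 < S)
      (N' : Seminorm ℝ (EuclideanSpace ℝ (Fin n)))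
      (_ : IsUniformlySmooth (min p 2) S N') (_ : IsKEquivalent K (lpSum p hp N) N')
      (ε : ℝ) (_ : 0 < ε) (_ : ε < 1),
      (p ≤ 2 → ∃ w : Fin m → ℝ, IsSparseApprox p hp N
        (C * (ENNReal.ofReal (K ^ p / ε ^ 2 * n) *
          (ENNReal.ofReal S * klsConst n * ENNReal.ofReal (Real.log (n / ε))) ^ p *
          ENNReal.ofReal (Real.log n) ^ 2)) ε w) ∧
      (2 ≤ p → ∃ w : Fin m → ℝ, IsSparseApprox p hp N
        (C * (ENNReal.ofReal (K ^ p * S ^ p * p ^ 2 / ε ^ 2 * ((n + p) / 2) ^ (p / 2)) *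
          (klsConst n * ENNReal.ofReal (Real.log (n / ε))) ^ 2 *
          ENNReal.ofReal (Real.log n) ^ 2)) ε w) := by
  obtain ⟨C₁, hC₁, H₁⟩ := exists_sparse_low
  obtain ⟨C₂, hC₂, H₂⟩ := exists_sparse_high
  obtain ⟨C₃, hC₃, H₃⟩ := exists_sparse_crude
  have hC : ((C₁ + C₂ + C₃ * 2).toNNReal : ℝ) = C₁ + C₂ + C₃ * 2 :=
    Real.coe_toNNReal _ (by positivity)
  refine ⟨(C₁ + C₂ + C₃ * 2).toNNReal, fun n m hn p hp N K S hK hS N' hsm hKN ε hε0 hε1 => ?_⟩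
  obtain ⟨M, hM, hMN, hNM⟩ := hKN.exists_normalized hsm
  refine ⟨fun hp2 => ?_, fun hp2 => ?_⟩
  · have hX := sizeLow_ge hn hp hp2 hK hS hε0 hε1
    have hT := ofReal_sizeLow_le hn hp hK hS hε0 hε1
    rw [min_eq_left hp2] at hM
    -- For large K S the smoothness hypothesis is discarded, and the bound from the triangle
    -- inequality is already below the target.
    rcases le_total (K * S) (44 * (n + p)) with hKS | hKS
    · exact isSparseApprox_of_card_le (c := C₁) (by linarith) (by linarith) hT
        (H₁ hn hp hp2 N M hK hS hM hMN hNM hKS hε0 hε1)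
    · obtain ⟨w, hw0, hws, hw⟩ := H₃ hn hp N hε0 hε1
      refine isSparseApprox_of_card_le (c := C₃ * 2) (by linarith) (by linarith) hT
        ⟨w, hw0, hws.trans ?_, hw⟩
      rw [mul_assoc]
      gcongr
      exact sizeCrude_le_sizeLow hn hp hp2 hK hS hε0 hε1 hKS
  · have hX := sizeHigh_ge hn hp2 hK hS hε0 hε1
    have hT := ofReal_sizeHigh_le hn hp hK hS hε0 hε1
    rw [min_eq_right hp2] at hM
    rcases le_total (K * S) (44 * (n + p)) with hKS | hKS
    · exact isSparseApprox_of_card_le (c := C₂) (by linarith) (by linarith) hT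
        (H₂ hn hp hp2 N M hK hS hM hMN hNM hKS hε0 hε1)
    · obtain ⟨w, hw0, hws, hw⟩ := H₃ hn hp N hε0 hε1
      refine isSparseApprox_of_card_le (c := C₃ * 2) (by linarith) (by linarith) hT
        ⟨w, hw0, hws.trans ?_, hw⟩
      rw [mul_assoc]
      gcongr
      exact sizeCrude_le_sizeHigh hn hp2 hK hS hε0 hε1 hKS
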